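/- **Setting.** Let $d,n,m\ge 1$ be integers, $L,R>0$, $\beta\ge 0$. Let $\mathcal X\subset\mathbb R^d$ be nonempty, compact and convex with $\|x-x'\|\le R$ for all $x,x'\in\mathcal X$, let $\mathcal Z$ be a measurable space, and let $f:\mathcal X\times\mathcal Z\to\mathbb R$ be such that for each $z\in\mathcal Z$ the function $f(\cdot,z)$ is convex, $L$-Lipschitz and $\beta$-smooth on $\mathcal X$ (differentiable with $\beta$-Lipschitz gradient $\nabla f(\cdot,z)$). For a probability distribution $P$ on $\mathcal Z$ put $F(x)=\mathbb E_{z\sim P}f(x,z)$ and $F^*=\min_{x\in\mathcal X}F(x)$. A dataset $\mathcal D=(Z_1,\dots,Z_n)\in(\mathcal Z^m)^n$ consists of $n$ users with $m$ samples each. A randomized algorithm $\mathcal A$ is $(\varepsilon,\delta)$-user-level DP if $\mathbb P(\mathcal A(\mathcal D)\in S)\le e^{\varepsilon}\,\mathbb P(\mathcal A(\mathcal D')\in S)+\delta$ for all measurable $S$ and all $\mathcal D,\mathcal D'$ that differ in the data of at most one user. $\Pi_{\mathcal X}$ is the Euclidean projection onto $\mathcal X$. **Algorithm** (parameters $\varepsilon,\delta,p,q,\eta$;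 initial point $x_0\in\mathcal X$). Let $l=\lfloor\log_2 n\rfloor$ and $C=\lceil 100\log(20nme^{\varepsilon}/\delta)/\varepsilon\rceil$. For $i=1,\dots,l$: 1. Let $n_i=(1-2^{-q})n/2^{iq}$, $\eta_i=\eta/2^{pi}$, $N_i=\lfloor n_i/C\rfloor$, $T_i=N_im$, $\tau_i=1000\,\eta_iL\sqrt{T_i}\log(ndm)$ and $\sigma_i=100\,\tau_i\log^2(n/\delta)/(\varepsilon C)$. 2. Take $C$ disjoint groups $D_{i,1},\dots,D_{i,C}$ of $N_i$ users each, none of them used in an earlier phase. (The groups, and the order in which samples are read, are chosen independently of the data, but otherwise arbitrarily.) 3. For each $j$ let $\tilde x_{i,j}$ be the average iterate of $T_i$ steps of one-pass projected SGD ($x\leftarrow\Pi_{\mathcal X}(x-\eta_i\nabla f(x,z))$) over the samples of $D_{i,j}$, started at $x_{i-1}$ (and $\tilde x_{i,j}=x_{i-1}$ if $T_i=0$). 4. Let $s_i=\frac1C\sum_{j,j'}\mathbf 1(\|\tilde x_{i,j}-\tilde x_{i,j'}\|\le\tau_i)$ and $\hat s_i=s_i+\mathrm{Lap}(20/\varepsilon)$.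 If $\hat s_i<4C/5$, halt and output $\Pi_{\mathcal X}(0)$ (which is $0$ if $0\in\mathcal X$). 5. Otherwise let $h_{i,j}=\sum_{j'}\mathbf 1(\|\tilde x_{i,j}-\tilde x_{i,j'}\|\le 2\tau_i)$ and, independently for each $j$, put $j$ into $\mathcal S_i$ with probability $0$ if $h_{i,j}<C/2$, $1$ if $h_{i,j}\ge 2C/3$, and $(h_{i,j}-C/2)/(C/6)$ otherwise. 6. Let $\tilde x_i=\frac1{|\mathcal S_i|}\sum_{j\in\mathcal S_i}\tilde x_{i,j}$ (with $\tilde x_i=0$ if $\mathcal S_i=\emptyset$) and $x_i=\Pi_{\mathcal X}(\tilde x_i+\zeta_i)$ with $\zeta_i\sim\mathcal N(0,\sigma_i^2I_d)$. If it does not halt, the algorithm outputs $x_l$. All noise is independent. In the theorem, $x_l$ denotes the output in either case. **Theorem.** There is an absolute constant $k\in\mathbb N$ such that for all $J>0$, $q>0$ and $\delta_0<1$ there is a constant $K=K(J,q,\delta_0)>0$ with the following property. Let $0<\varepsilon\le 10$, $0<\delta<1$, $$n^{1-q}\ \ge\ \frac{100}{1-2^{-q}}\cdot\frac{\log(n/\delta)}{\varepsilon},\qquad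 m\le n^J,\qquad \beta\le\frac LR\sqrt{dmn\varepsilon},$$ and run the algorithm with $p=J+\tfrac32$ and $\eta=R/(L\sqrt{dmn\varepsilon})$. Then disjoint groups as in step 2 exist, and for every choice of them: * the algorithm is $(\varepsilon,\delta)$-user-level DP, with output in $\mathcal X$; * it makes at most $nm$ gradient evaluations, on every dataset and for every outcome of the noise; * if $\delta\le\delta_0$ and the $nm$ samples are i.i.d. from $P$, then $$\mathbb E F(x_l)-F^*\ \le\ LR\cdot K\left(1+\log\frac{nmd}{\delta}\right)^{k}\left(\frac1{\sqrt{nm\varepsilon}}+\frac{\sqrt{d\log(1/\delta)}}{\sqrt n\,\varepsilon\sqrt m}\right).$$ -/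

import Mathlib

open MeasureTheory ProbabilityTheory

noncomputable section

namespace PhasedSGD

/-- Euclidean space `ℝ^d` with the `ℓ₂` norm. -/
abbrev E (d : ℕ) : Type := EuclideanSpace ℝ (Fin d)

/-! ### Gradient-evaluation counting -/

/-- A computation returning a value together with the number of gradient evaluations it made. -/
structure Counted (α : Type) where
  val : α
  grads : ℕ

instance : Monad Counted where
  pure a := ⟨a, 0⟩
  bind x g := ⟨(g x.val).val, x.grads + (g x.val).grads⟩

/-- One stochastic gradient evaluation. All access to the gradient goes through this call. -/
def queryGrad {d : ℕ} {Z : Type*} (G : E d → Z → E d) (x : E d) (z : Z) : Counted (E d) :=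
  ⟨G x z, 1⟩

/-- Run a finite family of computations and collect the results; the costs add up. -/
def Counted.all {C : ℕ} {α : Type} (f : Fin C → Counted α) : Counted (Fin C → α) :=
  ⟨fun j => (f j).val, ∑ j, (f j).grads⟩

/-! ### Projection, one-pass projected SGD -/

open Classical in
/-- Euclidean projection `Π_X(u) = argmin_{x ∈ X} ‖u - x‖`. The minimizer exists and is unique for
nonempty, closed, convex `X`. -/
def proj {d : ℕ} (X : Set (E d)) (u : E d) : E d :=
  if h : ∃ x ∈ X, ∀ y ∈ X, ‖u - x‖ ≤ ‖u - y‖ then h.choose else u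

/-- Projected SGD on a list of samples, from the current iterate `x`; `s` accumulates the sum of the
iterates. Every sample is used in exactly one step. -/
def sgdLoop {d : ℕ} {Z : Type*} (X : Set (E d)) (G : E d → Z → E d) (η : ℝ) :
    List Z → E d → E d → Counted (E d)
  | [], _, s => pure s
  | z :: zs, x, s => do
      let g ← queryGrad G x z
      sgdLoop X G η zs (proj X (x - η • g)) (s + x)

/-- The average `(x_0 + ... + x_{T-1}) / T` of the iterates of `T` steps of one-pass projected SGD
started at `x_0`, where `T` is the number of samples. Without samples it returns `x_0`. -/
def sgd {d : ℕ} {Z : Type*} (X : Set (E d)) (G : E d → Z → E d) (η : ℝ)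
    (zs : List Z) (x₀ : E d) : Counted (E d) :=
  match zs with
  | [] => pure x₀
  | zs => do
      let s ← sgdLoop X G η zs x₀ 0
      pure ((zs.length : ℝ)⁻¹ • s)

/-! ### Parameters of the algorithm -/

/-- Input parameters: `n` users with `m` samples each, privacy parameters `ε, δ`, the exponents
`p, q`, the base stepsize `η` and the Lipschitz constant `L`. -/
structure Params (d : ℕ) where
  n : ℕ
  m : ℕ
  ε : ℝ
  δ : ℝ
  p : ℝ
  q : ℝ
  η : ℝ
  L : ℝ

namespace Params

variable {d : ℕ} (P : Params d)

/-- Number of phases, `⌊log₂ n⌋`. -/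
def l : ℕ := Nat.log 2 P.n

/-- Number of groups per phase, `100 log(20 n m e^ε / δ) / ε`, rounded up. -/
def C : ℕ := ⌈100 * Real.log (20 * P.n * P.m * Real.exp P.ε / P.δ) / P.ε⌉₊

/-- Nominal number of users `n_i = (1 - 2^{-q}) n / 2^{iq}` of phase `i` (`i = 1, ..., l`). -/
def users (i : ℕ) : ℝ := (1 - (1 / 2 : ℝ) ^ P.q) * P.n / (2 : ℝ) ^ (i * P.q)

/-- Number of users per group in phase `i`, `n_i / C`, rounded down. -/
def N (i : ℕ) : ℕ := ⌊P.users i / P.C⌋₊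

/-- Number of SGD steps per group in phase `i`. -/
def T (i : ℕ) : ℕ := P.N i * P.m

/-- Stepsize `η_i = η / 2^{pi}`. -/
def step (i : ℕ) : ℝ := P.η / (2 : ℝ) ^ (P.p * i)

/-- Concentration radius `τ_i`. -/
def τ (i : ℕ) : ℝ :=
  1000 * P.step i * P.L * Real.sqrt (P.T i) * Real.log ((P.n : ℝ) * d * P.m)

/-- Standard deviation `σ_i` of the Gaussian output perturbation. -/
def σ (i : ℕ) : ℝ := 100 * P.τ i * Real.log (P.n / P.δ) ^ 2 / (P.ε * P.C)

end Params

/-- A dataset: `n` users, each holding `m` samples. -/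
abbrev Dataset (Z : Type*) (n m : ℕ) : Type _ := Fin n → Fin m → Z

/-- How the data are drawn. For `i : Fin l` (phase `i + 1` in one-based counting) and each group
`j`, `user i j` lists the users of the group; the groups of all phases are pairwise disjoint.
`order i j` is the order in which the one-pass SGD run reads the samples of the group. -/
structure Schedule {d : ℕ} (P : Params d) where
  user : (i : Fin P.l) → Fin P.C → Fin (P.N (i + 1)) → Fin P.n
  user_injective : Function.Injective
    (fun a : (Σ i : Fin P.l, Fin P.C × Fin (P.N (i + 1))) => user a.1 a.2.1 a.2.2)
  order : (i : Fin P.l) → Fin P.C → (Fin (P.T (i + 1)) ≃ Fin (P.N (i + 1)) × Fin P.m)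

/-- The samples of group `j` of phase `i`, in the order in which SGD reads them. -/
def Schedule.samples {d : ℕ} {P : Params d} {Z : Type*} (s : Schedule P)
    (D : Dataset Z P.n P.m) (i : Fin P.l) (j : Fin P.C) : List Z :=
  List.ofFn fun t => D (s.user i j (s.order i j t).1) (s.order i j t).2

/-! ### Randomness of the algorithm -/

/-- The Laplace distribution with scale `b`, of density `exp (-|x| / b) / (2 b)`. -/
def laplace (b : ℝ) : Measure ℝ :=
  volume.withDensity fun x => ENNReal.ofReal (1 / (2 * b) * Real.exp (-|x| / b))

/-- The noise of one phase: the Laplace noise, one uniform variable per group (used for the random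
selection of that group), and a standard Gaussian vector. -/
abbrev PhaseNoise {d : ℕ} (P : Params d) : Type := ℝ × (Fin P.C → ℝ) × E d

abbrev Noise {d : ℕ} (P : Params d) : Type := Fin P.l → PhaseNoise P

/-- Law of the noise of one phase; all components are independent. -/
def phaseNoiseLaw {d : ℕ} (P : Params d) : Measure (PhaseNoise P) :=
  (laplace (20 / P.ε)).prod
    ((Measure.pi fun _ => volume.restrict (Set.Icc (0 : ℝ) 1)).prod (stdGaussian (E d)))

/-- Law of all the noise; the phases are independent. -/
def noiseLaw {d : ℕ} (P : Params d) : Measure (Noise P) :=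
  Measure.pi fun _ => phaseNoiseLaw P

/-! ### The algorithm -/

section Selection

variable {d C : ℕ}

open Classical in
/-- Concentration score `(1/C) ∑_{j,j'} 1(‖x_j - x_{j'}‖ ≤ τ)`. -/
def concentrationScore (τ : ℝ) (x : Fin C → E d) : ℝ :=
  (1 / (C : ℝ)) * ∑ j, ∑ j', if ‖x j - x j'‖ ≤ τ then (1 : ℝ) else 0

open Classical in
/-- Score `h_j = ∑_{j'} 1(‖x_j - x_{j'}‖ ≤ 2 τ)`. -/
def score (τ : ℝ) (x : Fin C → E d) (j : Fin C) : ℝ :=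
  ∑ j', if ‖x j - x j'‖ ≤ 2 * τ then (1 : ℝ) else 0

open Classical in
/-- Probability with which a point of score `h` is kept. -/
def keepProb (C : ℕ) (h : ℝ) : ℝ :=
  if h < (C : ℝ) / 2 then 0
  else if 2 * (C : ℝ) / 3 ≤ h then 1
  else (h - (C : ℝ) / 2) / ((C : ℝ) / 6)

open Classical in
/-- The kept indices; `u j`, uniform on `[0, 1]`, decides on index `j`. -/
def kept (τ : ℝ) (x : Fin C → E d) (u : Fin C → ℝ) : Finset (Fin C) :=
  Finset.univ.filter fun j => u j < keepProb C (score τ x j)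

end Selection

open Classical in
/-- Phase `i + 1`, started at `x`. The value `none` means that the algorithm halts. The perturbed
point is projected to `X`, where the loss is defined. -/
def phase {d : ℕ} {Z : Type*} (P : Params d) (s : Schedule P) (X : Set (E d))
    (G : E d → Z → E d) (D : Dataset Z P.n P.m) (i : Fin P.l) (ω : PhaseNoise P) (x : E d) :
    Counted (Option (E d)) := do
  let y ← Counted.all fun j : Fin P.C => sgd X G (P.step (i + 1)) (s.samples D i j) x
  if 4 * (P.C : ℝ) / 5 ≤ concentrationScore (P.τ (i + 1)) y + ω.1 then
    let S := kept (P.τ (i + 1)) y ω.2.1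
    let mean : E d := (S.card : ℝ)⁻¹ • ∑ j ∈ S, y j
    pure (some (proj X (mean + P.σ (i + 1) • ω.2.2)))
  else
    pure none

/-- The first `k` phases. -/
def runPhases {d : ℕ} {Z : Type*} (P : Params d) (s : Schedule P) (X : Set (E d))
    (G : E d → Z → E d) (x₀ : E d) (D : Dataset Z P.n P.m) (ω : Noise P) :
    (k : ℕ) → k ≤ P.l → Counted (Option (E d))
  | 0, _ => pure (some x₀)
  | k + 1, hk => do
      match ← runPhases P s X G x₀ D ω k (Nat.le_of_succ_le hk) with
      | none => pure none
      | some x => phase P s X G D ⟨k, hk⟩ (ω ⟨k, hk⟩) x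

/-- The whole algorithm. After a halt it outputs `0` (more precisely the point of `X` nearest to
`0`, which is `0` itself if `0 ∈ X`). -/
def algorithm {d : ℕ} {Z : Type*} (P : Params d) (s : Schedule P) (X : Set (E d))
    (G : E d → Z → E d) (x₀ : E d) (D : Dataset Z P.n P.m) (ω : Noise P) : Counted (E d) := do
  match ← runPhases P s X G x₀ D ω P.l le_rfl with
  | none => pure (proj X 0)
  | some x => pure x

/-! ### Privacy -/

/-- `(ε, δ)`-user-level differential privacy of the randomized algorithm `A` whose internal
randomness has law `μ`. -/
def IsUserLevelDP {Z Ω O : Type*} [MeasurableSpace Ω] [MeasurableSpace O] {n m : ℕ}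
    (μ : Measure Ω) (A : Dataset Z n m → Ω → O) (ε δ : ℝ) : Prop :=
  (∀ D, Measurable (A D)) ∧
  ∀ D D' : Dataset Z n m, (∃ i, ∀ j, j ≠ i → D j = D' j) →
    ∀ S : Set O, MeasurableSet S →
      μ {ω | A D ω ∈ S} ≤
        ENNReal.ofReal (Real.exp ε) * μ {ω | A D' ω ∈ S} + ENNReal.ofReal δ

/-! ### Stochastic convex optimization -/

/-- The standing assumptions: `X` is a nonempty compact convex set of diameter at most `R`, and
each loss `f(·, z)` is convex, `L`-Lipschitz and `β`-smooth on `X`, with gradient `G(·, z)`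
(unique if `X` has interior points); `f(x, ·)` is integrable and `G(x, ·)` measurable. -/
structure IsSmoothSCO {d : ℕ} {Z : Type*} [MeasurableSpace Z] (X : Set (E d))
    (f : E d → Z → ℝ) (G : E d → Z → E d) (Q : Measure Z) (L R β : ℝ) : Prop where
  nonempty : X.Nonempty
  compact : IsCompact X
  convex : Convex ℝ X
  diam : ∀ x ∈ X, ∀ y ∈ X, ‖x - y‖ ≤ R
  loss_convex : ∀ z, ConvexOn ℝ X fun x => f x z
  loss_lipschitz : ∀ z, ∀ x ∈ X, ∀ y ∈ X, |f x z - f y z| ≤ L * ‖x - y‖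
  loss_gradient : ∀ z, ∀ x ∈ X, HasGradientWithinAt (fun y => f y z) (G x z) X x
  loss_smooth : ∀ z, ∀ x ∈ X, ∀ y ∈ X, ‖G x z - G y z‖ ≤ β * ‖x - y‖
  loss_integrable : ∀ x ∈ X, Integrable (f x) Q
  gradient_measurable : ∀ x ∈ X, Measurable (G x)

/-- Population loss `F(x) = E_{z ∼ Q} f(x, z)`. -/
def popLoss {d : ℕ} {Z : Type*} [MeasurableSpace Z] (f : E d → Z → ℝ) (Q : Measure Z)
    (x : E d) : ℝ := ∫ z, f x z ∂Q

/-- Law of a dataset of `n m` i.i.d. samples from `Q`. -/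
def dataLaw {Z : Type*} [MeasurableSpace Z] (Q : Measure Z) (n m : ℕ) :
    Measure (Dataset Z n m) :=
  Measure.pi fun _ => Measure.pi fun _ => Q

end PhasedSGD

end

noncomputable section

namespace PhasedSGD

open scoped RealInnerProductSpace

/-! ### Euclidean projection -/

section Projection

variable {d : ℕ} {X : Set (E d)}

/-! Privacy needs no composition. The groups of all phases are disjoint, so one user influences at
most one of the `C` averages of one phase; the earlier phases are unaffected and the later ones are
post-processing (`stateAfter_private`). It remains to make a single phase private when one of the
`C` aggregated points changes (`phase_private`). The concentration score moves by at most 2, so the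
Laplace test spends `ε / 10`. If the score is below `3C/5`, passing the test requires Laplace noise
of at least `C/5`, an event of probability at most `δ`. Otherwise some ball of radius `τ` contains
`3C/5` of the points, and with either dataset every kept point lies within `3τ` of its centre. The
keeping probability is `6/C`-Lipschitz in the score, so apart from the changed point only a
logarithmic number of decisions flip, while more than `C/6` points are kept, up to a small failure
probability. The two means therefore differ by `O(τ log(n/δ) / C)`, which the Gaussian noise hides
with the remaining `9ε/10` (`keptMean_noise_le`).

The excess loss is controlled by comparison with an idealized chain without test and selection, in
which each phase perturbs the mean over all groups. Since `η_i β ≤ 1`, a gradient step of a convex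
smooth loss is nonexpansive. An exponential moment of the squared distance between SGD and
population gradient descent from the same point can then be propagated through all steps, so the
average iterate lies within `τ_i / 2` of a deterministic point with overwhelming probability
(`IsTame.exists_sgdAvg_concentration`). Hence all groups agree up to `τ_i`, the test passes, every
point is kept, and the true and the ideal phase coincide (`phaseStep_eq_of_close`). A union bound
over the phases costs only `O(log n / (nm))`.

In the ideal chain, the SGD regret bound for a phase is applied with the unperturbed mean of the
previous phase as comparator. The Gaussian noise then enters through its squared norm, giving `σ_i²
d / (2 η_{i+1} T_{i+1})`, and fresh samples are independent of the comparator. Because `σ_i` is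
proportional to `η_i √T_i`, each such term is at most `η L² d` up to constants and logarithms, and
`η` is chosen so that `η L² d = L R √d / √(nmε)`. After the last phase the noise enters linearly, as
`L σ √d`; the geometric decay of `η_i` with `p = J + 3/2` makes this small, since the phases that
own samples reach an index `k₀` with `2^{k₀}` at least a constant fraction of `n`. Later phases are
empty and do nothing.

The domain may have empty interior, and the losses are controlled on it only. The gradients are
therefore replaced by their components along the span of differences of points of `X`, which changes
no projected step (`sgdAvg_reducedGrad`). Bounds on these components come from directions in which a
slightly shrunken domain has room (`inner_gradient_sub_le`, `inner_gradient_le_of_lipschitz`). -/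

theorem proj_spec (hne : X.Nonempty) (hc : IsCompact X) (u : E d) :
    proj X u ∈ X ∧ ∀ y ∈ X, ‖u - proj X u‖ ≤ ‖u - y‖ := by
  have h : ∃ x ∈ X, ∀ y ∈ X, ‖u - x‖ ≤ ‖u - y‖ := by
    obtain ⟨x, hx, hmin⟩ := hc.exists_isMinOn hne
      (f := fun x => ‖u - x‖) (by fun_prop)
    exact ⟨x, hx, fun y hy => hmin hy⟩
  unfold proj
  rw [dif_pos h]
  exact h.choose_spec

theorem proj_mem (hne : X.Nonempty) (hc : IsCompact X) (u : E d) : proj X u ∈ X :=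
  (proj_spec hne hc u).1

theorem inner_sub_proj_le (hne : X.Nonempty) (hc : IsCompact X) (hX : Convex ℝ X) (u : E d)
    {y : E d} (hy : y ∈ X) : ⟪u - proj X u, y - proj X u⟫ ≤ 0 := by
  have h := (norm_eq_iInf_iff_real_inner_le_zero (u := u) hX (proj_mem hne hc u)).1 ?_
  · exact h y hy
  · have : Nonempty X := hne.to_subtype
    refine le_antisymm (le_ciInf fun w => (proj_spec hne hc u).2 w w.2) ?_
    exact ciInf_le (f := fun w : X => ‖u - w‖) ⟨0, by rintro _ ⟨w, rfl⟩; positivity⟩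
      ⟨proj X u, proj_mem hne hc u⟩

theorem proj_eq_of_inner_le (hne : X.Nonempty) (hc : IsCompact X) (hX : Convex ℝ X) {u p : E d}
    (hp : p ∈ X) (h : ∀ y ∈ X, ⟪u - p, y - p⟫ ≤ 0) : proj X u = p := by
  have h1 := inner_sub_proj_le hne hc hX u hp
  have h2 := h _ (proj_mem hne hc u)
  have h3 : ⟪proj X u - p, proj X u - p⟫ ≤ 0 := by
    have : ⟪proj X u - p, proj X u - p⟫ =
        ⟪u - proj X u, p - proj X u⟫ + ⟪u - p, proj X u - p⟫ := by
      simp only [inner_sub_left, inner_sub_right]; ring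
    linarith
  rw [real_inner_self_eq_norm_sq] at h3
  have : ‖proj X u - p‖ = 0 := by
    have := sq_nonneg ‖proj X u - p‖
    exact pow_eq_zero_iff (two_ne_zero) |>.1 (le_antisymm h3 this)
  exact sub_eq_zero.1 (norm_eq_zero.1 this)

theorem proj_of_mem (hne : X.Nonempty) (hc : IsCompact X) (hX : Convex ℝ X) {u : E d}
    (hu : u ∈ X) : proj X u = u :=
  proj_eq_of_inner_le hne hc hX hu (by simp)

theorem norm_proj_sub_proj_le (hne : X.Nonempty) (hc : IsCompact X) (hX : Convex ℝ X)
    (u v : E d) : ‖proj X u - proj X v‖ ≤ ‖u - v‖ := by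
  have h1 := inner_sub_proj_le hne hc hX u (proj_mem hne hc v)
  have h2 := inner_sub_proj_le hne hc hX v (proj_mem hne hc u)
  have h3 : ‖proj X u - proj X v‖ ^ 2 ≤ ⟪u - v, proj X u - proj X v⟫ := by
    have : ⟪u - v, proj X u - proj X v⟫ - ⟪proj X u - proj X v, proj X u - proj X v⟫ =
        -⟪u - proj X u, proj X v - proj X u⟫ - ⟪v - proj X v, proj X u - proj X v⟫ := by
      simp only [inner_sub_left, inner_sub_right]; ring
    rw [real_inner_self_eq_norm_sq] at this
    linarith
  have h4 := real_inner_le_norm (u - v) (proj X u - proj X v)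
  by_contra hlt
  push Not at hlt
  nlinarith [norm_nonneg (u - v)]

theorem norm_proj_sub_le (hne : X.Nonempty) (hc : IsCompact X) (hX : Convex ℝ X)
    (u : E d) {y : E d} (hy : y ∈ X) : ‖proj X u - y‖ ≤ ‖u - y‖ := by
  simpa [proj_of_mem hne hc hX hy] using norm_proj_sub_proj_le hne hc hX u y

theorem continuous_proj (hne : X.Nonempty) (hc : IsCompact X) (hX : Convex ℝ X) :
    Continuous (proj X) := by
  have : LipschitzWith 1 (proj X) := LipschitzWith.of_dist_le_mul fun u v => by
    simpa [dist_eq_norm] using norm_proj_sub_proj_le hne hc hX u v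
  exact this.continuous

/-- The obtuse-angle criterion for the projection tests only against differences of points of `X`,
so a component orthogonal to all of them is invisible. This is why the part of a gradient
transversal to `X` does not matter. -/
theorem proj_add_of_orthogonal (hne : X.Nonempty) (hc : IsCompact X) (hX : Convex ℝ X)
    (u w : E d) (hw : ∀ y ∈ X, ∀ y' ∈ X, ⟪w, y - y'⟫ = 0) : proj X (u + w) = proj X u := by
  refine proj_eq_of_inner_le hne hc hX (proj_mem hne hc u) fun y hy => ?_
  rw [show u + w - proj X u = (u - proj X u) + w by abel, inner_add_left,
    hw y hy _ (proj_mem hne hc u), add_zero]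
  exact inner_sub_proj_le hne hc hX u hy

end Projection

/-! ### Convex functions that are smooth on a convex set -/

section SmoothConvex

variable {d : ℕ} {X : Set (E d)}

theorem add_smul_sub_mem (hX : Convex ℝ X) {x y : E d} (hx : x ∈ X) (hy : y ∈ X) {t : ℝ}
    (ht : t ∈ Set.Icc (0 : ℝ) 1) : x + t • (y - x) ∈ X :=
  hX.add_smul_sub_mem hx hy ht

theorem hasDerivWithinAt_segment (hX : Convex ℝ X) {f : E d → ℝ} {g : E d → E d}
    (hf : ∀ x ∈ X, HasGradientWithinAt f (g x) X x) {x y : E d} (hx : x ∈ X) (hy : y ∈ X)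
    {t : ℝ} (ht : t ∈ Set.Icc (0 : ℝ) 1) :
    HasDerivWithinAt (fun t : ℝ => f (x + t • (y - x))) ⟪g (x + t • (y - x)), y - x⟫
      (Set.Icc 0 1) t := by
  have h1 := (hf _ (hX.add_smul_sub_mem hx hy ht)).hasFDerivWithinAt
  have h2 : HasDerivWithinAt (fun t : ℝ => x + t • (y - x)) (y - x) (Set.Icc 0 1) t := by
    have := ((hasDerivAt_id t).smul_const (y - x)).const_add x
    simpa using this.hasDerivWithinAt
  have h3 := h1.comp_hasDerivWithinAt t h2 (fun s hs => hX.add_smul_sub_mem hx hy hs)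
  simpa [Function.comp_def] using h3

theorem add_inner_gradient_le_of_convexOn (hX : Convex ℝ X) {f : E d → ℝ} {g : E d → E d}
    (hconv : ConvexOn ℝ X f) (hf : ∀ x ∈ X, HasGradientWithinAt f (g x) X x) {x y : E d}
    (hx : x ∈ X) (hy : y ∈ X) : f x + ⟪g x, y - x⟫ ≤ f y := by
  have h := hasDerivWithinAt_segment hX hf hx hy (t := 0) (by simp)
  have h' := h.mono Set.Ioc_subset_Icc_self
  rw [hasDerivWithinAt_iff_tendsto_slope' (by simp)] at h'
  simp only [zero_smul, add_zero] at h'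
  have : (nhdsWithin (0 : ℝ) (Set.Ioc 0 1)).NeBot := by
    rw [nhdsWithin_Ioc_eq_nhdsGT one_pos]; infer_instance
  have := le_of_tendsto h' (b := f y - f x) ?_
  · linarith
  filter_upwards [self_mem_nhdsWithin] with t ht
  have hc := hconv.2 hx hy (by linarith [ht.2] : (0 : ℝ) ≤ 1 - t) ht.1.le (by ring)
  rw [slope_def_field]
  simp only [zero_smul, add_zero, sub_zero]
  rw [div_le_iff₀ ht.1]
  have he : x + t • (y - x) = (1 - t) • x + t • y := by
    rw [smul_sub, sub_smul, one_smul]; abel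
  rw [he]
  simp only [smul_eq_mul] at hc
  linarith

/-- Along the segment, the difference of the two sides has a nonpositive derivative because the
gradient is `β`-Lipschitz; monotonicity replaces integration of the gradient. -/
theorem le_add_inner_gradient_of_smooth (hX : Convex ℝ X) {f : E d → ℝ} {g : E d → E d} {β : ℝ}
    (hf : ∀ x ∈ X, HasGradientWithinAt f (g x) X x)
    (hg : ∀ x ∈ X, ∀ y ∈ X, ‖g x - g y‖ ≤ β * ‖x - y‖) {x y : E d}
    (hx : x ∈ X) (hy : y ∈ X) : f y ≤ f x + ⟪g x, y - x⟫ + β / 2 * ‖y - x‖ ^ 2 := by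
  have hd : ∀ t ∈ Set.Icc (0 : ℝ) 1, HasDerivWithinAt
      (fun t : ℝ => f (x + t • (y - x)) - t * ⟪g x, y - x⟫ - β / 2 * ‖y - x‖ ^ 2 * t ^ 2)
      (⟪g (x + t • (y - x)), y - x⟫ - ⟪g x, y - x⟫ - β / 2 * ‖y - x‖ ^ 2 * (2 * t))
      (Set.Icc 0 1) t := by
    intro t ht
    have h1 := hasDerivWithinAt_segment hX hf hx hy ht
    have h2 : HasDerivWithinAt (fun t : ℝ => t * ⟪g x, y - x⟫) ⟪g x, y - x⟫ (Set.Icc 0 1) t := by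
      simpa using ((hasDerivAt_id t).mul_const ⟪g x, y - x⟫).hasDerivWithinAt
    have h3 : HasDerivWithinAt (fun t : ℝ => β / 2 * ‖y - x‖ ^ 2 * t ^ 2)
        (β / 2 * ‖y - x‖ ^ 2 * (2 * t)) (Set.Icc 0 1) t := by
      simpa using ((hasDerivAt_pow 2 t).const_mul (β / 2 * ‖y - x‖ ^ 2)).hasDerivWithinAt
    exact (h1.sub h2).sub h3
  have hanti : AntitoneOn
      (fun t : ℝ => f (x + t • (y - x)) - t * ⟪g x, y - x⟫ - β / 2 * ‖y - x‖ ^ 2 * t ^ 2)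
      (Set.Icc 0 1) := by
    refine antitoneOn_of_hasDerivWithinAt_nonpos (convex_Icc 0 1)
      (fun t ht => (hd t ht).continuousWithinAt) (fun t ht => ?_) (fun t ht => ?_)
      (f' := fun t => ⟪g (x + t • (y - x)), y - x⟫ - ⟪g x, y - x⟫ -
        β / 2 * ‖y - x‖ ^ 2 * (2 * t))
    · exact (hd t (interior_subset ht)).mono interior_subset
    · have ht' := interior_subset ht
      have h1 := hg _ (hX.add_smul_sub_mem hx hy ht') x hx
      rw [add_sub_cancel_left, norm_smul, Real.norm_of_nonneg ht'.1] at h1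
      have h2 := real_inner_le_norm (g (x + t • (y - x)) - g x) (y - x)
      rw [inner_sub_left] at h2
      have h3 := mul_le_mul_of_nonneg_right h1 (norm_nonneg (y - x))
      nlinarith
  have := hanti (a := 0) (b := 1) (by simp) (by simp) zero_le_one
  simp only [one_smul, add_sub_cancel, zero_smul, add_zero] at this
  linarith

/-- If `ψ` is convex and `1`-smooth with gradient `φ`, in the form of the first-order inequalities
on `X`, then `φ` is nonexpansive, tested on a direction in which there is room inside `X`. -/
theorem two_mul_inner_gradient_sub_le {ψ : E d → ℝ} {φ : E d → E d}
    (h1 : ∀ a ∈ X, ∀ b ∈ X, ψ a + ⟪φ a, b - a⟫ ≤ ψ b)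
    (h2 : ∀ a ∈ X, ∀ b ∈ X, ψ b ≤ ψ a + ⟪φ a, b - a⟫ + 1 / 2 * ‖b - a‖ ^ 2)
    {u v w : E d} (hu : u ∈ X) (hv : v ∈ X) (huw : u - w ∈ X) (hvw : v + w ∈ X) :
    2 * ⟪φ u - φ v, w⟫ ≤ ‖w‖ ^ 2 + ‖u - v‖ ^ 2 := by
  have a1 := h1 v hv _ huw
  have a2 := h2 u hu _ huw
  have a3 := h1 u hu _ hvw
  have a4 := h2 v hv _ hvw
  have a5 := h2 u hu v hv
  have a6 := h2 v hv u hu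
  rw [show u - w - u = -w by abel, norm_neg, inner_neg_right] at a2
  rw [add_sub_cancel_left] at a4
  rw [norm_sub_rev v u] at a5
  simp only [inner_sub_left, inner_sub_right, inner_add_right] at *
  nlinarith

/-- The four-point inequality is sharp only for a test vector as long as `u - v`, and a vector of
that length may leave `X`. Cutting the segment into many pieces makes both lengths small enough for
the available room; the estimates for the pieces telescope. -/
theorem inner_gradient_sub_le_of_room {ψ : E d → ℝ} {φ : E d → E d}
    (h1 : ∀ a ∈ X, ∀ b ∈ X, ψ a + ⟪φ a, b - a⟫ ≤ ψ b)
    (h2 : ∀ a ∈ X, ∀ b ∈ X, ψ b ≤ ψ a + ⟪φ a, b - a⟫ + 1 / 2 * ‖b - a‖ ^ 2)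
    {x y w : E d} {r : ℝ} (hr : 0 < r)
    (hroom : ∀ s ∈ Set.Icc (0 : ℝ) 1, ∀ t, |t| ≤ r → y + s • (x - y) + t • w ∈ X) :
    ⟪φ x - φ y, w⟫ ≤ ‖x - y‖ * ‖w‖ := by
  by_cases hw : w = 0
  · simp [hw]
  by_cases hxy : x = y
  · simp [hxy]
  have hw' : 0 < ‖w‖ := norm_pos_iff.2 hw
  have hxy' : 0 < ‖x - y‖ := norm_pos_iff.2 (sub_ne_zero.2 hxy)
  obtain ⟨N, hN⟩ := exists_nat_gt (‖x - y‖ / (‖w‖ * r))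
  have hN0 : (0 : ℝ) < N := lt_trans (by positivity) hN
  set p : ℕ → E d := fun k => y + ((k : ℝ) / N) • (x - y) with hp
  have hs : ∀ k : ℕ, k ≤ N → ((k : ℝ) / N) ∈ Set.Icc (0 : ℝ) 1 := fun k hk =>
    ⟨by positivity, (div_le_one hN0).2 (by exact_mod_cast hk)⟩
  -- With this `t` the vector `t • w` is exactly as long as one piece of the segment, which balances
  -- the two squares. The choice of `N` ensures `t ≤ r`.
  set t : ℝ := ‖x - y‖ / N / ‖w‖ with ht
  have ht0 : 0 < t := by positivity
  have htr : |t| ≤ r := by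
    rw [abs_of_pos ht0, ht, div_div, div_le_iff₀ (by positivity)]
    rw [div_lt_iff₀ (by positivity)] at hN
    nlinarith
  have hmem : ∀ k, k ≤ N → p k ∈ X := fun k hk => by
    simpa using hroom _ (hs k hk) 0 (by simp [hr.le])
  have hstep : ∀ k ∈ Finset.range N, ⟪φ (p (k + 1)) - φ (p k), w⟫ ≤ ‖x - y‖ * ‖w‖ / N := by
    intro k hk
    have hk' : k + 1 ≤ N := Finset.mem_range.1 hk
    have hdiff : p (k + 1) - p k = (1 / (N : ℝ)) • (x - y) := by
      simp only [hp, add_sub_add_left_eq_sub, ← sub_smul]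
      congr 1
      push_cast
      ring
    have := two_mul_inner_gradient_sub_le h1 h2 (hmem _ hk') (hmem k (by omega)) (w := t • w)
      (by
        have := hroom _ (hs _ hk') (-t) (by rwa [abs_neg])
        rwa [neg_smul, ← sub_eq_add_neg] at this)
      (hroom _ (hs k (by omega)) t htr)
    rw [hdiff, inner_smul_right, norm_smul, norm_smul, Real.norm_of_nonneg ht0.le,
      Real.norm_of_nonneg (by positivity : (0 : ℝ) ≤ 1 / N)] at this
    have e1 : t * ‖w‖ = ‖x - y‖ / N := by rw [ht]; field_simp
    have e2 : 1 / (N : ℝ) * ‖x - y‖ = ‖x - y‖ / N := by ring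
    rw [e1, e2] at this
    have e3 : t * ⟪φ (p (k + 1)) - φ (p k), w⟫ ≤ t * (‖x - y‖ * ‖w‖ / N) := by
      have : t * (‖x - y‖ * ‖w‖ / N) = (‖x - y‖ / N) ^ 2 := by rw [ht]; field_simp
      rw [this]; linarith
    exact le_of_mul_le_mul_left e3 ht0
  have hsum := Finset.sum_le_sum hstep
  rw [← sum_inner, Finset.sum_range_sub (fun k => φ (p k))] at hsum
  have e0 : p 0 = y := by simp [hp]
  have eN : p N = x := by simp [hp, hN0.ne']
  rw [e0, eN, Finset.sum_const, Finset.card_range, nsmul_eq_mul] at hsum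
  calc _ ≤ _ := hsum
    _ = _ := by field_simp

/-- Points of `X` moved towards the midpoint of `c` and `e` have room in the direction `c - e`. -/
theorem shrink_add_smul_mem (hX : Convex ℝ X) {x c e : E d} (hx : x ∈ X) (hc : c ∈ X)
    (he : e ∈ X) {s : ℝ} (hs : s ∈ Set.Ioc (0 : ℝ) 1) {t : ℝ} (ht : |t| ≤ s / 2) :
    x + s • ((1 / 2 : ℝ) • (c + e) - x) + t • (c - e) ∈ X := by
  have hs0 := hs.1
  have hm : (1 / 2 + t / s) • c + (1 / 2 - t / s) • e ∈ X := by
    have hts : |t / s| ≤ 1 / 2 := by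
      rw [abs_div, abs_of_pos hs0, div_le_iff₀ hs0]; linarith
    obtain ⟨h1, h2⟩ := abs_le.1 hts
    exact hX hc he (by linarith) (by linarith) (by ring)
  have := hX hx hm (a := 1 - s) (b := s) (by linarith [hs.2]) hs0.le (by ring)
  convert this using 1
  have h1 : s * (1 / 2 + t / s) = s / 2 + t := by field_simp
  have h2 : s * (1 / 2 - t / s) = s / 2 - t := by field_simp
  rw [smul_add s, smul_smul, smul_smul, h1, h2]
  module

theorem shrink_mem (hX : Convex ℝ X) {x c e : E d} (hx : x ∈ X) (hc : c ∈ X)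
    (he : e ∈ X) {s : ℝ} (hs : s ∈ Set.Ioc (0 : ℝ) 1) :
    x + s • ((1 / 2 : ℝ) • (c + e) - x) ∈ X := by
  have h := shrink_add_smul_mem hX hx hc he hs (t := 0) (by rw [abs_zero]; linarith [hs.1])
  rwa [zero_smul, add_zero] at h

theorem tendsto_shrink (hX : Convex ℝ X) {φ : E d → E d} (hφ : ContinuousOn φ X) {x c e : E d}
    (hx : x ∈ X) (hc : c ∈ X) (he : e ∈ X) :
    Filter.Tendsto (fun s : ℝ => φ (x + s • ((1 / 2 : ℝ) • (c + e) - x)))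
      (nhdsWithin 0 (Set.Ioc 0 1)) (nhds (φ x)) := by
  have h1 : Filter.Tendsto (fun s : ℝ => x + s • ((1 / 2 : ℝ) • (c + e) - x))
      (nhdsWithin 0 (Set.Ioc 0 1)) (nhdsWithin x X) := by
    refine tendsto_nhdsWithin_of_tendsto_nhds_of_eventually_within _ ?_ ?_
    · have : Continuous (fun s : ℝ => x + s • ((1 / 2 : ℝ) • (c + e) - x)) := by fun_prop
      simpa using (this.tendsto 0).mono_left nhdsWithin_le_nhds
    · filter_upwards [self_mem_nhdsWithin] with s hs
      exact shrink_mem hX hx hc he hs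
  exact (hφ x hx).tendsto.comp h1

theorem neBot_nhdsWithin_Ioc : (nhdsWithin (0 : ℝ) (Set.Ioc 0 1)).NeBot := by
  rw [nhdsWithin_Ioc_eq_nhdsGT one_pos]; infer_instance

/-- Moving `x` and `y` by a fraction `s` towards the midpoint of `c` and `e` creates room `s / 2` in
the direction `c - e` at every point between them, even if `X` has no interior. Continuity of `φ`
allows `s` to tend to zero. -/
theorem inner_gradient_sub_le (hX : Convex ℝ X) {ψ : E d → ℝ} {φ : E d → E d}
    (h1 : ∀ a ∈ X, ∀ b ∈ X, ψ a + ⟪φ a, b - a⟫ ≤ ψ b)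
    (h2 : ∀ a ∈ X, ∀ b ∈ X, ψ b ≤ ψ a + ⟪φ a, b - a⟫ + 1 / 2 * ‖b - a‖ ^ 2)
    (hφ : ContinuousOn φ X)
    {x y c e : E d} (hx : x ∈ X) (hy : y ∈ X) (hc : c ∈ X) (he : e ∈ X) :
    ⟪φ x - φ y, c - e⟫ ≤ ‖x - y‖ * ‖c - e‖ := by
  have := neBot_nhdsWithin_Ioc
  have hlim := ((tendsto_shrink hX hφ hx hc he).sub (tendsto_shrink hX hφ hy hc he)).inner (𝕜 := ℝ)
    (tendsto_const_nhds (x := c - e))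
  refine le_of_tendsto hlim ?_
  filter_upwards [self_mem_nhdsWithin] with s hs
  set x' := x + s • ((1 / 2 : ℝ) • (c + e) - x) with hx'
  set y' := y + s • ((1 / 2 : ℝ) • (c + e) - y) with hy'
  have hxm : x' ∈ X := shrink_mem hX hx hc he hs
  have hym : y' ∈ X := shrink_mem hX hy hc he hs
  have hd : x' - y' = (1 - s) • (x - y) := by rw [hx', hy']; module
  have := inner_gradient_sub_le_of_room h1 h2 (x := x') (y := y') (w := c - e) (r := s / 2)
    (by linarith [hs.1]) (fun a ha t ht => by
      have := shrink_add_smul_mem hX (hX.add_smul_sub_mem hy hx ha) hc he hs ht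
      convert this using 2
      rw [hd, hy']; module)
  refine this.trans ?_
  rw [hd, norm_smul, Real.norm_of_nonneg (by linarith [hs.2])]
  have : 0 ≤ ‖x - y‖ * ‖c - e‖ := by positivity
  nlinarith [hs.1]

/-- At a point shrunk towards the midpoint of `c` and `e`, a step along `c - e` stays in `X`, where
the first-order inequality and the Lipschitz bound can be compared. The boundary case follows by
continuity. Only directions along `X` are controlled. -/
theorem inner_gradient_le_of_lipschitz (hX : Convex ℝ X) {f : E d → ℝ} {g : E d → E d} {L : ℝ}
    (hconv : ConvexOn ℝ X f) (hf : ∀ x ∈ X, HasGradientWithinAt f (g x) X x)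
    (hL : ∀ x ∈ X, ∀ y ∈ X, |f x - f y| ≤ L * ‖x - y‖) (hg : ContinuousOn g X)
    {x c e : E d} (hx : x ∈ X) (hc : c ∈ X) (he : e ∈ X) :
    ⟪g x, c - e⟫ ≤ L * ‖c - e‖ := by
  have := neBot_nhdsWithin_Ioc
  have hlim := (tendsto_shrink hX hg hx hc he).inner (𝕜 := ℝ) (tendsto_const_nhds (x := c - e))
  refine le_of_tendsto hlim ?_
  filter_upwards [self_mem_nhdsWithin] with s hs
  set x' := x + s • ((1 / 2 : ℝ) • (c + e) - x) with hx'
  have hs0 : 0 < s := hs.1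
  have hxm : x' ∈ X := shrink_mem hX hx hc he hs
  have hxm' : x' + (s / 2) • (c - e) ∈ X :=
    shrink_add_smul_mem hX hx hc he hs (by rw [abs_of_pos (by linarith)])
  have h1 := add_inner_gradient_le_of_convexOn hX hconv hf hxm hxm'
  have h2 := (abs_le.1 (hL _ hxm' _ hxm)).2
  rw [add_sub_cancel_left, inner_smul_right] at h1
  rw [add_sub_cancel_left, norm_smul, Real.norm_of_nonneg (by linarith)] at h2
  have : s / 2 * ⟪g x', c - e⟫ ≤ s / 2 * (L * ‖c - e‖) := by nlinarith
  exact le_of_mul_le_mul_left this (by linarith)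

/-- The linear span of the differences of points of `X`. -/
def dirSpan (X : Set (E d)) : Submodule ℝ (E d) :=
  Submodule.span ℝ {v | ∃ c ∈ X, ∃ e ∈ X, v = c - e}

theorem sub_mem_dirSpan {x y : E d} (hx : x ∈ X) (hy : y ∈ X) : x - y ∈ dirSpan X :=
  Submodule.subset_span ⟨x, hx, y, hy, rfl⟩

/-- Convexity merges two multiples of differences into a multiple of one difference, with weights `t
/ (t + t')` and `t' / (t + t')`, and exchanging `c` and `e` absorbs signs. Estimates in the
directions `c - e` thus extend to the whole span, and a vector of the span can be tested against
itself. -/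
theorem exists_smul_sub_of_mem_dirSpan (hne : X.Nonempty) (hX : Convex ℝ X) {v : E d}
    (hv : v ∈ dirSpan X) : ∃ t : ℝ, 0 ≤ t ∧ ∃ c ∈ X, ∃ e ∈ X, v = t • (c - e) := by
  induction hv using Submodule.span_induction with
  | mem v hv =>
    obtain ⟨c, hc, e, he, rfl⟩ := hv
    exact ⟨1, zero_le_one, c, hc, e, he, by simp⟩
  | zero =>
    obtain ⟨x, hx⟩ := hne
    exact ⟨0, le_rfl, x, hx, x, hx, by simp⟩
  | add v w _ _ h1 h2 =>
    obtain ⟨t, ht, c, hc, e, he, rfl⟩ := h1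
    obtain ⟨t', ht', c', hc', e', he', rfl⟩ := h2
    rcases (add_nonneg ht ht').eq_or_lt with h0 | h0
    · have h1 : t = 0 := by linarith
      have h2 : t' = 0 := by linarith
      exact ⟨0, le_rfl, c, hc, e, he, by simp [h1, h2]⟩
    · have ha : t / (t + t') + t' / (t + t') = 1 := by field_simp
      refine ⟨t + t', h0.le, _, hX hc hc' (by positivity) (by positivity) ha,
        _, hX he he' (by positivity) (by positivity) ha, ?_⟩
      have e1 : (t + t') * (t / (t + t')) = t := by field_simp
      have e2 : (t + t') * (t' / (t + t')) = t' := by field_simp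
      simp only [smul_sub, smul_add, smul_smul, e1, e2]
      abel
  | smul a v _ h =>
    obtain ⟨t, ht, c, hc, e, he, rfl⟩ := h
    rcases le_total 0 a with ha | ha
    · exact ⟨a * t, by positivity, c, hc, e, he, by rw [smul_smul]⟩
    · exact ⟨(-a) * t, mul_nonneg (by linarith) ht, e, he, c, hc, by module⟩

end SmoothConvex

end PhasedSGD

end

noncomputable section

namespace PhasedSGD

open scoped RealInnerProductSpace

/-! ### Reduction to bounded gradients -/

/-- The map `x ↦ x - η • g x` is the gradient of `½‖x‖² - η f x`. This function is convex because `η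
β ≤ 1` and `1`-smooth because `f` is convex, and the gradient of such a function is nonexpansive. -/
theorem norm_gradient_step_sub_le {d : ℕ} {X : Set (E d)} (hne : X.Nonempty) (hX : Convex ℝ X)
    {f : E d → ℝ} {g : E d → E d} {β : ℝ}
    (hsub : ∀ x ∈ X, ∀ y ∈ X, f x + ⟪g x, y - x⟫ ≤ f y)
    (hdesc : ∀ x ∈ X, ∀ y ∈ X, f y ≤ f x + ⟪g x, y - x⟫ + β / 2 * ‖y - x‖ ^ 2)
    (hgm : ∀ x, g x ∈ dirSpan X) (hcont : Continuous g) {η : ℝ} (hη : 0 ≤ η) (hηβ : η * β ≤ 1)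
    {x y : E d} (hx : x ∈ X) (hy : y ∈ X) :
    ‖(x - η • g x) - (y - η • g y)‖ ≤ ‖x - y‖ := by
  set φ : E d → E d := fun x => x - η • g x with hφ
  set ψ : E d → ℝ := fun x => 1 / 2 * ‖x‖ ^ 2 - η * f x with hψ
  have key : ∀ a b : E d, ψ a + ⟪φ a, b - a⟫ = 1 / 2 * ‖b‖ ^ 2 - 1 / 2 * ‖b - a‖ ^ 2
      - η * (f a + ⟪g a, b - a⟫) := by
    intro a b
    simp only [hφ, hψ, inner_sub_left, inner_smul_left, norm_sub_sq_real, inner_sub_right,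
      real_inner_self_eq_norm_sq, real_inner_comm a b]
    simp
    ring
  have h1 : ∀ a ∈ X, ∀ b ∈ X, ψ a + ⟪φ a, b - a⟫ ≤ ψ b := by
    intro a ha b hb
    rw [key]
    have := mul_le_mul_of_nonneg_left (hdesc a ha b hb) hη
    have h3 : η * β * ‖b - a‖ ^ 2 ≤ 1 * ‖b - a‖ ^ 2 := by gcongr
    simp only [hψ]
    nlinarith
  have h2 : ∀ a ∈ X, ∀ b ∈ X, ψ b ≤ ψ a + ⟪φ a, b - a⟫ + 1 / 2 * ‖b - a‖ ^ 2 := by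
    intro a ha b hb
    rw [key]
    have := mul_le_mul_of_nonneg_left (hsub a ha b hb) hη
    simp only [hψ]
    nlinarith
  -- The difference lies in the span along `X`, so up to scaling it is itself an admissible test
  -- direction `c - e`.
  have hmem : φ x - φ y ∈ dirSpan X := by
    have : φ x - φ y = (x - y) - η • (g x - g y) := by
      simp only [hφ, smul_sub]; abel
    rw [this]
    exact Submodule.sub_mem _ (sub_mem_dirSpan hx hy)
      (Submodule.smul_mem _ _ (Submodule.sub_mem _ (hgm _) (hgm _)))
  obtain ⟨t, ht, c, hc, e, he, hv⟩ := exists_smul_sub_of_mem_dirSpan hne hX hmem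
  have hφc : ContinuousOn φ X := by
    have := hcont
    exact (continuous_id.sub (this.const_smul η)).continuousOn
  have h3 := inner_gradient_sub_le hX h1 h2 hφc hx hy hc he
  have h4 : ‖φ x - φ y‖ ^ 2 ≤ ‖x - y‖ * ‖φ x - φ y‖ := by
    rw [← real_inner_self_eq_norm_sq]
    have h5 : ‖φ x - φ y‖ = t * ‖c - e‖ := by rw [hv, norm_smul, Real.norm_of_nonneg ht]
    rw [h5]
    nth_rewrite 2 [hv]
    rw [inner_smul_right]
    nlinarith
  change ‖φ x - φ y‖ ≤ ‖x - y‖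
  by_contra hlt
  push Not at hlt
  nlinarith [norm_nonneg (x - y)]

section TameGradient

variable {d : ℕ} {Z : Type*}

/-- The properties of the problem that the analysis uses, for a gradient oracle that is bounded and
measurable on the whole space. -/
structure IsTame [MeasurableSpace Z] (X : Set (E d)) (f : E d → Z → ℝ) (g : E d → Z → E d)
    (Q : Measure Z) (L R β : ℝ) : Prop where
  nonempty : X.Nonempty
  compact : IsCompact X
  convex : Convex ℝ X
  diam : ∀ x ∈ X, ∀ y ∈ X, ‖x - y‖ ≤ R
  loss_convex : ∀ z, ConvexOn ℝ X fun x => f x z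
  loss_lipschitz : ∀ z, ∀ x ∈ X, ∀ y ∈ X, |f x z - f y z| ≤ L * ‖x - y‖
  loss_integrable : ∀ x ∈ X, Integrable (f x) Q
  bounded : ∀ x z, ‖g x z‖ ≤ L
  measurable : Measurable (Function.uncurry g)
  subgradient : ∀ z, ∀ x ∈ X, ∀ y ∈ X, f x z + ⟪g x z, y - x⟫ ≤ f y z
  nonexpansive : ∀ η, 0 ≤ η → η * β ≤ 1 → ∀ z, ∀ x ∈ X, ∀ y ∈ X,
    ‖(x - η • g x z) - (y - η • g y z)‖ ≤ ‖x - y‖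

/-- The component of the gradient along the affine span of `X`, extended to the whole space by
projecting the argument to `X`. -/
def reducedGrad (X : Set (E d)) (G : E d → Z → E d) (x : E d) (z : Z) : E d :=
  (dirSpan X).starProjection (G (proj X x) z)

theorem inner_reducedGrad {X : Set (E d)} {G : E d → Z → E d} {x v : E d} (hv : v ∈ dirSpan X)
    (z : Z) : ⟪reducedGrad X G x z, v⟫ = ⟪G (proj X x) z, v⟫ := by
  unfold reducedGrad
  rw [Submodule.inner_starProjection_left_eq_right, Submodule.starProjection_eq_self_iff.2 hv]

theorem reducedGrad_mem {X : Set (E d)} {G : E d → Z → E d} {x : E d} (z : Z) :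
    reducedGrad X G x z ∈ dirSpan X :=
  Submodule.starProjection_apply_mem _ _

/-- Testing the reduced gradient against itself turns the directional Lipschitz bound into `‖g‖ ≤
L`. Inner products with differences of points of `X` are unchanged by the reduction, so the
convexity and smoothness inequalities survive. -/
theorem IsSmoothSCO.isTame [MeasurableSpace Z] {X : Set (E d)} {f : E d → Z → ℝ}
    {G : E d → Z → E d} {Q : Measure Z} {L R β : ℝ}
    (h : IsSmoothSCO X f G Q L R β) (hL : 0 ≤ L) (hβ : 0 ≤ β) :
    IsTame X f (reducedGrad X G) Q L R β := by
  have hpm := proj_mem h.nonempty h.compact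
  have hlip : ∀ z x y, ‖reducedGrad X G x z - reducedGrad X G y z‖ ≤ β * ‖x - y‖ := by
    intro z x y
    unfold reducedGrad
    rw [← map_sub]
    refine (Submodule.norm_starProjection_apply_le _ _).trans
      ((h.loss_smooth z _ (hpm x) _ (hpm y)).trans ?_)
    gcongr
    exact norm_proj_sub_proj_le h.nonempty h.compact h.convex x y
  have hcont : ∀ z, Continuous fun x => reducedGrad X G x z := fun z => by
    refine (LipschitzWith.of_dist_le_mul (K := ⟨β, hβ⟩) fun x y => ?_).continuous
    rw [dist_eq_norm, dist_eq_norm]; exact hlip z x y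
  have hGcont : ∀ z, ContinuousOn (fun x => G x z) X := fun z => by
    refine (LipschitzOnWith.of_dist_le_mul (K := ⟨β, hβ⟩) fun x hx y hy => ?_).continuousOn
    rw [dist_eq_norm, dist_eq_norm]; exact h.loss_smooth z x hx y hy
  have hsub : ∀ z, ∀ x ∈ X, ∀ y ∈ X, f x z + ⟪reducedGrad X G x z, y - x⟫ ≤ f y z := by
    intro z x hx y hy
    rw [inner_reducedGrad (sub_mem_dirSpan hy hx), proj_of_mem h.nonempty h.compact h.convex hx]
    exact add_inner_gradient_le_of_convexOn h.convex (h.loss_convex z) (h.loss_gradient z) hx hy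
  have hdesc : ∀ z, ∀ x ∈ X, ∀ y ∈ X,
      f y z ≤ f x z + ⟪reducedGrad X G x z, y - x⟫ + β / 2 * ‖y - x‖ ^ 2 := by
    intro z x hx y hy
    rw [inner_reducedGrad (sub_mem_dirSpan hy hx), proj_of_mem h.nonempty h.compact h.convex hx]
    exact le_add_inner_gradient_of_smooth h.convex (h.loss_gradient z) (h.loss_smooth z) hx hy
  refine ⟨h.nonempty, h.compact, h.convex, h.diam, h.loss_convex, h.loss_lipschitz,
    h.loss_integrable, fun x z => ?_, ?_, hsub, fun η hη hηβ z x hx y hy => ?_⟩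
  · obtain ⟨t, ht, c, hc, e, he, hv⟩ := exists_smul_sub_of_mem_dirSpan h.nonempty h.convex
      (reducedGrad_mem (X := X) (G := G) (x := x) z)
    have h1 := inner_gradient_le_of_lipschitz h.convex (h.loss_convex z) (h.loss_gradient z)
      (h.loss_lipschitz z) (hGcont z) (hpm x) hc he
    have h2 : ‖reducedGrad X G x z‖ ^ 2 ≤ L * ‖reducedGrad X G x z‖ := by
      rw [← real_inner_self_eq_norm_sq, inner_reducedGrad (reducedGrad_mem z)]
      rw [hv, inner_smul_right, norm_smul, Real.norm_of_nonneg ht]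
      nlinarith
    by_contra hlt
    push Not at hlt
    nlinarith
  -- Carathéodory: continuity in the point and measurability in the sample give joint measurability.
  · exact measurable_uncurry_of_continuous_of_measurable
      (u := fun (x : E d) (z : Z) => reducedGrad X G x z) hcont
      (fun x => (dirSpan X).starProjection.continuous.measurable.comp
        (h.gradient_measurable _ (hpm x)))
  · exact norm_gradient_step_sub_le h.nonempty h.convex (hsub z) (hdesc z)
      (fun x => reducedGrad_mem z) (hcont z) hη hηβ hx hy

end TameGradient

/-! ### Projected SGD as a trajectory -/

section Trajectory

variable {S Z : Type*}

/-- The first `T` states of the recursion `s ↦ next s z` driven by the samples `w`. -/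
def traj (next : S → Z → S) : (T : ℕ) → (Fin T → Z) → S → Fin T → S
  | 0, _, _ => Fin.elim0
  | T + 1, w, s => Fin.cons s (traj next T (fun t => w t.succ) (next s (w 0)))

theorem traj_mem {next : S → Z → S} {I : Set S} (hI : ∀ s ∈ I, ∀ z, next s z ∈ I) {T : ℕ}
    (w : Fin T → Z) {s : S} (hs : s ∈ I) (t : Fin T) : traj next T w s t ∈ I := by
  induction T generalizing s with
  | zero => exact t.elim0
  | succ T ih =>
    refine Fin.cases ?_ (fun t => ?_) t
    · simpa [traj] using hs
    · simpa [traj] using ih _ (hI s hs _) t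

theorem measurable_traj [MeasurableSpace S] [MeasurableSpace Z] {next : S → Z → S}
    (hn : Measurable (Function.uncurry next)) (T : ℕ) (t : Fin T) :
    Measurable fun p : (Fin T → Z) × S => traj next T p.1 p.2 t := by
  induction T with
  | zero => exact t.elim0
  | succ T ih =>
    refine Fin.cases ?_ (fun t => ?_) t
    · simpa [traj] using measurable_snd
    · simp only [traj, Fin.cons_succ]
      refine (ih t).comp (Measurable.prodMk ?_ ?_)
      · fun_prop
      · exact hn.comp (Measurable.prodMk measurable_snd (by fun_prop))

theorem traj_congr {next next' : S → Z → S} {I : Set S} (hI : ∀ s ∈ I, ∀ z, next s z ∈ I)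
    (h : ∀ s ∈ I, ∀ z, next s z = next' s z) {T : ℕ} (w : Fin T → Z) {s : S} (hs : s ∈ I) :
    traj next T w s = traj next' T w s := by
  induction T generalizing s with
  | zero => rfl
  | succ T ih => simp only [traj]; rw [ih _ (hI s hs _), h s hs]

theorem traj_prod {S' : Type*} (next : S → Z → S) (next' : S' → Z → S') {T : ℕ} (w : Fin T → Z)
    (s : S) (s' : S') (t : Fin T) :
    traj (fun p z => (next p.1 z, next' p.2 z)) T w (s, s') t =
      (traj next T w s t, traj next' T w s' t) := by
  induction T generalizing s s' with
  | zero => exact t.elim0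
  | succ T ih =>
    refine Fin.cases ?_ (fun t => ?_) t
    · simp [traj]
    · simpa [traj] using ih _ _ _ t

theorem lintegral_pi_succ [MeasurableSpace Z] (Q : Measure Z) [IsProbabilityMeasure Q] {T : ℕ}
    {h : Z → (Fin T → Z) → ENNReal} (hh : Measurable (Function.uncurry h)) :
    ∫⁻ w : Fin (T + 1) → Z, h (w 0) (fun t => w t.succ) ∂(Measure.pi fun _ => Q) =
      ∫⁻ z, ∫⁻ w, h z w ∂(Measure.pi fun _ => Q) ∂Q := by
  have hmp := measurePreserving_piFinSuccAbove (fun _ : Fin (T + 1) => Q) 0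
  have h2 := lintegral_prod (μ := Q) (ν := Measure.pi fun _ : Fin T => Q) (Function.uncurry h)
    hh.aemeasurable
  rw [← hmp.lintegral_comp hh] at h2
  exact h2

/-- A dynamic-programming bound: `Φ T` dominates the present cost plus the expected potential with
one sample fewer, and peeling off the first sample closes the induction. With a squared distance as
`Φ` it yields the regret bound, with exponentials of squared distances the concentration bound. -/
theorem lintegral_sum_traj_le [MeasurableSpace S] [MeasurableSpace Z] {Q : Measure Z}
    [IsProbabilityMeasure Q] {next : S → Z → S} (hn : Measurable (Function.uncurry next))
    {I : Set S} (hI : ∀ s ∈ I, ∀ z, next s z ∈ I) {c : S → ENNReal} (hc : Measurable c)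
    {Φ : ℕ → S → ENNReal} {N : ℕ}
    (hΦ : ∀ T < N, ∀ s ∈ I, c s + ∫⁻ z, Φ T (next s z) ∂Q ≤ Φ (T + 1) s) {T : ℕ} (hT : T ≤ N)
    {s : S} (hs : s ∈ I) :
    ∫⁻ w, ∑ t, c (traj next T w s t) ∂(Measure.pi fun _ => Q) ≤ Φ T s := by
  induction T generalizing s with
  | zero => simp
  | succ T ih =>
    have e : ∀ w : Fin (T + 1) → Z, ∑ t, c (traj next (T + 1) w s t) =
        c s + ∑ t, c (traj next T (fun t => w t.succ) (next s (w 0)) t) := fun w => by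
      rw [Fin.sum_univ_succ]; simp [traj]
    simp_rw [e]
    rw [lintegral_add_left measurable_const, lintegral_const, measure_univ, mul_one]
    have hm : Measurable (Function.uncurry fun (z : Z) (w : Fin T → Z) =>
        ∑ t, c (traj next T w (next s z) t)) := by
      refine Finset.measurable_sum _ fun t _ => hc.comp ?_
      exact (measurable_traj hn T t).comp (Measurable.prodMk measurable_snd
        (hn.comp (Measurable.prodMk measurable_const measurable_fst)))
    rw [lintegral_pi_succ Q hm]
    refine le_trans ?_ (hΦ T (by omega) s hs)
    gcongr with z
    exact ih (by omega) (hI s hs z)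

end Trajectory

end PhasedSGD

end

noncomputable section

namespace PhasedSGD

open scoped RealInnerProductSpace

/-! ### One-pass SGD -/

section SGD

variable {d : ℕ} {Z : Type*}

/-- One step of projected SGD. -/
def sgdNext (X : Set (E d)) (g : E d → Z → E d) (η : ℝ) (x : E d) (z : Z) : E d :=
  proj X (x - η • g x z)

/-- The average iterate of projected SGD on `T` samples. -/
def sgdAvg (X : Set (E d)) (g : E d → Z → E d) (η : ℝ) (T : ℕ) (w : Fin T → Z) (x : E d) : E d :=
  if T = 0 then x else (T : ℝ)⁻¹ • ∑ t, traj (sgdNext X g η) T w x t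

theorem Counted.val_bind {α β : Type} (x : Counted α) (k : α → Counted β) :
    (x >>= k).val = (k x.val).val := rfl

theorem Counted.grads_bind {α β : Type} (x : Counted α) (k : α → Counted β) :
    (x >>= k).grads = x.grads + (k x.val).grads := rfl

theorem Counted.val_pure {α : Type} (a : α) : (pure a : Counted α).val = a := rfl

theorem Counted.grads_pure {α : Type} (a : α) : (pure a : Counted α).grads = 0 := rfl

theorem sgdLoop_ofFn (X : Set (E d)) (G : E d → Z → E d) (η : ℝ) {T : ℕ} (w : Fin T → Z)
    (x s : E d) :
    (sgdLoop X G η (List.ofFn w) x s).val = s + ∑ t, traj (sgdNext X G η) T w x t ∧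
      (sgdLoop X G η (List.ofFn w) x s).grads = T := by
  induction T generalizing x s with
  | zero => simp [sgdLoop, Counted.val_pure, Counted.grads_pure]
  | succ T ih =>
    rw [List.ofFn_succ]
    simp only [sgdLoop, queryGrad, Counted.val_bind, Counted.grads_bind]
    obtain ⟨h1, h2⟩ := ih (fun t => w t.succ) (proj X (x - η • G x (w 0))) (s + x)
    rw [h1, h2]
    constructor
    · rw [Fin.sum_univ_succ]; simp [traj, sgdNext, add_assoc]
    · omega

theorem sgd_ofFn (X : Set (E d)) (G : E d → Z → E d) (η : ℝ) {T : ℕ} (w : Fin T → Z) (x : E d) :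
    (sgd X G η (List.ofFn w) x).val = sgdAvg X G η T w x ∧
      (sgd X G η (List.ofFn w) x).grads = T := by
  cases T with
  | zero => simp [sgd, sgdAvg, Counted.val_pure, Counted.grads_pure]
  | succ T =>
    have h := sgdLoop_ofFn X G η w x 0
    have e : sgd X G η (List.ofFn w) x = (do
        let s ← sgdLoop X G η (List.ofFn w) x 0
        pure (((List.ofFn w).length : ℝ)⁻¹ • s)) := by
      rw [List.ofFn_succ]; rfl
    rw [e, Counted.val_bind, Counted.grads_bind, Counted.val_pure, Counted.grads_pure, h.1, h.2]
    simp [sgdAvg]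

theorem sgdNext_mem {X : Set (E d)} (hne : X.Nonempty) (hc : IsCompact X) (g : E d → Z → E d)
    (η : ℝ) (x : E d) (z : Z) : sgdNext X g η x z ∈ X := proj_mem hne hc _

theorem average_mem {X : Set (E d)} (hX : Convex ℝ X) {ι : Type*} {s : Finset ι}
    (hs : s.Nonempty) {y : ι → E d} (hy : ∀ i ∈ s, y i ∈ X) :
    (s.card : ℝ)⁻¹ • ∑ i ∈ s, y i ∈ X := by
  rw [Finset.smul_sum]
  refine hX.sum_mem (fun _ _ => by positivity) ?_ hy
  have : (s.card : ℝ) ≠ 0 := by simpa using hs.ne_empty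
  simp [this]

theorem sgdAvg_mem {X : Set (E d)} (hne : X.Nonempty) (hc : IsCompact X) (hX : Convex ℝ X)
    (g : E d → Z → E d) (η : ℝ) {T : ℕ} (w : Fin T → Z) {x : E d} (hx : x ∈ X) :
    sgdAvg X g η T w x ∈ X := by
  unfold sgdAvg
  split_ifs with h
  · exact hx
  · have : NeZero T := ⟨h⟩
    have := average_mem hX (s := (Finset.univ : Finset (Fin T))) Finset.univ_nonempty
      (y := fun t => traj (sgdNext X g η) T w x t)
      (fun t _ => traj_mem (fun s _ z => sgdNext_mem hne hc g η s z) w hx t)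
    simpa using this

/-- The two steps before projection differ by a vector orthogonal to all differences of points of
`X`, which the projection ignores. -/
theorem sgdNext_reducedGrad {X : Set (E d)} (hne : X.Nonempty) (hc : IsCompact X)
    (hX : Convex ℝ X) (G : E d → Z → E d) (η : ℝ) {x : E d} (hx : x ∈ X) (z : Z) :
    sgdNext X G η x z = sgdNext X (reducedGrad X G) η x z := by
  unfold sgdNext
  rw [show x - η • reducedGrad X G x z =
    (x - η • G x z) + η • (G x z - reducedGrad X G x z) by rw [smul_sub]; abel]
  refine (proj_add_of_orthogonal hne hc hX _ _ fun y hy y' hy' => ?_).symm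
  rw [inner_smul_left, inner_sub_left, inner_reducedGrad (sub_mem_dirSpan hy hy'),
    proj_of_mem hne hc hX hx]
  simp

theorem sgdAvg_reducedGrad {X : Set (E d)} (hne : X.Nonempty) (hc : IsCompact X)
    (hX : Convex ℝ X) (G : E d → Z → E d) (η : ℝ) {T : ℕ} (w : Fin T → Z) {x : E d}
    (hx : x ∈ X) : sgdAvg X G η T w x = sgdAvg X (reducedGrad X G) η T w x := by
  unfold sgdAvg
  rw [traj_congr (fun s _ z => sgdNext_mem hne hc G η s z)
    (fun s hs z => sgdNext_reducedGrad hne hc hX G η hs z) w hx]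

theorem measurable_sgdNext [MeasurableSpace Z] {X : Set (E d)} (hne : X.Nonempty)
    (hc : IsCompact X) (hX : Convex ℝ X) {g : E d → Z → E d}
    (hg : Measurable (Function.uncurry g)) (η : ℝ) :
    Measurable (Function.uncurry (sgdNext X g η)) :=
  (continuous_proj hne hc hX).measurable.comp (measurable_fst.sub (hg.const_smul η))

theorem measurable_sgdAvg [MeasurableSpace Z] {X : Set (E d)} (hne : X.Nonempty)
    (hc : IsCompact X) (hX : Convex ℝ X) {g : E d → Z → E d}
    (hg : Measurable (Function.uncurry g)) (η : ℝ) (T : ℕ) :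
    Measurable fun p : (Fin T → Z) × E d => sgdAvg X g η T p.1 p.2 := by
  unfold sgdAvg
  split_ifs
  · exact measurable_snd
  · exact (Finset.measurable_sum _ fun t _ =>
      measurable_traj (measurable_sgdNext hne hc hX hg η) T t).const_smul ((T : ℝ)⁻¹)

end SGD

/-- Deterministic gradient descent becomes a trajectory that ignores the samples, so that it can run
in one recursion with SGD. -/
theorem traj_const {S Z : Type*} (φ : S → S) {T : ℕ} (w : Fin T → Z) (s : S) (t : Fin T) :
    traj (fun u (_ : Z) => φ u) T w s t = φ^[t] s := by
  induction T generalizing s with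
  | zero => exact t.elim0
  | succ T ih =>
    refine Fin.cases ?_ (fun t => ?_) t
    · simp [traj]
    · simp [traj, ih]

theorem IsTame.convexOn_popLoss {d : ℕ} {Z : Type*} [MeasurableSpace Z] {X : Set (E d)}
    {f : E d → Z → ℝ} {g : E d → Z → E d} {Q : Measure Z} {L R β : ℝ}
    (h : IsTame X f g Q L R β) : ConvexOn ℝ X (popLoss f Q) := by
  refine ⟨h.convex, fun x hx y hy a b ha hb hab => ?_⟩
  have hm := h.convex hx hy ha hb hab
  unfold popLoss
  rw [smul_eq_mul, smul_eq_mul, ← integral_const_mul, ← integral_const_mul, ← integral_add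
    ((h.loss_integrable x hx).const_mul a) ((h.loss_integrable y hy).const_mul b)]
  refine integral_mono (h.loss_integrable _ hm)
    (((h.loss_integrable x hx).const_mul a).add ((h.loss_integrable y hy).const_mul b))
    fun z => ?_
  exact (h.loss_convex z).2 hx hy ha hb hab

/-! ### SGD and the population loss: regret and concentration. -/

section Population

variable {d : ℕ} {Z : Type*} [MeasurableSpace Z] {X : Set (E d)} {f : E d → Z → ℝ}
  {g : E d → Z → E d} {Q : Measure Z} [IsProbabilityMeasure Q] {L R β : ℝ}

theorem IsTame.nonneg (h : IsTame X f g Q L R β) : 0 ≤ L :=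
  (norm_nonneg _).trans (h.bounded 0 (Classical.choice (nonempty_of_isProbabilityMeasure Q)))

theorem IsTame.abs_popLoss_sub_le (h : IsTame X f g Q L R β) {x y : E d} (hx : x ∈ X)
    (hy : y ∈ X) : |popLoss f Q x - popLoss f Q y| ≤ L * ‖x - y‖ := by
  unfold popLoss
  rw [← integral_sub (h.loss_integrable x hx) (h.loss_integrable y hy)]
  have := norm_integral_le_of_norm_le_const (μ := Q) (f := fun z => f x z - f y z)
    (C := L * ‖x - y‖) (Filter.Eventually.of_forall fun z => h.loss_lipschitz z x hx y hy)
  simpa using this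

theorem IsTame.continuous_popLoss_proj (h : IsTame X f g Q L R β) :
    Continuous fun x => popLoss f Q (proj X x) := by
  have hL := h.nonneg
  refine (LipschitzWith.of_dist_le_mul (K := ⟨L, hL⟩) fun x y => ?_).continuous
  rw [dist_eq_norm, dist_eq_norm]
  refine (h.abs_popLoss_sub_le (proj_mem h.nonempty h.compact x)
    (proj_mem h.nonempty h.compact y)).trans ?_
  exact mul_le_mul_of_nonneg_left (norm_proj_sub_proj_le h.nonempty h.compact h.convex x y) hL

theorem IsTame.integrable_grad (h : IsTame X f g Q L R β) (x : E d) : Integrable (g x) Q :=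
  Integrable.of_bound (h.measurable.comp measurable_prodMk_left).aestronglyMeasurable L
    (Filter.Eventually.of_forall (h.bounded x))

/-- Regret bound for the average iterate of one-pass SGD. -/
theorem IsTame.integral_popLoss_sgdAvg_le (h : IsTame X f g Q L R β) {η : ℝ} (hη : 0 < η) {T : ℕ}
    (hT : T ≠ 0) {x y : E d} (hx : x ∈ X) (hy : y ∈ X) :
    ∫ w, popLoss f Q (sgdAvg X g η T w x) ∂(Measure.pi fun _ => Q) ≤
      popLoss f Q y + ‖x - y‖ ^ 2 / (2 * η * T) + η * L ^ 2 / 2 := by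
  have hne := h.nonempty
  have hc := h.compact
  have hX := h.convex
  have hpm := proj_mem hne hc
  set F := popLoss f Q with hF
  have hL := h.nonneg
  -- A lower bound for the population loss on `X`. Subtracting it makes all costs nonnegative, so
  -- that Lebesgue integrals can be used; it cancels at the end.
  set m : ℝ := F y - L * R with hm
  have hmF : ∀ x ∈ X, 0 ≤ F x - m := fun x hx => by
    have h1 := (abs_le.1 (h.abs_popLoss_sub_le hx hy)).1
    have h2 := mul_le_mul_of_nonneg_left (h.diam x hx y hy) hL
    rw [hm]; linarith
  set k : ℝ := η ^ 2 * L ^ 2 + 2 * η * (F y - m) with hk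
  have hk0 : 0 ≤ k := by have := hmF y hy; positivity
  have hFm : Measurable fun x => F (proj X x) := h.continuous_popLoss_proj.measurable
  have key := lintegral_sum_traj_le (Q := Q) (measurable_sgdNext hne hc hX h.measurable η)
    (I := X) (fun s _ z => sgdNext_mem hne hc g η s z)
    (c := fun x => ENNReal.ofReal (2 * η * (F (proj X x) - m)))
    (((hFm.sub_const m).const_mul _).ennreal_ofReal)
    (Φ := fun T x => ENNReal.ofReal (‖x - y‖ ^ 2 + T * k)) (N := T) ?_ le_rfl hx
  · have hmeas : Measurable fun w : Fin T → Z => F (sgdAvg X g η T w x) := by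
      have e : (fun w : Fin T → Z => F (sgdAvg X g η T w x)) =
          fun w => F (proj X (sgdAvg X g η T w x)) := by
        funext w
        rw [proj_of_mem hne hc hX (sgdAvg_mem hne hc hX g η w hx)]
      rw [e]
      exact hFm.comp ((measurable_sgdAvg hne hc hX h.measurable η T).comp
        (measurable_id.prodMk measurable_const))
    have hT0 : (0 : ℝ) < T := by positivity
    have hI : Integrable (fun w : Fin T → Z => F (sgdAvg X g η T w x))
        (Measure.pi fun _ => Q) := by
      refine Integrable.of_bound hmeas.aestronglyMeasurable (|F y| + L * R)
        (Filter.Eventually.of_forall fun w => ?_)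
      have hav := sgdAvg_mem hne hc hX g η w hx
      have h1 := h.abs_popLoss_sub_le hav hy
      have h2 := mul_le_mul_of_nonneg_left (h.diam _ hav y hy) hL
      rw [Real.norm_eq_abs]
      have := abs_sub_abs_le_abs_sub (F (sgdAvg X g η T w x)) (F y)
      linarith
    -- Jensen: the loss of the average iterate is at most the average loss of the iterates.
    have hjen : ∀ w : Fin T → Z, 2 * η * T * (F (sgdAvg X g η T w x) - m) ≤
        ∑ t, 2 * η * (F (proj X (traj (sgdNext X g η) T w x t)) - m) := by
      intro w
      have hmem : ∀ t, traj (sgdNext X g η) T w x t ∈ X := fun t =>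
        traj_mem (fun s _ z => sgdNext_mem hne hc g η s z) w hx t
      have h1 := h.convexOn_popLoss.map_sum_le (t := Finset.univ)
        (w := fun _ : Fin T => (T : ℝ)⁻¹) (p := fun t => traj (sgdNext X g η) T w x t) (fun _ _ => by positivity)
        (by simp [hT]) (fun t _ => hmem t)
      rw [← Finset.smul_sum, ← Finset.smul_sum] at h1
      have h2 : sgdAvg X g η T w x = (T : ℝ)⁻¹ • ∑ t, traj (sgdNext X g η) T w x t := by
        simp [sgdAvg, hT]
      rw [← h2, smul_eq_mul] at h1
      simp_rw [fun t => proj_of_mem hne hc hX (hmem t)]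
      rw [← Finset.mul_sum, Finset.sum_sub_distrib, Finset.sum_const, Finset.card_univ,
        Fintype.card_fin, nsmul_eq_mul, mul_assoc]
      refine mul_le_mul_of_nonneg_left ?_ (by positivity)
      have := mul_le_mul_of_nonneg_left h1 hT0.le
      rw [← mul_assoc, mul_inv_cancel₀ hT0.ne', one_mul] at this
      linarith
    have h3 : ENNReal.ofReal (∫ w, 2 * η * T * (F (sgdAvg X g η T w x) - m)
        ∂(Measure.pi fun _ => Q)) ≤ ENNReal.ofReal (‖x - y‖ ^ 2 + T * k) := by
      have hint2 : Integrable (fun w => 2 * η * T * (F (sgdAvg X g η T w x) - m))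
          (Measure.pi fun _ => Q) := (hI.sub (integrable_const m)).const_mul _
      rw [ofReal_integral_eq_lintegral_ofReal hint2
        (Filter.Eventually.of_forall fun w => by
          have := hmF _ (sgdAvg_mem hne hc hX g η w hx)
          simp only [Pi.zero_apply]
          positivity)]
      refine le_trans (lintegral_mono fun w => ?_) key
      refine (ENNReal.ofReal_le_ofReal (hjen w)).trans (le_of_eq ?_)
      exact ENNReal.ofReal_sum_of_nonneg fun t _ => by
        have := hmF _ (hpm (traj (sgdNext X g η) T w x t))
        positivity
    rw [ENNReal.ofReal_le_ofReal_iff (by positivity), integral_const_mul,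
      integral_sub hI (integrable_const m)] at h3
    simp only [integral_const, probReal_univ, smul_eq_mul, one_mul] at h3
    have h4 : ∫ w, F (sgdAvg X g η T w x) ∂(Measure.pi fun _ => Q) - m ≤
        (‖x - y‖ ^ 2 + T * k) / (2 * η * T) := by
      rw [le_div_iff₀ (by positivity)]; linarith
    have h5 : (‖x - y‖ ^ 2 + T * k) / (2 * η * T) =
        ‖x - y‖ ^ 2 / (2 * η * T) + η * L ^ 2 / 2 + (F y - m) := by
      rw [hk]; field_simp; ring
    linarith
  · intro T _ s hs
    -- The usual one-step estimate: projecting does not increase the distance to `y`, and the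
    -- expanded cross term has, in expectation, at least the size `2η (F s - F y)` by convexity.
    have hb : ∀ z, ‖sgdNext X g η s z - y‖ ^ 2 ≤
        ‖s - y‖ ^ 2 - 2 * η * ⟪g s z, s - y⟫ + η ^ 2 * L ^ 2 := by
      intro z
      have h1 : ‖sgdNext X g η s z - y‖ ≤ ‖(s - y) - η • g s z‖ := by
        have := norm_proj_sub_le hne hc hX (s - η • g s z) hy
        rwa [show s - η • g s z - y = (s - y) - η • g s z by abel] at this
      have h2 := pow_le_pow_left₀ (norm_nonneg _) h1 2
      rw [norm_sub_sq_real (s - y), inner_smul_right, norm_smul, Real.norm_of_nonneg hη.le,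
        real_inner_comm] at h2
      have h3 := pow_le_pow_left₀ (norm_nonneg _) (h.bounded s z) 2
      nlinarith [sq_nonneg η]
    have hi : Integrable (fun z => ⟪g s z, s - y⟫) Q := (h.integrable_grad s).inner_const _
    have hA : F s - F y ≤ ∫ z, ⟪g s z, s - y⟫ ∂Q := by
      rw [hF]
      unfold popLoss
      rw [← integral_sub (h.loss_integrable s hs) (h.loss_integrable y hy)]
      refine integral_mono ((h.loss_integrable s hs).sub (h.loss_integrable y hy)) hi fun z => ?_
      have := h.subgradient z s hs y hy
      have e : ⟪g s z, y - s⟫ = -⟪g s z, s - y⟫ := by rw [← inner_neg_right, neg_sub]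
      rw [e] at this
      linarith
    have hi2 : Integrable (fun z => ‖s - y‖ ^ 2 - 2 * η * ⟪g s z, s - y⟫ + η ^ 2 * L ^ 2 + T * k)
        Q := (((integrable_const _).sub (hi.const_mul _)).add (integrable_const _)).add
          (integrable_const _)
    have h5 : ∫⁻ z, ENNReal.ofReal (‖sgdNext X g η s z - y‖ ^ 2 + T * k) ∂Q ≤
        ENNReal.ofReal
          (∫ z, (‖s - y‖ ^ 2 - 2 * η * ⟪g s z, s - y⟫ + η ^ 2 * L ^ 2 + T * k) ∂Q) := by
      rw [ofReal_integral_eq_lintegral_ofReal hi2 (Filter.Eventually.of_forall fun z => by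
        have := hb z
        have h7 : 0 ≤ ‖sgdNext X g η s z - y‖ ^ 2 + T * k := by positivity
        simp only [Pi.zero_apply]
        linarith)]
      refine lintegral_mono fun z => ENNReal.ofReal_le_ofReal ?_
      linarith [hb z]
    have h6 : ∫ z, (‖s - y‖ ^ 2 - 2 * η * ⟪g s z, s - y⟫ + η ^ 2 * L ^ 2 + T * k) ∂Q =
        ‖s - y‖ ^ 2 - 2 * η * ∫ z, ⟪g s z, s - y⟫ ∂Q + η ^ 2 * L ^ 2 + T * k := by
      have e : ∀ z, ‖s - y‖ ^ 2 - 2 * η * ⟪g s z, s - y⟫ + η ^ 2 * L ^ 2 + T * k =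
          (‖s - y‖ ^ 2 + η ^ 2 * L ^ 2 + T * k) - 2 * η * ⟪g s z, s - y⟫ := fun z => by ring
      simp_rw [e]
      rw [integral_sub (integrable_const _) (hi.const_mul _), integral_const_mul]
      simp
      ring
    have h8 : 0 ≤ ∫ z, (‖s - y‖ ^ 2 - 2 * η * ⟪g s z, s - y⟫ + η ^ 2 * L ^ 2 + T * k) ∂Q := by
      refine integral_nonneg fun z => ?_
      have := hb z
      have h7 : 0 ≤ ‖sgdNext X g η s z - y‖ ^ 2 + T * k := by positivity
      simp only [Pi.zero_apply]
      linarith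
    refine (add_le_add_right h5 _).trans ?_
    have h9 := hmF s hs
    rw [proj_of_mem hne hc hX hs, ← ENNReal.ofReal_add (by positivity) h8, h6]
    refine ENNReal.ofReal_le_ofReal ?_
    push_cast
    rw [hk]
    nlinarith

/-- One gradient step on the population loss. -/
def popNext (X : Set (E d)) (g : E d → Z → E d) (Q : Measure Z) (η : ℝ) (u : E d) : E d :=
  proj X (u - η • ∫ z, g u z ∂Q)

theorem IsTame.measurable_popNext (h : IsTame X f g Q L R β) (η : ℝ) :
    Measurable (popNext X g Q η) := by
  have h1 : StronglyMeasurable fun u : E d => ∫ z, g u z ∂Q :=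
    StronglyMeasurable.integral_prod_right (f := g) h.measurable.stronglyMeasurable
  exact (continuous_proj h.nonempty h.compact h.convex).measurable.comp
    (measurable_id.sub (h1.measurable.const_smul η))

/-- Stochastic and population gradient descent side by side. -/
def pairNext (X : Set (E d)) (g : E d → Z → E d) (Q : Measure Z) (η : ℝ) (p : E d × E d) (z : Z) :
    E d × E d := (sgdNext X g η p.1 z, popNext X g Q η p.2)

theorem IsTame.measurable_pairNext (h : IsTame X f g Q L R β) (η : ℝ) :
    Measurable (Function.uncurry (pairNext X g Q η)) := by
  have h1 : Measurable fun q : (E d × E d) × Z => (q.1.1, q.2) := by fun_prop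
  have h2 : Measurable fun q : (E d × E d) × Z => q.1.2 := by fun_prop
  have h3 := (measurable_sgdNext h.nonempty h.compact h.convex h.measurable η).comp h1
  have h4 := (h.measurable_popNext η).comp h2
  exact Measurable.prodMk h3 h4

/-- Before projection, the new difference is `A` plus centred noise of norm at most `2ηL`, where `A`
is the difference after two population steps and `‖A‖ ≤ ‖x - u‖` by nonexpansiveness. Expanding the
square, the noise costs `4η²L²`, and by Hoeffding's lemma the cross term is subgaussian with
parameter proportional to `‖A‖²`; its exponential moment only inflates the coefficient of `‖x -
u‖²`. -/
theorem IsTame.lintegral_exp_norm_sgdNext_sub_popNext_le (h : IsTame X f g Q L R β) {η : ℝ}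
    (hη : 0 ≤ η) (hηβ : η * β ≤ 1) {x u : E d} (hx : x ∈ X) (hu : u ∈ X) {r : ℝ} (hr : 0 ≤ r) :
    ∫⁻ z, ENNReal.ofReal (Real.exp (r * ‖sgdNext X g η x z - popNext X g Q η u‖ ^ 2)) ∂Q ≤
      ENNReal.ofReal (Real.exp (4 * r * η ^ 2 * L ^ 2 +
        r * (1 + 2 * r * η ^ 2 * L ^ 2) * ‖x - u‖ ^ 2)) := by
  have hL := h.nonneg
  set gx : E d := ∫ z, g x z ∂Q with hgx
  set gu : E d := ∫ z, g u z ∂Q with hgu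
  set A : E d := (x - η • gx) - (u - η • gu) with hA
  have hAn : ‖A‖ ≤ ‖x - u‖ := by
    have hi : ∀ x, Integrable (fun z => x - η • g x z) Q := fun x =>
      (integrable_const x).sub ((h.integrable_grad x).smul η)
    have e : ∀ x, x - η • ∫ z, g x z ∂Q = ∫ z, (x - η • g x z) ∂Q := fun x => by
      have hs : Integrable (fun z => η • g x z) Q := (h.integrable_grad x).smul η
      rw [integral_sub (integrable_const x) hs, integral_smul]
      simp
    rw [hA, hgx, hgu, e x, e u, ← integral_sub (hi x) (hi u)]
    have := norm_integral_le_of_norm_le_const (μ := Q)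
      (f := fun z => (x - η • g x z) - (u - η • g u z)) (C := ‖x - u‖)
      (Filter.Eventually.of_forall fun z => h.nonexpansive η hη hηβ z x hx u hu)
    simpa using this
  have hgxL : ‖gx‖ ≤ L := by
    have := norm_integral_le_of_norm_le_const (μ := Q) (f := g x) (C := L)
      (Filter.Eventually.of_forall fun z => h.bounded x z)
    simpa using this
  have hgm : Measurable (g x) := h.measurable.comp measurable_prodMk_left
  have hpt : ∀ z, ‖sgdNext X g η x z - popNext X g Q η u‖ ^ 2 ≤
      ‖x - u‖ ^ 2 + 4 * η ^ 2 * L ^ 2 + 2 * η * ⟪A, gx - g x z⟫ := by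
    intro z
    have h1 : ‖sgdNext X g η x z - popNext X g Q η u‖ ≤ ‖A + η • (gx - g x z)‖ := by
      have := norm_proj_sub_proj_le h.nonempty h.compact h.convex (x - η • g x z) (u - η • gu)
      rwa [show (x - η • g x z) - (u - η • gu) = A + η • (gx - g x z) by
        rw [hA, smul_sub]; abel] at this
    have h2 := pow_le_pow_left₀ (norm_nonneg _) h1 2
    rw [norm_add_sq_real, inner_smul_right, norm_smul, Real.norm_of_nonneg hη] at h2
    have h3 : ‖gx - g x z‖ ≤ 2 * L := (norm_sub_le _ _).trans (by linarith [h.bounded x z])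
    have h4 := pow_le_pow_left₀ (norm_nonneg _) h3 2
    have h5 := pow_le_pow_left₀ (norm_nonneg _) hAn 2
    have h6 := mul_le_mul_of_nonneg_left h4 (sq_nonneg η)
    nlinarith
  have hsg : HasSubgaussianMGF (fun z => ⟪A, gx - g x z⟫)
      ((‖L * ‖A‖ - (-(L * ‖A‖))‖₊ / 2) ^ 2) Q := by
    have hb : ∀ᵐ z ∂Q, -⟪A, g x z⟫ ∈ Set.Icc (-(L * ‖A‖)) (L * ‖A‖) := by
      refine Filter.Eventually.of_forall fun z => ?_
      have h1 := abs_real_inner_le_norm A (g x z)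
      have h2 : ‖A‖ * ‖g x z‖ ≤ L * ‖A‖ := by
        rw [mul_comm]; exact mul_le_mul_of_nonneg_right (h.bounded x z) (norm_nonneg _)
      have h3 := abs_le.1 (h1.trans h2)
      exact ⟨by linarith, by linarith⟩
    have := hasSubgaussianMGF_of_mem_Icc (μ := Q) (X := fun z => -⟪A, g x z⟫)
      (by fun_prop) hb
    refine this.congr (Filter.Eventually.of_forall fun z => ?_)
    simp only [integral_neg, inner_sub_right]
    rw [integral_inner (h.integrable_grad x)]
    ring
  have hmgf := hsg.mgf_le (2 * r * η)
  have hcst : (((‖L * ‖A‖ - (-(L * ‖A‖))‖₊ / 2) ^ 2 : NNReal) : ℝ) = L ^ 2 * ‖A‖ ^ 2 := by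
    push_cast
    rw [Real.norm_of_nonneg (by have := norm_nonneg A; nlinarith [mul_nonneg hL this])]
    ring
  rw [hcst, mgf] at hmgf
  have hI := hsg.integrable_exp_mul (2 * r * η)
  calc _ ≤ ∫⁻ z, ENNReal.ofReal (Real.exp (r * (‖x - u‖ ^ 2 + 4 * η ^ 2 * L ^ 2)) *
        Real.exp (2 * r * η * ⟪A, gx - g x z⟫)) ∂Q := by
        refine lintegral_mono fun z => ENNReal.ofReal_le_ofReal ?_
        rw [← Real.exp_add]
        refine Real.exp_le_exp.2 ?_
        have := mul_le_mul_of_nonneg_left (hpt z) hr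
        linarith
    _ = ENNReal.ofReal (∫ z, Real.exp (r * (‖x - u‖ ^ 2 + 4 * η ^ 2 * L ^ 2)) *
        Real.exp (2 * r * η * ⟪A, gx - g x z⟫) ∂Q) := by
        rw [ofReal_integral_eq_lintegral_ofReal (hI.const_mul _)
          (Filter.Eventually.of_forall fun z => by positivity)]
    _ ≤ _ := by
        refine ENNReal.ofReal_le_ofReal ?_
        rw [integral_const_mul]
        refine (mul_le_mul_of_nonneg_left hmgf (Real.exp_nonneg _)).trans ?_
        rw [← Real.exp_add]
        refine Real.exp_le_exp.2 ?_
        have h5 := pow_le_pow_left₀ (norm_nonneg _) hAn 2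
        have : L ^ 2 * ‖A‖ ^ 2 * (2 * r * η) ^ 2 / 2 ≤
            L ^ 2 * ‖x - u‖ ^ 2 * (2 * r * η) ^ 2 / 2 := by
          gcongr
        nlinarith

/-- The summand with index `t` is the cost `t` steps ahead, pulled back to the present. One
pull-back adds `4rη²L² ≤ 1/T` to the exponent and `2r²η²L² ≤ lam/T` to the rate `r = lam (1 + t/T)`.
Over `T` steps the constant in the exponent thus stays below 1 and the rate below `2 lam`; the 8 in
`lam` is what makes both estimates hold. -/
theorem IsTame.lintegral_potential_le (h : IsTame X f g Q L R β) (hL : 0 < L) {η : ℝ}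
    (hη : 0 < η) (hηβ : η * β ≤ 1) {T n : ℕ} (hn : n < T) {p : E d × E d} (hp1 : p.1 ∈ X)
    (hp2 : p.2 ∈ X) :
    ENNReal.ofReal (Real.exp (1 / (8 * η ^ 2 * L ^ 2 * T) * ‖p.1 - p.2‖ ^ 2)) +
      ∫⁻ z, ∑ t ∈ Finset.range n, ENNReal.ofReal (Real.exp (t / T +
        1 / (8 * η ^ 2 * L ^ 2 * T) * (1 + t / T) *
          ‖(pairNext X g Q η p z).1 - (pairNext X g Q η p z).2‖ ^ 2)) ∂Q ≤
      ∑ t ∈ Finset.range (n + 1), ENNReal.ofReal (Real.exp (t / T +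
        1 / (8 * η ^ 2 * L ^ 2 * T) * (1 + t / T) * ‖p.1 - p.2‖ ^ 2)) := by
  have hT0 : (0 : ℝ) < T := by have : 0 < T := by omega
                               exact_mod_cast this
  set lam : ℝ := 1 / (8 * η ^ 2 * L ^ 2 * T) with hlam
  have hlam0 : 0 < lam := by positivity
  rw [Finset.sum_range_succ', add_comm]
  simp only [Nat.cast_zero, zero_div, zero_add, add_zero, mul_one]
  gcongr
  have hm : Measurable fun z => pairNext X g Q η p z :=
    Measurable.of_uncurry_left (h.measurable_pairNext η)
  have hm2 : Measurable fun z => ‖(pairNext X g Q η p z).1 - (pairNext X g Q η p z).2‖ :=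
    (hm.fst.sub hm.snd).norm
  rw [lintegral_finsetSum _ fun t _ => by fun_prop]
  refine Finset.sum_le_sum fun t ht => ?_
  have ht' : t + 1 ≤ T := by have := Finset.mem_range.1 ht; omega
  have htT : (t : ℝ) / T ≤ 1 := (div_le_one hT0).2 (by exact_mod_cast (by omega : t ≤ T))
  have ht0 : 0 ≤ (t : ℝ) / T := by positivity
  set r : ℝ := lam * (1 + t / T) with hr
  have hr0 : 0 ≤ r := by positivity
  have h1 := h.lintegral_exp_norm_sgdNext_sub_popNext_le hη.le hηβ hp1 hp2 hr0
  have hlam8 : lam * (η ^ 2 * L ^ 2) = 1 / (8 * T) := by rw [hlam]; field_simp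
  have hrl : r * (η ^ 2 * L ^ 2) ≤ 1 / (4 * T) := by
    have e : r * (η ^ 2 * L ^ 2) = 1 / (8 * T) * (1 + (t : ℝ) / T) := by
      rw [← hlam8, hr]; ring
    rw [e]
    calc 1 / (8 * (T : ℝ)) * (1 + (t : ℝ) / T) ≤ 1 / (8 * T) * 2 := by gcongr; linarith
      _ = _ := by field_simp; norm_num
  calc ∫⁻ z, ENNReal.ofReal (Real.exp (t / T + r *
        ‖(pairNext X g Q η p z).1 - (pairNext X g Q η p z).2‖ ^ 2)) ∂Q
      = ENNReal.ofReal (Real.exp (t / T)) * ∫⁻ z, ENNReal.ofReal (Real.exp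
          (r * ‖sgdNext X g η p.1 z - popNext X g Q η p.2‖ ^ 2)) ∂Q := by
        rw [← lintegral_const_mul' _ _ ENNReal.ofReal_ne_top]
        refine lintegral_congr fun z => ?_
        rw [← ENNReal.ofReal_mul (Real.exp_nonneg _), ← Real.exp_add]
        rfl
    _ ≤ ENNReal.ofReal (Real.exp (t / T)) * ENNReal.ofReal (Real.exp (4 * r * η ^ 2 * L ^ 2 +
          r * (1 + 2 * r * η ^ 2 * L ^ 2) * ‖p.1 - p.2‖ ^ 2)) := by gcongr
    _ = ENNReal.ofReal (Real.exp (t / T + (4 * r * η ^ 2 * L ^ 2 +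
          r * (1 + 2 * r * η ^ 2 * L ^ 2) * ‖p.1 - p.2‖ ^ 2))) := by
        rw [← ENNReal.ofReal_mul (Real.exp_nonneg _), ← Real.exp_add]
    _ ≤ _ := by
        refine ENNReal.ofReal_le_ofReal (Real.exp_le_exp.2 ?_)
        push_cast
        have e1 : ((t : ℝ) + 1) / T = t / T + 1 / T := by ring
        have e2 : 4 * r * η ^ 2 * L ^ 2 ≤ 1 / T := by
          calc 4 * r * η ^ 2 * L ^ 2 = 4 * (r * (η ^ 2 * L ^ 2)) := by ring
            _ ≤ 4 * (1 / (4 * (T : ℝ))) := by gcongr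
            _ = 1 / (T : ℝ) := by field_simp
        have e3 : r * (1 + 2 * r * η ^ 2 * L ^ 2) ≤ lam * (1 + (t + 1) / T) := by
          have e4 : r * (2 * r * η ^ 2 * L ^ 2) ≤ lam * (1 / T) := by
            calc r * (2 * r * η ^ 2 * L ^ 2) = 2 * r * (r * (η ^ 2 * L ^ 2)) := by ring
              _ ≤ 2 * r * (1 / (4 * T)) := by gcongr
              _ = lam * (1 + t / T) * (1 / T) / 2 := by rw [hr]; ring
              _ ≤ lam * 2 * (1 / T) / 2 := by gcongr; linarith
              _ = _ := by ring
          rw [e1]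
          calc _ = r + r * (2 * r * η ^ 2 * L ^ 2) := by ring
            _ ≤ r + lam * (1 / T) := by gcongr
            _ = _ := by rw [hr]; ring
        have e5 := mul_le_mul_of_nonneg_right e3 (sq_nonneg ‖p.1 - p.2‖)
        linarith

/-- The average iterate of one-pass SGD concentrates around a deterministic point. -/
theorem IsTame.exists_sgdAvg_concentration (h : IsTame X f g Q L R β) (hL : 0 < L) {η : ℝ}
    (hη : 0 < η) (hηβ : η * β ≤ 1) {T : ℕ} (hT : T ≠ 0) {x : E d} (hx : x ∈ X) :
    ∃ c : E d, ∀ r : ℝ, 0 ≤ r →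
      (Measure.pi fun _ : Fin T => Q) {w | r < ‖sgdAvg X g η T w x - c‖} ≤
        ENNReal.ofReal (Real.exp (1 - r ^ 2 / (8 * η ^ 2 * L ^ 2 * T))) := by
  have hne := h.nonempty
  have hc := h.compact
  have hX := h.convex
  have hT0 : (0 : ℝ) < T := by positivity
  set lam : ℝ := 1 / (8 * η ^ 2 * L ^ 2 * T) with hlam
  have hlam0 : 0 < lam := by positivity
  set next : E d × E d → Z → E d × E d := pairNext X g Q η with hnext
  have hnm : Measurable (Function.uncurry next) := h.measurable_pairNext η
  have key := lintegral_sum_traj_le (Q := Q) hnm (I := X ×ˢ X)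
    (fun s _ z => ⟨sgdNext_mem hne hc g η _ z, proj_mem hne hc _⟩)
    (c := fun p => ENNReal.ofReal (Real.exp (lam * ‖p.1 - p.2‖ ^ 2)))
    (by fun_prop)
    (Φ := fun n p => ∑ t ∈ Finset.range n,
      ENNReal.ofReal (Real.exp (t / T + lam * (1 + t / T) * ‖p.1 - p.2‖ ^ 2)))
    (N := T) ?_ le_rfl (s := (x, x)) ⟨hx, hx⟩
  -- The centre is the average iterate of gradient descent on the population loss, started at the
  -- same point.
  · set c : E d := (T : ℝ)⁻¹ • ∑ t : Fin T, (popNext X g Q η)^[t] x with hcdef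
    refine ⟨c, fun r hr => ?_⟩
    have hpath : ∀ w : Fin T → Z, ENNReal.ofReal
        (T * Real.exp (lam * ‖sgdAvg X g η T w x - c‖ ^ 2)) ≤
        ∑ t, ENNReal.ofReal (Real.exp (lam * ‖(traj next T w (x, x) t).1 -
          (traj next T w (x, x) t).2‖ ^ 2)) := by
      intro w
      rw [← ENNReal.ofReal_sum_of_nonneg fun t _ => (Real.exp_nonneg _)]
      refine ENNReal.ofReal_le_ofReal ?_
      have e : ∀ t, traj next T w (x, x) t =
          (traj (sgdNext X g η) T w x t, (popNext X g Q η)^[t] x) := fun t => by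
        rw [← traj_const (popNext X g Q η) w x t]
        exact traj_prod (sgdNext X g η) (fun u _ => popNext X g Q η u) w x x t
      simp_rw [e]
      set v : Fin T → E d := fun t => traj (sgdNext X g η) T w x t - (popNext X g Q η)^[t] x
        with hv
      have hav : sgdAvg X g η T w x - c = (T : ℝ)⁻¹ • ∑ t, v t := by
        simp [sgdAvg, hT, hcdef, hv, Finset.sum_sub_distrib, smul_sub]
      have hsq : ‖sgdAvg X g η T w x - c‖ ^ 2 ≤ ∑ t, (T : ℝ)⁻¹ • ‖v t‖ ^ 2 := by
        rw [hav, norm_smul, Real.norm_of_nonneg (by positivity), ← Finset.smul_sum, smul_eq_mul]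
        have h1 : ‖∑ t, v t‖ ^ 2 ≤ T * ∑ t, ‖v t‖ ^ 2 := by
          refine (pow_le_pow_left₀ (norm_nonneg _) (norm_sum_le _ _) 2).trans ?_
          simpa using sq_sum_le_card_mul_sum_sq (s := (Finset.univ : Finset (Fin T)))
            (f := fun t => ‖v t‖)
        calc ((T : ℝ)⁻¹ * ‖∑ t, v t‖) ^ 2 = (T : ℝ)⁻¹ ^ 2 * ‖∑ t, v t‖ ^ 2 := by ring
          _ ≤ (T : ℝ)⁻¹ ^ 2 * (T * ∑ t, ‖v t‖ ^ 2) := by gcongr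
          _ = _ := by field_simp
      -- Jensen for the exponential passes from the average iterate to the sum of per-step costs,
      -- which the potential controls.
      have hj := convexOn_exp.map_sum_le (t := Finset.univ)
        (w := fun _ : Fin T => (T : ℝ)⁻¹) (p := fun t => lam * ‖v t‖ ^ 2) (fun _ _ => by positivity) (by simp [hT]) (by simp)
      have h2 : Real.exp (lam * ‖sgdAvg X g η T w x - c‖ ^ 2) ≤
          (T : ℝ)⁻¹ * ∑ t, Real.exp (lam * ‖v t‖ ^ 2) := by
        refine le_trans (Real.exp_le_exp.2 ?_) (hj.trans (le_of_eq ?_))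
        · refine (mul_le_mul_of_nonneg_left hsq hlam0.le).trans (le_of_eq ?_)
          rw [Finset.mul_sum]
          refine Finset.sum_congr rfl fun t _ => ?_
          simp only [smul_eq_mul]; ring
        · rw [← Finset.smul_sum, smul_eq_mul]
      calc _ ≤ (T : ℝ) * ((T : ℝ)⁻¹ * ∑ t, Real.exp (lam * ‖v t‖ ^ 2)) := by gcongr
        _ = ∑ t, Real.exp (lam * ‖v t‖ ^ 2) := by field_simp
    -- Both trajectories start at `x`, so the quadratic part of the potential vanishes and at most
    -- `T * e` remains; Markov's inequality does the rest.
    have hΦ : ∑ t ∈ Finset.range T, ENNReal.ofReal (Real.exp (t / T + lam * (1 + t / T) *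
        ‖((x, x) : E d × E d).1 - ((x, x) : E d × E d).2‖ ^ 2)) ≤
        ENNReal.ofReal (T * Real.exp 1) := by
      refine (Finset.sum_le_card_nsmul _ _ (ENNReal.ofReal (Real.exp 1)) fun t ht => ?_).trans
        (le_of_eq ?_)
      · refine ENNReal.ofReal_le_ofReal (Real.exp_le_exp.2 ?_)
        have : (t : ℝ) / T ≤ 1 := (div_le_one hT0).2
          (by exact_mod_cast (Finset.mem_range.1 ht).le)
        simpa using this
      · rw [Finset.card_range, nsmul_eq_mul, ENNReal.ofReal_mul hT0.le, ENNReal.ofReal_natCast]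
    have hfin := (lintegral_mono hpath).trans (key.trans hΦ)
    have hmark := mul_meas_ge_le_lintegral (μ := Measure.pi fun _ : Fin T => Q)
      (f := fun w => ENNReal.ofReal (T * Real.exp (lam * ‖sgdAvg X g η T w x - c‖ ^ 2))) (by
        have := (measurable_sgdAvg hne hc hX h.measurable η T).comp
          (measurable_id.prodMk (measurable_const (a := x)))
        have h2 : Measurable fun w : Fin T → Z => sgdAvg X g η T w x := this
        fun_prop) (ENNReal.ofReal (T * Real.exp (lam * r ^ 2)))
    have hsub : {w | r < ‖sgdAvg X g η T w x - c‖} ⊆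
        {w | ENNReal.ofReal (T * Real.exp (lam * r ^ 2)) ≤
          ENNReal.ofReal (T * Real.exp (lam * ‖sgdAvg X g η T w x - c‖ ^ 2))} := by
      intro w hw
      have hw' : r < ‖sgdAvg X g η T w x - c‖ := hw
      refine ENNReal.ofReal_le_ofReal ?_
      gcongr
    have h3 := (mul_le_mul_right (measure_mono (μ := Measure.pi fun _ : Fin T => Q) hsub)
      (ENNReal.ofReal (T * Real.exp (lam * r ^ 2)))).trans (hmark.trans hfin)
    have hpos : 0 < T * Real.exp (lam * r ^ 2) := by positivity
    rw [mul_comm, ← ENNReal.le_div_iff_mul_le (Or.inl (ENNReal.ofReal_pos.2 hpos).ne')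
      (Or.inl ENNReal.ofReal_ne_top), ← ENNReal.ofReal_div_of_pos hpos] at h3
    refine h3.trans (le_of_eq ?_)
    congr 1
    rw [mul_div_mul_left _ _ hT0.ne', ← Real.exp_sub, hlam]
    congr 1
    ring
  · exact fun n hn p hp => h.lintegral_potential_le hL hη hηβ hn hp.1 hp.2

end Population

end PhasedSGD

end

noncomputable section

namespace PhasedSGD

/-! ### Product measures -/

section Product

variable {ι : Type*} [Fintype ι]

theorem lintegral_pi_prod {α : ι → Type*} [∀ i, MeasurableSpace (α i)] (μ : ∀ i, Measure (α i))
    [∀ i, IsProbabilityMeasure (μ i)] {f : ∀ i, α i → ENNReal} (hf : ∀ i, Measurable (f i)) :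
    ∫⁻ x, ∏ i, f i (x i) ∂(Measure.pi μ) = ∏ i, ∫⁻ x, f i x ∂(μ i) := by
  have h := lintegral_prod_eq_prod_lintegral_of_indepFun (μ := Measure.pi μ) Finset.univ
    (fun i (x : ∀ i, α i) => f i (x i))
    (iIndepFun_pi fun i => (hf i).aemeasurable) fun i => (hf i).comp (measurable_pi_apply i)
  refine h.trans ?_
  exact Finset.prod_congr rfl fun i _ => (measurePreserving_eval μ i).lintegral_comp (hf i)

/-- An injective choice of coordinates of an i.i.d. family is again an i.i.d. family. -/
theorem measurePreserving_select {κ Z : Type*} [Fintype κ] [MeasurableSpace Z] (Q : Measure Z)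
    [IsProbabilityMeasure Q] {e : κ → ι} (he : Function.Injective e) :
    MeasurePreserving (fun (x : ι → Z) k => x (e k)) (Measure.pi fun _ => Q)
      (Measure.pi fun _ => Q) := by
  refine ⟨by fun_prop, ?_⟩
  have h := (iIndepFun_pi (μ := fun _ : ι => Q) (X := fun _ => id)
    fun _ => aemeasurable_id).precomp he
  refine ((iIndepFun_iff_map_fun_eq_pi_map (μ := Measure.pi fun _ : ι => Q)
    (f := fun k (x : ι → Z) => x (e k))
    fun k => (measurable_pi_apply (e k)).aemeasurable).1 h).trans ?_
  congr 1
  funext k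
  exact (measurePreserving_eval (fun _ : ι => Q) (e k)).map_eq

/-- Resampling one coordinate from its own law leaves a product measure invariant. This is the form
in which independence of a single phase from all others is used, both for privacy and for the excess
loss. -/
theorem measurePreserving_update [DecidableEq ι] {α : ι → Type*} [∀ i, MeasurableSpace (α i)]
    (μ : ∀ i, Measure (α i)) [∀ i, IsProbabilityMeasure (μ i)] (k : ι) :
    MeasurePreserving (fun p : (∀ i, α i) × α k => Function.update p.1 k p.2)
      ((Measure.pi μ).prod (μ k)) (Measure.pi μ) := by
  have hm : Measurable fun p : (∀ i, α i) × α k => Function.update p.1 k p.2 := by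
    refine measurable_pi_lambda _ fun i => ?_
    by_cases hik : i = k
    · subst hik; simpa using measurable_snd
    · simp only [Function.update_of_ne hik]
      exact (measurable_pi_apply i).comp measurable_fst
  refine ⟨hm, (Measure.pi_eq fun s hs => ?_).symm⟩
  rw [Measure.map_apply hm (.univ_pi hs)]
  have e : (fun p : (∀ i, α i) × α k => Function.update p.1 k p.2) ⁻¹' Set.univ.pi s =
      (Set.univ.pi (Function.update s k Set.univ)) ×ˢ s k := by
    ext ⟨x, y⟩
    simp only [Set.mem_preimage, Set.mem_univ_pi, Set.mem_prod]
    constructor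
    · intro h
      refine ⟨fun i => ?_, by simpa using h k⟩
      by_cases hik : i = k
      · subst hik; simp
      · simpa [hik] using h i
    · rintro ⟨h1, h2⟩ i
      by_cases hik : i = k
      · subst hik; simpa using h2
      · simpa [hik] using h1 i
  rw [e, Measure.prod_prod, Measure.pi_pi, ← Finset.prod_erase_mul _ _ (Finset.mem_univ k),
    ← Finset.prod_erase_mul (a := k) _ _ (Finset.mem_univ k)]
  simp only [Function.update_self, measure_univ, mul_one]
  congr 1
  refine Finset.prod_congr rfl fun i hi => ?_
  rw [Function.update_of_ne (Finset.ne_of_mem_erase hi)]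

theorem measurePreserving_prodProdProdComm {A B A' B' : Type*} [MeasurableSpace A]
    [MeasurableSpace B] [MeasurableSpace A'] [MeasurableSpace B'] (a : Measure A) (b : Measure B)
    (a' : Measure A') (b' : Measure B') [IsProbabilityMeasure a] [IsProbabilityMeasure b]
    [IsProbabilityMeasure a'] [IsProbabilityMeasure b'] :
    MeasurePreserving (fun q : (A × B) × (A' × B') => ((q.1.1, q.2.1), (q.1.2, q.2.2)))
      ((a.prod b).prod (a'.prod b')) ((a.prod a').prod (b.prod b')) := by
  have hm : Measurable fun q : (A × B) × (A' × B') => ((q.1.1, q.2.1), (q.1.2, q.2.2)) := by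
    fun_prop
  refine ⟨hm, ?_⟩
  refine (Measure.prod_eq_generateFrom (μ := a.prod a') (ν := b.prod b')
    generateFrom_prod generateFrom_prod isPiSystem_prod isPiSystem_prod
    ⟨fun _ => Set.univ, fun _ => ⟨_, .univ, _, .univ, Set.univ_prod_univ⟩, fun _ => by simp,
      Set.iUnion_const _⟩
    ⟨fun _ => Set.univ, fun _ => ⟨_, .univ, _, .univ, Set.univ_prod_univ⟩, fun _ => by simp,
      Set.iUnion_const _⟩
    ?_).symm
  rintro _ ⟨s, hs, s', hs', rfl⟩ _ ⟨t, ht, t', ht', rfl⟩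
  rw [Measure.map_apply hm ((hs.prod hs').prod (ht.prod ht'))]
  have e : (fun q : (A × B) × (A' × B') => ((q.1.1, q.2.1), (q.1.2, q.2.2))) ⁻¹'
      ((s ×ˢ s') ×ˢ (t ×ˢ t')) = (s ×ˢ t) ×ˢ (s' ×ˢ t') := by
    ext q; simp only [Set.mem_preimage, Set.mem_prod]; tauto
  rw [e]
  simp only [Measure.prod_prod]
  ring

/-- Resampling coordinate `k` of two independent product families. -/
theorem measurePreserving_update_prod [DecidableEq ι] {α α' : ι → Type*}
    [∀ i, MeasurableSpace (α i)] [∀ i, MeasurableSpace (α' i)]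
    (μ : ∀ i, Measure (α i)) (μ' : ∀ i, Measure (α' i)) [∀ i, IsProbabilityMeasure (μ i)]
    [∀ i, IsProbabilityMeasure (μ' i)] (k : ι) :
    MeasurePreserving (fun q : ((∀ i, α i) × (∀ i, α' i)) × (α k × α' k) =>
        (Function.update q.1.1 k q.2.1, Function.update q.1.2 k q.2.2))
      (((Measure.pi μ).prod (Measure.pi μ')).prod ((μ k).prod (μ' k)))
      ((Measure.pi μ).prod (Measure.pi μ')) :=
  ((measurePreserving_update μ k).prod (measurePreserving_update μ' k)).comp
    (measurePreserving_prodProdProdComm (Measure.pi μ) (Measure.pi μ') (μ k) (μ' k))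

/-- Injectivity of `e` says that no sample is read twice, so the blocks read by different phases are
independent and each consists of i.i.d. samples. -/
theorem measurePreserving_dataLaw {Z : Type*} [MeasurableSpace Z] (Q : Measure Z)
    [IsProbabilityMeasure Q] (n m : ℕ) {κ : ι → Type*} [∀ i, Fintype (κ i)]
    {e : (i : ι) → κ i → Fin n × Fin m}
    (he : Function.Injective fun a : (Σ i, κ i) => e a.1 a.2) :
    MeasurePreserving (fun (D : Dataset Z n m) i (p : κ i) => D (e i p).1 (e i p).2)
      (dataLaw Q n m) (Measure.pi fun i => Measure.pi fun _ : κ i => Q) := by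
  have h1 : MeasurePreserving (MeasurableEquiv.curry (Fin n) (Fin m) Z).symm (dataLaw Q n m)
      (Measure.pi fun _ => Q) := by
    refine ⟨MeasurableEquiv.measurable _, ?_⟩
    have := Measure.infinitePi_map_curry_symm (fun (_ : Fin n) (_ : Fin m) => Q)
    simp only [Measure.infinitePi_eq_pi] at this
    exact this
  have h2 := measurePreserving_select Q he
  have h3 : MeasurePreserving (MeasurableEquiv.piCurry (fun (i : ι) (_ : κ i) => Z))
      (Measure.pi fun _ => Q) (Measure.pi fun i => Measure.pi fun _ : κ i => Q) := by
    refine ⟨MeasurableEquiv.measurable _, ?_⟩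
    have := Measure.infinitePi_map_piCurry (X := fun (i : ι) (_ : κ i) => Z) (fun _ _ => Q)
    simpa only [Measure.infinitePi_eq_pi] using this
  exact h3.comp (h2.comp h1)

end Product

/-! ### Independent uniform variables -/

section Uniform

instance isProbabilityMeasure_uniform :
    IsProbabilityMeasure (volume.restrict (Set.Icc (0 : ℝ) 1)) := ⟨by simp⟩

variable {ι : Type*} [Fintype ι]

open Classical in
-- Chernoff's bound from the exponential moment of the number of successes, which factorizes over
-- the coordinates. The sign of `θ` is free: `θ = 1` serves for an upper tail and `θ = -1` for a
-- lower tail.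
theorem measure_pi_card_ge_le {α : ι → Type*} [∀ i, MeasurableSpace (α i)]
    (μ : ∀ i, Measure (α i)) [∀ i, IsProbabilityMeasure (μ i)] {A : ∀ i, Set (α i)}
    (hA : ∀ i, MeasurableSet (A i)) (θ k : ℝ) :
    (Measure.pi μ) {u | k ≤ θ * (Finset.univ.filter fun i => u i ∈ A i).card} ≤
      ENNReal.ofReal (Real.exp (-k) * ∏ i, (1 + (Real.exp θ - 1) * (μ i).real (A i))) := by
  set f : ∀ i, α i → ENNReal := fun i x =>
    (A i).indicator (fun _ => ENNReal.ofReal (Real.exp θ)) x + (A i)ᶜ.indicator (fun _ => 1) x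
    with hf
  have hfm : ∀ i, Measurable (f i) := fun i =>
    (measurable_const.indicator (hA i)).add (measurable_const.indicator (hA i).compl)
  have hfi : ∀ i, ∫⁻ x, f i x ∂(μ i) =
      ENNReal.ofReal (1 + (Real.exp θ - 1) * (μ i).real (A i)) := by
    intro i
    rw [lintegral_add_left (measurable_const.indicator (hA i)), lintegral_indicator_const (hA i),
      lintegral_indicator_const (hA i).compl, one_mul, ← ofReal_measureReal,
      ← ofReal_measureReal, ← ENNReal.ofReal_mul (Real.exp_nonneg _),
      ← ENNReal.ofReal_add (by positivity) (by positivity), probReal_compl_eq_one_sub (hA i)]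
    congr 1
    ring
  have hprod : ∀ u : ∀ i, α i, ∏ i, f i (u i) = ENNReal.ofReal
      (Real.exp (θ * (Finset.univ.filter fun i => u i ∈ A i).card)) := by
    intro u
    have h1 : ∀ i, f i (u i) = if u i ∈ A i then ENNReal.ofReal (Real.exp θ) else 1 := by
      intro i
      by_cases h : u i ∈ A i <;> simp [hf, h]
    simp_rw [h1]
    rw [Finset.prod_ite, Finset.prod_const, Finset.prod_const_one, mul_one,
      ← ENNReal.ofReal_pow (Real.exp_nonneg _), ← Real.exp_nat_mul, mul_comm]
  have hnn : ∀ i, 0 ≤ 1 + (Real.exp θ - 1) * (μ i).real (A i) := fun i => by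
    have h1 : (μ i).real (A i) ≤ 1 := measureReal_le_one
    have h2 := Real.exp_pos θ
    have h3 : 0 ≤ (μ i).real (A i) := measureReal_nonneg
    nlinarith [mul_nonneg h2.le h3]
  have h1 := lintegral_pi_prod μ hfm
  simp_rw [hprod, hfi] at h1
  rw [← ENNReal.ofReal_prod_of_nonneg fun i _ => hnn i] at h1
  have hmeas : Measurable fun u : ∀ i, α i => ENNReal.ofReal
      (Real.exp (θ * (Finset.univ.filter fun i => u i ∈ A i).card)) := by
    simp_rw [← hprod]
    exact Finset.measurable_prod _ fun i _ => (hfm i).comp (measurable_pi_apply i)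
  have h2 := meas_ge_le_lintegral_div (μ := Measure.pi μ) hmeas.aemeasurable
    (ε := ENNReal.ofReal (Real.exp k)) (ENNReal.ofReal_pos.2 (Real.exp_pos k)).ne'
    ENNReal.ofReal_ne_top
  rw [h1, ← ENNReal.ofReal_div_of_pos (Real.exp_pos k)] at h2
  refine (measure_mono fun u hu => ?_).trans (h2.trans (le_of_eq ?_))
  · exact ENNReal.ofReal_le_ofReal (Real.exp_le_exp.2 hu)
  · rw [Real.exp_neg, div_eq_mul_inv, mul_comm]

theorem uniform_Ico_le (a b : ℝ) :
    (volume.restrict (Set.Icc (0 : ℝ) 1)).real (Set.Ico a b) ≤ |b - a| := by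
  have h1 : (volume.restrict (Set.Icc (0 : ℝ) 1)) (Set.Ico a b) ≤ ENNReal.ofReal (b - a) := by
    rw [Measure.restrict_apply measurableSet_Ico, ← Real.volume_Ico]
    exact measure_mono Set.inter_subset_left
  refine (ENNReal.toReal_mono ENNReal.ofReal_ne_top h1).trans ?_
  rw [ENNReal.toReal_ofReal']
  exact max_le (le_abs_self _) (abs_nonneg _)

theorem uniform_Iio {p : ℝ} (hp0 : 0 ≤ p) (hp1 : p ≤ 1) :
    (volume.restrict (Set.Icc (0 : ℝ) 1)).real (Set.Iio p) = p := by
  rw [measureReal_def, Measure.restrict_apply measurableSet_Iio]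
  have : Set.Iio p ∩ Set.Icc (0 : ℝ) 1 = Set.Ico 0 p := by
    ext x; simp only [Set.mem_inter_iff, Set.mem_Iio, Set.mem_Icc, Set.mem_Ico]
    constructor
    · rintro ⟨h1, h2, _⟩; exact ⟨h2, h1⟩
    · rintro ⟨h1, h2⟩; exact ⟨h2, h1, by linarith⟩
  rw [this, Real.volume_Ico, sub_zero, ENNReal.toReal_ofReal hp0]

end Uniform

end PhasedSGD

end

noncomputable section

namespace PhasedSGD

open scoped RealInnerProductSpace

/-! ### The Laplace distribution -/

section Laplace

variable {b : ℝ}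

theorem isProbabilityMeasure_laplace (hb : 0 < b) : IsProbabilityMeasure (laplace b) := by
  refine ⟨?_⟩
  unfold laplace
  rw [withDensity_apply _ .univ, Measure.restrict_univ]
  have h1 : ∫ x : ℝ, 1 / (2 * b) * Real.exp (-|x| / b) = 1 := by
    have h2 := integral_comp_abs (f := fun x => 1 / (2 * b) * Real.exp (-x / b))
    have h3 : ∫ x in Set.Ioi (0 : ℝ), 1 / (2 * b) * Real.exp (-x / b) = 1 / 2 := by
      rw [integral_const_mul]
      have h4 := integral_exp_mul_Ioi (a := -(1 / b)) (by simpa using hb) 0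
      have h5 : ∀ x : ℝ, -x / b = -(1 / b) * x := fun x => by ring
      simp_rw [h5]
      rw [h4]
      simp
      field_simp
    rw [h3] at h2
    simpa using h2
  rw [← ofReal_integral_eq_lintegral_ofReal
    (Integrable.of_integral_ne_zero (by rw [h1]; exact one_ne_zero))
    (Filter.Eventually.of_forall fun x => by positivity), h1, ENNReal.ofReal_one]

theorem laplace_preimage_add (b a : ℝ) {S : Set ℝ} (hS : MeasurableSet S) :
    laplace b {x | x + a ∈ S} =
      ∫⁻ x in S, ENNReal.ofReal (1 / (2 * b) * Real.exp (-|x - a| / b)) := by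
  have hS' : MeasurableSet {x : ℝ | x + a ∈ S} := hS.preimage (measurable_add_const a)
  unfold laplace
  rw [withDensity_apply _ hS', ← lintegral_indicator hS', ← lintegral_indicator hS]
  refine Eq.trans (lintegral_congr fun x => ?_) (lintegral_add_right_eq_self _ a)
  by_cases hx : x + a ∈ S <;> simp [Set.indicator, hx]

/-- The Laplace mechanism: by the triangle inequality, translating by `a` changes the density by at
most the factor `exp (|a| / b)`. -/
theorem laplace_preimage_add_le (hb : 0 < b) (a : ℝ) {S : Set ℝ} (hS : MeasurableSet S) :
    laplace b {x | x + a ∈ S} ≤ ENNReal.ofReal (Real.exp (|a| / b)) * laplace b S := by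
  rw [laplace_preimage_add b a hS]
  unfold laplace
  rw [withDensity_apply _ hS, ← lintegral_const_mul' _ _ ENNReal.ofReal_ne_top]
  refine lintegral_mono fun x => ?_
  rw [← ENNReal.ofReal_mul (Real.exp_nonneg _)]
  refine ENNReal.ofReal_le_ofReal ?_
  rw [mul_left_comm, ← Real.exp_add]
  refine mul_le_mul_of_nonneg_left (Real.exp_le_exp.2 ?_) (by positivity)
  rw [← add_div]
  refine div_le_div_of_nonneg_right ?_ hb.le
  linarith [abs_sub_abs_le_abs_sub x a, abs_sub_comm x a]

theorem laplace_Ici_le (hb : 0 < b) {t : ℝ} (ht : 0 ≤ t) :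
    laplace b (Set.Ici t) ≤ ENNReal.ofReal (Real.exp (-t / b)) := by
  have := isProbabilityMeasure_laplace hb
  have e : Set.Ici t = {x : ℝ | x + (-t) ∈ Set.Ici 0} := by ext x; simp
  rw [e, laplace_preimage_add b _ measurableSet_Ici]
  calc _ = ∫⁻ x in Set.Ici (0 : ℝ), ENNReal.ofReal (Real.exp (-t / b)) *
        ENNReal.ofReal (1 / (2 * b) * Real.exp (-|x| / b)) := by
        refine setLIntegral_congr_fun measurableSet_Ici fun x hx => ?_
        have hx' : 0 ≤ x := hx
        rw [← ENNReal.ofReal_mul (Real.exp_nonneg _), mul_left_comm, ← Real.exp_add,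
          abs_of_nonneg hx', abs_of_nonneg (by linarith : 0 ≤ x - -t)]
        congr 4
        ring
    _ = ENNReal.ofReal (Real.exp (-t / b)) * laplace b (Set.Ici 0) := by
        rw [lintegral_const_mul' _ _ ENNReal.ofReal_ne_top]
        unfold laplace
        rw [withDensity_apply _ measurableSet_Ici]
    _ ≤ _ := mul_le_of_le_one_right' prob_le_one

theorem laplace_Iic_le (hb : 0 < b) {t : ℝ} (ht : 0 ≤ t) :
    laplace b (Set.Iic (-t)) ≤ ENNReal.ofReal (Real.exp (-t / b)) := by
  have := isProbabilityMeasure_laplace hb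
  have e : Set.Iic (-t) = {x : ℝ | x + t ∈ Set.Iic 0} := by
    ext x; simp only [Set.mem_Iic, Set.mem_ofPred_eq]; constructor <;> intro h <;> linarith
  rw [e, laplace_preimage_add b _ measurableSet_Iic]
  calc _ = ∫⁻ x in Set.Iic (0 : ℝ), ENNReal.ofReal (Real.exp (-t / b)) *
        ENNReal.ofReal (1 / (2 * b) * Real.exp (-|x| / b)) := by
        refine setLIntegral_congr_fun measurableSet_Iic fun x hx => ?_
        have hx' : x ≤ 0 := hx
        rw [← ENNReal.ofReal_mul (Real.exp_nonneg _), mul_left_comm, ← Real.exp_add,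
          abs_of_nonpos hx', abs_of_nonpos (by linarith : x - t ≤ 0)]
        congr 4
        ring
    _ = ENNReal.ofReal (Real.exp (-t / b)) * laplace b (Set.Iic 0) := by
        rw [lintegral_const_mul' _ _ ENNReal.ofReal_ne_top]
        unfold laplace
        rw [withDensity_apply _ measurableSet_Iic]
    _ ≤ _ := mul_le_of_le_one_right' prob_le_one

end Laplace

/-! ### The standard Gaussian -/

section Gaussian

theorem pi_withDensity {ι : Type*} [Fintype ι] {α : ι → Type*} [∀ i, MeasurableSpace (α i)]
    (μ : ∀ i, Measure (α i)) [∀ i, IsProbabilityMeasure (μ i)] {f : ∀ i, α i → ENNReal}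
    (hf : ∀ i, Measurable (f i)) [∀ i, SigmaFinite ((μ i).withDensity (f i))] :
    Measure.pi (fun i => (μ i).withDensity (f i)) =
      (Measure.pi μ).withDensity fun x => ∏ i, f i (x i) := by
  refine Measure.pi_eq fun s hs => ?_
  rw [withDensity_apply _ (.univ_pi hs), ← lintegral_indicator (.univ_pi hs)]
  have e : ∀ x : ∀ i, α i, (Set.univ.pi s).indicator (fun x => ∏ i, f i (x i)) x =
      ∏ i, (s i).indicator (f i) (x i) := by
    intro x
    by_cases hx : x ∈ Set.univ.pi s
    · rw [Set.indicator_of_mem hx]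
      exact Finset.prod_congr rfl fun i _ => (Set.indicator_of_mem (hx i trivial) _).symm
    · rw [Set.indicator_of_notMem hx]
      simp only [Set.mem_univ_pi, not_forall] at hx
      obtain ⟨i, hi⟩ := hx
      exact (Finset.prod_eq_zero (Finset.mem_univ i) (Set.indicator_of_notMem hi _)).symm
  simp_rw [e]
  rw [lintegral_pi_prod μ fun i => (hf i).indicator (hs i)]
  refine Finset.prod_congr rfl fun i _ => ?_
  rw [lintegral_indicator (hs i), withDensity_apply _ (hs i)]

theorem gaussianReal_eq_withDensity (a : ℝ) :
    gaussianReal a 1 = (gaussianReal 0 1).withDensity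
      fun x => ENNReal.ofReal (Real.exp (a * x - a ^ 2 / 2)) := by
  rw [gaussianReal_of_var_ne_zero _ one_ne_zero, gaussianReal_of_var_ne_zero _ one_ne_zero,
    ← withDensity_mul _ (measurable_gaussianPDF 0 1) (by fun_prop)]
  congr 1
  funext x
  simp only [Pi.mul_apply, gaussianPDF, gaussianPDFReal]
  rw [← ENNReal.ofReal_mul (by positivity), mul_assoc (_⁻¹), ← Real.exp_add]
  congr 3
  simp
  ring

variable {d : ℕ}

theorem measurable_gaussianShiftDensity (v : E d) :
    Measurable fun x : E d => ENNReal.ofReal (Real.exp (⟪v, x⟫ - ‖v‖ ^ 2 / 2)) := by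
  fun_prop

/-- Cameron–Martin in finite dimension. In coordinates the measure is a product of one-dimensional
Gaussians, and the product of the shift densities is the exponential of an inner product. -/
theorem stdGaussian_map_add (v : E d) :
    (stdGaussian (E d)).map (fun x => v + x) = (stdGaussian (E d)).withDensity
      fun x => ENNReal.ofReal (Real.exp (⟪v, x⟫ - ‖v‖ ^ 2 / 2)) := by
  set μ : Measure (Fin d → ℝ) := Measure.pi fun _ => gaussianReal 0 1 with hμ
  have hstd : stdGaussian (E d) = μ.map (WithLp.toLp 2) := (map_pi_eq_stdGaussian).symm
  have hm : Measurable (WithLp.toLp 2 : (Fin d → ℝ) → E d) := by fun_prop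
  have hshift : μ.map (fun x i => v i + x i) = μ.withDensity
      fun x => ∏ i, ENNReal.ofReal (Real.exp (v i * x i - v i ^ 2 / 2)) := by
    have h1 : μ.map (fun x i => v i + x i) = Measure.pi fun i => gaussianReal (v i) 1 := by
      rw [hμ, Measure.pi_map_pi (f := fun i x => v i + x) (fun i => by fun_prop)]
      congr 1
      funext i
      rw [gaussianReal_map_const_add, zero_add]
    rw [h1]
    have h2 : ∀ i, SigmaFinite ((gaussianReal 0 1).withDensity
        fun x => ENNReal.ofReal (Real.exp (v i * x - v i ^ 2 / 2))) := fun i => by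
      rw [← gaussianReal_eq_withDensity]; infer_instance
    rw [← pi_withDensity (fun _ => gaussianReal 0 1)
      (f := fun i x => ENNReal.ofReal (Real.exp (v i * x - v i ^ 2 / 2))) (fun i => by fun_prop)]
    congr 1
    funext i
    exact gaussianReal_eq_withDensity (v i)
  refine Measure.ext fun S hS => ?_
  rw [Measure.map_apply (by fun_prop) hS, withDensity_apply _ hS, hstd,
    Measure.map_apply hm (hS.preimage (by fun_prop)),
    setLIntegral_map hS (measurable_gaussianShiftDensity v) hm]
  have h3 := congrArg (fun ν => ν ((WithLp.toLp 2 : (Fin d → ℝ) → E d) ⁻¹' S)) hshift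
  simp only at h3
  rw [Measure.map_apply (by fun_prop) (hS.preimage hm), withDensity_apply _ (hS.preimage hm)] at h3
  refine h3.trans ?_
  refine lintegral_congr fun x => ?_
  rw [← ENNReal.ofReal_prod_of_nonneg fun i _ => (Real.exp_nonneg _), ← Real.exp_sum]
  congr 2
  rw [Finset.sum_sub_distrib, EuclideanSpace.real_norm_sq_eq, Finset.sum_div]
  congr 1
  simp [PiLp.inner_apply, mul_comm]

theorem lintegral_gaussianShiftDensity (v : E d) :
    ∫⁻ x, ENNReal.ofReal (Real.exp (⟪v, x⟫ - ‖v‖ ^ 2 / 2)) ∂(stdGaussian (E d)) = 1 := by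
  have h := congrArg (fun ν => ν Set.univ) (stdGaussian_map_add v)
  simp only at h
  rw [withDensity_apply _ .univ, Measure.restrict_univ, Measure.map_apply (by fun_prop) .univ,
    Set.preimage_univ, measure_univ] at h
  exact h.symm

/-- The density of the shift by `t • v` has integral one, so it serves as a normalized exponential
moment in Markov's inequality; `t = s / a²` optimizes the resulting bound. -/
theorem stdGaussian_inner_ge_le {v : E d} {a s : ℝ} (ha : 0 < a) (hv : ‖v‖ ≤ a) (hs : 0 ≤ s) :
    stdGaussian (E d) {x | s ≤ ⟪v, x⟫} ≤ ENNReal.ofReal (Real.exp (-(s ^ 2 / (2 * a ^ 2)))) := by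
  set t : ℝ := s / a ^ 2 with ht
  have ht0 : 0 ≤ t := by positivity
  set c : ℝ := t * s - t ^ 2 * ‖v‖ ^ 2 / 2 with hc
  have h1 := meas_ge_le_lintegral_div (μ := stdGaussian (E d))
    (measurable_gaussianShiftDensity (t • v)).aemeasurable
    (ε := ENNReal.ofReal (Real.exp c)) (ENNReal.ofReal_pos.2 (Real.exp_pos _)).ne'
    ENNReal.ofReal_ne_top
  rw [lintegral_gaussianShiftDensity, ← ENNReal.ofReal_one,
    ← ENNReal.ofReal_div_of_pos (Real.exp_pos _)] at h1
  refine (measure_mono fun x hx => ?_).trans (h1.trans (ENNReal.ofReal_le_ofReal ?_))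
  · refine ENNReal.ofReal_le_ofReal (Real.exp_le_exp.2 ?_)
    have hx' : s ≤ ⟪v, x⟫ := hx
    rw [inner_smul_left, norm_smul, Real.norm_of_nonneg ht0, hc]
    simp only [conj_trivial]
    nlinarith [mul_le_mul_of_nonneg_left hx' ht0]
  · rw [one_div, ← Real.exp_neg]
    refine Real.exp_le_exp.2 (neg_le_neg ?_)
    have h2 := pow_le_pow_left₀ (norm_nonneg _) hv 2
    have h3 : t ^ 2 * ‖v‖ ^ 2 ≤ t ^ 2 * a ^ 2 := by gcongr
    have h4 : t * s = s ^ 2 / a ^ 2 := by rw [ht]; ring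
    have h5 : t ^ 2 * a ^ 2 = s ^ 2 / a ^ 2 := by rw [ht]; field_simp
    have h6 : s ^ 2 / (2 * a ^ 2) = s ^ 2 / a ^ 2 / 2 := by field_simp
    rw [hc, h4, h6]
    linarith

/-- The Gaussian mechanism: a shift by a vector of norm at most `a` is `(ε, δ)`-indistinguishable
with `δ = exp (-(ε - a² / 2)² / (2 a²))`. -/
theorem stdGaussian_preimage_add_le {v : E d} {a ε : ℝ} (ha : 0 < a) (hv : ‖v‖ ≤ a)
    (hε : a ^ 2 / 2 ≤ ε) {S : Set (E d)} (hS : MeasurableSet S) :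
    stdGaussian (E d) {x | v + x ∈ S} ≤ ENNReal.ofReal (Real.exp ε) * stdGaussian (E d) S +
      ENNReal.ofReal (Real.exp (-((ε - a ^ 2 / 2) ^ 2 / (2 * a ^ 2)))) := by
  set γ := stdGaussian (E d) with hγ
  set ρ : E d → ENNReal := fun x => ENNReal.ofReal (Real.exp (⟪v, x⟫ - ‖v‖ ^ 2 / 2)) with hρ
  have hρm : Measurable ρ := measurable_gaussianShiftDensity v
  set B : Set (E d) := {x | ε ≤ ⟪v, x⟫ - ‖v‖ ^ 2 / 2} with hB
  have hBm : MeasurableSet B := measurableSet_le measurable_const (by fun_prop)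
  have hmap : ∀ S, MeasurableSet S → γ {x | v + x ∈ S} = ∫⁻ x in S, ρ x ∂γ := by
    intro S hS
    have h := congrArg (fun ν => ν S) (stdGaussian_map_add v)
    simp only at h
    rw [withDensity_apply _ hS, Measure.map_apply (by fun_prop) hS] at h
    exact h
  -- Outside `B` the density of the shifted law is at most `exp ε`. The set `B`, where the privacy
  -- loss is at least `ε`, has small probability under the shifted law and supplies the additive
  -- term.
  have hsplit : S ⊆ (S ∩ Bᶜ) ∪ B := fun x hx => by
    by_cases h : x ∈ B
    · exact Or.inr h
    · exact Or.inl ⟨hx, h⟩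
  rw [hmap S hS]
  refine (lintegral_mono_set hsplit).trans ((lintegral_union_le _ _ _).trans (add_le_add ?_ ?_))
  · calc ∫⁻ x in S ∩ Bᶜ, ρ x ∂γ ≤ ∫⁻ _ in S ∩ Bᶜ, ENNReal.ofReal (Real.exp ε) ∂γ := by
          refine setLIntegral_mono' (hS.inter hBm.compl) fun x hx => ?_
          have : ¬ ε ≤ ⟪v, x⟫ - ‖v‖ ^ 2 / 2 := hx.2
          exact ENNReal.ofReal_le_ofReal (Real.exp_le_exp.2 (by linarith))
      _ = ENNReal.ofReal (Real.exp ε) * γ (S ∩ Bᶜ) := by rw [setLIntegral_const]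
      _ ≤ _ := by gcongr; exact Set.inter_subset_left
  · rw [← hmap B hBm]
    refine le_trans (measure_mono fun x hx => ?_)
      (stdGaussian_inner_ge_le ha hv (sub_nonneg.2 hε))
    have hx' : ε ≤ ⟪v, v + x⟫ - ‖v‖ ^ 2 / 2 := hx
    rw [inner_add_right, real_inner_self_eq_norm_sq] at hx'
    have h2 := pow_le_pow_left₀ (norm_nonneg _) hv 2
    simp only [Set.mem_ofPred_eq]
    linarith

theorem integrable_norm_sq_stdGaussian :
    Integrable (fun x : E d => ‖x‖ ^ 2) (stdGaussian (E d)) := by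
  have h : MemLp id 2 (stdGaussian (E d)) := IsGaussian.memLp_two_id
  exact h.integrable_norm_pow two_ne_zero

theorem integral_norm_sq_stdGaussian :
    ∫ x : E d, ‖x‖ ^ 2 ∂(stdGaussian (E d)) = d := by
  have h1 : ∀ i : Fin d, ∫ x : E d, (x i) ^ 2 ∂(stdGaussian (E d)) = 1 := by
    intro i
    have h2 := variance_dual_stdGaussian (E := E d) (innerSL ℝ (EuclideanSpace.single i (1 : ℝ)))
    rw [variance_eq_sub] at h2
    · rw [integral_strongDual_stdGaussian, innerSL_apply_norm] at h2
      have h3 : ∀ x : E d, ⟪EuclideanSpace.single i (1 : ℝ), x⟫ = x i := fun x => by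
        rw [EuclideanSpace.inner_single_left]; simp
      simpa [h3] using h2
    · exact (IsGaussian.memLp_two_id (μ := stdGaussian (E d))).continuousLinearMap_comp _
  simp_rw [EuclideanSpace.real_norm_sq_eq]
  rw [integral_finsetSum]
  · simp [h1]
  · intro i _
    refine integrable_norm_sq_stdGaussian.mono' (by fun_prop)
      (Filter.Eventually.of_forall fun x => ?_)
    rw [Real.norm_of_nonneg (sq_nonneg _), EuclideanSpace.real_norm_sq_eq]
    exact Finset.single_le_sum (f := fun i => x i ^ 2) (fun _ _ => sq_nonneg _) (Finset.mem_univ i)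

end Gaussian

end PhasedSGD

end

noncomputable section

namespace PhasedSGD

open scoped RealInnerProductSpace

/-! ### Scores and selection -/

section Scores

variable {d C : ℕ}

theorem abs_ite_sub_ite_le (p q : Prop) [Decidable p] [Decidable q] :
    |(if p then (1 : ℝ) else 0) - if q then 1 else 0| ≤ 1 := by
  split_ifs <;> norm_num

/-- An unchanged point is compared with the changed one exactly once. -/
theorem abs_score_sub_le {τ : ℝ} {y y' : Fin C → E d} {j₀ : Fin C} (h : ∀ j, j ≠ j₀ → y j = y' j)
    {j : Fin C} (hj : j ≠ j₀) : |score τ y j - score τ y' j| ≤ 1 := by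
  classical
  unfold score
  rw [← Finset.sum_sub_distrib, Finset.sum_eq_single j₀]
  · exact abs_ite_sub_ite_le _ _
  · intro j' _ hj'
    rw [h j hj, h j' hj', sub_self]
  · simp

/-- The row of `j₀` can change by `C` and every other row by 1, in total by at most `2C`; the
normalization `1 / C` leaves 2. -/
theorem abs_concentrationScore_sub_le {τ : ℝ} {y y' : Fin C → E d} {j₀ : Fin C}
    (h : ∀ j, j ≠ j₀ → y j = y' j) :
    |concentrationScore τ y - concentrationScore τ y'| ≤ 2 := by
  classical
  have hC : 0 < C := j₀.pos
  have hC' : (0 : ℝ) < C := by exact_mod_cast hC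
  unfold concentrationScore
  rw [← mul_sub, abs_mul, abs_of_pos (by positivity), ← Finset.sum_sub_distrib]
  have hrow : ∀ j, |∑ j', (if ‖y j - y j'‖ ≤ τ then (1 : ℝ) else 0) -
      ∑ j', (if ‖y' j - y' j'‖ ≤ τ then (1 : ℝ) else 0)| ≤ if j = j₀ then (C : ℝ) else 1 := by
    intro j
    rw [← Finset.sum_sub_distrib]
    split_ifs with hj
    · refine (Finset.abs_sum_le_sum_abs _ _).trans ?_
      refine (Finset.sum_le_sum fun _ _ => abs_ite_sub_ite_le _ _).trans ?_
      simp
    · rw [Finset.sum_eq_single j₀]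
      · exact abs_ite_sub_ite_le _ _
      · intro j' _ hj'
        rw [h j hj, h j' hj', sub_self]
      · simp
  have hsum := (Finset.abs_sum_le_sum_abs _ Finset.univ).trans (Finset.sum_le_sum fun j _ => hrow j)
  have h2 : ∑ j : Fin C, (if j = j₀ then (C : ℝ) else 1) ≤ 2 * C := by
    have : ∀ j : Fin C, (if j = j₀ then (C : ℝ) else 1) ≤ (if j = j₀ then (C : ℝ) else 0) + 1 := by
      intro j; split_ifs <;> simp
    refine (Finset.sum_le_sum fun j _ => this j).trans ?_
    rw [Finset.sum_add_distrib]
    simp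
    linarith
  calc 1 / (C : ℝ) * _ ≤ 1 / (C : ℝ) * (2 * C) := by gcongr; exact hsum.trans h2
    _ = 2 := by field_simp

/-- As a clamped affine function the keeping probability is visibly `6 / C`-Lipschitz and lies in
the unit interval. -/
theorem keepProb_eq (hC : 0 < C) (h : ℝ) :
    keepProb C h = max 0 (min 1 (6 / C * h - 3)) := by
  have hC' : (0 : ℝ) < C := by exact_mod_cast hC
  have e : (h - (C : ℝ) / 2) / ((C : ℝ) / 6) = 6 / C * h - 3 := by field_simp; ring
  have e1 : h < (C : ℝ) / 2 ↔ 6 / C * h - 3 < 0 := by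
    rw [← e, div_lt_iff₀ (by positivity)]; constructor <;> intro _ <;> linarith
  have e2 : 2 * (C : ℝ) / 3 ≤ h ↔ 1 ≤ 6 / C * h - 3 := by
    rw [← e, le_div_iff₀ (by positivity)]; constructor <;> intro _ <;> linarith
  unfold keepProb
  split_ifs with h1 h2
  · rw [e1] at h1; rw [max_eq_left]; exact (min_le_right _ _).trans h1.le
  · rw [e2] at h2; rw [min_eq_left h2]; simp
  · rw [e1] at h1; rw [e2] at h2
    rw [e, min_eq_right (by linarith), max_eq_right (by linarith)]

theorem keepProb_nonneg (hC : 0 < C) (h : ℝ) : 0 ≤ keepProb C h := by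
  rw [keepProb_eq hC]; exact le_max_left _ _

theorem keepProb_le_one (hC : 0 < C) (h : ℝ) : keepProb C h ≤ 1 := by
  rw [keepProb_eq hC]; exact max_le zero_le_one (min_le_left _ _)

theorem abs_keepProb_sub_le (hC : 0 < C) (h h' : ℝ) :
    |keepProb C h - keepProb C h'| ≤ 6 / C * |h - h'| := by
  rw [keepProb_eq hC, keepProb_eq hC]
  refine (abs_max_sub_max_le_max _ _ _ _).trans (max_le (by simp; positivity) ?_)
  refine (abs_min_sub_min_le_max _ _ _ _).trans (max_le (by simp; positivity) ?_)
  rw [show 6 / (C : ℝ) * h - 3 - (6 / C * h' - 3) = 6 / C * (h - h') by ring, abs_mul,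
    abs_of_nonneg (by positivity : (0 : ℝ) ≤ 6 / C)]

theorem half_le_of_keepProb_pos {h : ℝ} (hk : 0 < keepProb C h) : (C : ℝ) / 2 ≤ h := by
  by_contra hlt
  push Not at hlt
  unfold keepProb at hk
  rw [if_pos hlt] at hk
  exact lt_irrefl _ hk

theorem le_keepProb (hC : 0 < C) {h : ℝ} (hh : 3 / 5 * (C : ℝ) ≤ h) : 3 / 5 ≤ keepProb C h := by
  have hC' : (0 : ℝ) < C := by exact_mod_cast hC
  rw [keepProb_eq hC]
  refine le_max_of_le_right (le_min (by norm_num) ?_)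
  have : 6 / (C : ℝ) * (3 / 5 * C) ≤ 6 / C * h := by gcongr
  have e : 6 / (C : ℝ) * (3 / 5 * C) = 18 / 5 := by field_simp; norm_num
  linarith

/-- The mean of the kept points. -/
def keptMean (τ : ℝ) (y : Fin C → E d) (u : Fin C → ℝ) : E d :=
  ((kept τ y u).card : ℝ)⁻¹ • ∑ j ∈ kept τ y u, y j

theorem measurable_score (τ : ℝ) (j : Fin C) : Measurable fun y : Fin C → E d => score τ y j := by
  classical
  unfold score
  refine Finset.measurable_sum _ fun j' _ => Measurable.ite ?_ measurable_const measurable_const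
  exact measurableSet_le (by fun_prop) measurable_const

theorem measurable_concentrationScore (τ : ℝ) :
    Measurable fun y : Fin C → E d => concentrationScore τ y := by
  classical
  unfold concentrationScore
  refine Measurable.const_mul (Finset.measurable_sum _ fun j _ =>
    Finset.measurable_sum _ fun j' _ => Measurable.ite ?_ measurable_const measurable_const) _
  exact measurableSet_le (by fun_prop) measurable_const

theorem measurable_keepProb (C : ℕ) : Measurable (keepProb C) := by
  rcases Nat.eq_zero_or_pos C with rfl | hC
  · unfold keepProb
    refine Measurable.ite measurableSet_Iio measurable_const
      (Measurable.ite measurableSet_Ici measurable_const (by fun_prop))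
  · rw [funext (keepProb_eq hC)]
    fun_prop

theorem measurable_keptMean (τ : ℝ) :
    Measurable fun q : (Fin C → E d) × (Fin C → ℝ) => keptMean τ q.1 q.2 := by
  classical
  have hset : ∀ j : Fin C, MeasurableSet
      {q : (Fin C → E d) × (Fin C → ℝ) | q.2 j < keepProb C (score τ q.1 j)} := fun j =>
    measurableSet_lt (by fun_prop)
      ((measurable_keepProb C).comp ((measurable_score τ j).comp measurable_fst))
  have h1 : (fun q : (Fin C → E d) × (Fin C → ℝ) => keptMean τ q.1 q.2) = fun q =>
      (∑ j, if q.2 j < keepProb C (score τ q.1 j) then (1 : ℝ) else 0)⁻¹ •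
        ∑ j, if q.2 j < keepProb C (score τ q.1 j) then q.1 j else 0 := by
    funext q
    unfold keptMean kept
    rw [Finset.sum_filter, Finset.card_filter]
    push_cast
    congr!
  rw [h1]
  have hc : Measurable fun q : (Fin C → E d) × (Fin C → ℝ) =>
      ∑ j, if q.2 j < keepProb C (score τ q.1 j) then (1 : ℝ) else 0 :=
    Finset.measurable_sum _ fun j _ => Measurable.ite (hset j) measurable_const measurable_const
  have hv : Measurable fun q : (Fin C → E d) × (Fin C → ℝ) =>
      ∑ j, if q.2 j < keepProb C (score τ q.1 j) then q.1 j else 0 :=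
    Finset.measurable_sum _ fun j _ => Measurable.ite (hset j) (by fun_prop) measurable_const
  exact hc.inv.smul hv

open Classical in
-- The concentration score is the average size of the `τ`-neighbourhoods of the points, and some
-- neighbourhood is at least as large as the average.
theorem exists_majority {τ : ℝ} {y : Fin C → E d} (hC : 0 < C)
    (hs : 3 / 5 * (C : ℝ) ≤ concentrationScore τ y) :
    ∃ j, 3 / 5 * (C : ℝ) ≤ (Finset.univ.filter fun j' => ‖y j - y j'‖ ≤ τ).card := by
  by_contra hcon
  push Not at hcon
  have hC' : (0 : ℝ) < C := by exact_mod_cast hC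
  have hne : (Finset.univ : Finset (Fin C)).Nonempty := ⟨⟨0, hC⟩, Finset.mem_univ _⟩
  have h1 : ∑ j, ∑ j', (if ‖y j - y j'‖ ≤ τ then (1 : ℝ) else 0) <
      ∑ _j : Fin C, 3 / 5 * (C : ℝ) := by
    refine Finset.sum_lt_sum_of_nonempty hne fun j _ => ?_
    have := hcon j
    rw [Finset.card_filter, Nat.cast_sum] at this
    simpa using this
  unfold concentrationScore at hs
  rw [one_div, inv_mul_eq_div, le_div_iff₀ hC'] at hs
  simp only [Finset.sum_const, Finset.card_univ, Fintype.card_fin, nsmul_eq_mul] at h1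
  linarith

open Classical in
/-- A point with a large score is close to the centre of any majority cluster. -/
theorem norm_sub_le_of_majority {τ : ℝ} {y : Fin C → E d} {c : E d} {M : Finset (Fin C)}
    (hM : ∀ j ∈ M, ‖c - y j‖ ≤ τ) (hcard : (C : ℝ) / 2 < M.card) {j : Fin C}
    (hj : (C : ℝ) / 2 ≤ score τ y j) : ‖y j - c‖ ≤ 3 * τ := by
  have h1 : score τ y j = ((Finset.univ.filter fun j' => ‖y j - y j'‖ ≤ 2 * τ).card : ℝ) := by
    unfold score
    rw [Finset.card_filter]
    push_cast
    rfl
  rw [h1] at hj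
  have hlt : (Finset.univ : Finset (Fin C)).card <
      (Finset.univ.filter fun j' => ‖y j - y j'‖ ≤ 2 * τ).card + M.card := by
    rw [Finset.card_univ, Fintype.card_fin]
    have : (C : ℝ) < ((Finset.univ.filter fun j' => ‖y j - y j'‖ ≤ 2 * τ).card : ℝ) + M.card := by
      linarith
    exact_mod_cast this
  obtain ⟨j', hj'⟩ := Finset.inter_nonempty_of_card_lt_card_add_card
    (Finset.filter_subset _ _) (Finset.subset_univ M) hlt
  rw [Finset.mem_inter, Finset.mem_filter] at hj'
  have h2 := hM j' hj'.2
  calc ‖y j - c‖ = ‖(y j - y j') - (c - y j')‖ := by congr 1; abel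
    _ ≤ ‖y j - y j'‖ + ‖c - y j'‖ := norm_sub_le _ _
    _ ≤ 3 * τ := by linarith [hj'.1.2]

/-- After recentring at `c` every summand has norm at most `ρ`. The two sums differ only on `B`,
which costs `2 ρ |B|`; the two cardinalities differ by at most `|B|`, which costs another `ρ |B|`.
-/
theorem norm_average_sub_average_le {ι : Type*} [DecidableEq ι] {S S' B : Finset ι}
    {y y' : ι → E d} {c : E d} {ρ : ℝ} (hS : ∀ j ∈ S, ‖y j - c‖ ≤ ρ)
    (hS' : ∀ j ∈ S', ‖y' j - c‖ ≤ ρ) (hne : S.Nonempty) (hne' : S'.Nonempty)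
    (hB : ∀ j, j ∉ B → ((j ∈ S ↔ j ∈ S') ∧ y j = y' j)) (hρ : 0 ≤ ρ) :
    ‖(S.card : ℝ)⁻¹ • ∑ j ∈ S, y j - (S'.card : ℝ)⁻¹ • ∑ j ∈ S', y' j‖ ≤
      3 * ρ * B.card / S.card := by
  have hp : (0 : ℝ) < S.card := by exact_mod_cast hne.card_pos
  have hp' : (0 : ℝ) < S'.card := by exact_mod_cast hne'.card_pos
  have hfil : S.filter (· ∉ B) = S'.filter (· ∉ B) := by
    ext j
    simp only [Finset.mem_filter]
    constructor
    · rintro ⟨h1, h2⟩; exact ⟨(hB j h2).1.1 h1, h2⟩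
    · rintro ⟨h1, h2⟩; exact ⟨(hB j h2).1.2 h1, h2⟩
  have hbound : ∀ (s : Finset ι) (v : ι → E d), (∀ j ∈ s, ‖v j - c‖ ≤ ρ) →
      ‖∑ j ∈ s, (v j - c)‖ ≤ s.card * ρ := fun s v hv => by
    simpa using norm_sum_le_of_le s hv
  have hcardB : ∀ s : Finset ι, ((s.filter (· ∈ B)).card : ℝ) ≤ B.card := fun s => by
    have : (s.filter (· ∈ B)).card ≤ B.card :=
      Finset.card_le_card fun j hj => (Finset.mem_filter.1 hj).2
    exact_mod_cast this
  have hsumdiff : ‖∑ j ∈ S, (y j - c) - ∑ j ∈ S', (y' j - c)‖ ≤ 2 * ρ * B.card := by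
    rw [← Finset.sum_filter_add_sum_filter_not S (· ∈ B),
      ← Finset.sum_filter_add_sum_filter_not S' (· ∈ B), hfil,
      Finset.sum_congr rfl (g := fun j => y' j - c)
        (fun j hj => by rw [(hB j (Finset.mem_filter.1 hj).2).2] :
          ∀ j ∈ S'.filter (· ∉ B), y j - c = y' j - c), add_sub_add_right_eq_sub]
    refine (norm_sub_le _ _).trans ?_
    have h1 := hbound (S.filter (· ∈ B)) y fun j hj => hS j (Finset.mem_filter.1 hj).1
    have h2 := hbound (S'.filter (· ∈ B)) y' fun j hj => hS' j (Finset.mem_filter.1 hj).1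
    nlinarith [hcardB S, hcardB S']
  have hcarddiff : |(S'.card : ℝ) - S.card| ≤ B.card := by
    have e1 := Finset.card_filter_add_card_filter_not (s := S) (· ∈ B)
    have e2 := Finset.card_filter_add_card_filter_not (s := S') (· ∈ B)
    rw [hfil] at e1
    have e1' : (S.card : ℝ) = (S.filter (· ∈ B)).card + (S'.filter (· ∉ B)).card := by
      exact_mod_cast e1.symm
    have e2' : (S'.card : ℝ) = (S'.filter (· ∈ B)).card + (S'.filter (· ∉ B)).card := by
      exact_mod_cast e2.symm
    rw [e1', e2', abs_le]
    have h1 := hcardB S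
    have h2 := hcardB S'
    have h3 : (0 : ℝ) ≤ (S.filter (· ∈ B)).card := by positivity
    have h4 : (0 : ℝ) ≤ (S'.filter (· ∈ B)).card := by positivity
    constructor <;> linarith
  have hmean : ∀ (s : Finset ι) (v : ι → E d), (0 : ℝ) < s.card →
      (s.card : ℝ)⁻¹ • ∑ j ∈ s, v j = c + (s.card : ℝ)⁻¹ • ∑ j ∈ s, (v j - c) := by
    intro s v hs
    rw [Finset.sum_sub_distrib, Finset.sum_const, smul_sub, ← Nat.cast_smul_eq_nsmul ℝ,
      smul_smul, inv_mul_cancel₀ hs.ne', one_smul]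
    abel
  rw [hmean S y hp, hmean S' y' hp', add_sub_add_left_eq_sub]
  have hdecomp : (S.card : ℝ)⁻¹ • ∑ j ∈ S, (y j - c) - (S'.card : ℝ)⁻¹ • ∑ j ∈ S', (y' j - c) =
      (S.card : ℝ)⁻¹ • ((∑ j ∈ S, (y j - c) - ∑ j ∈ S', (y' j - c)) +
        (((S'.card : ℝ) - S.card) * (S'.card : ℝ)⁻¹) • ∑ j ∈ S', (y' j - c)) := by
    rw [smul_add, smul_sub, smul_smul, sub_add, ← sub_smul]
    congr 2
    have e : ∀ a b : ℝ, 0 < a → 0 < b → b⁻¹ = a⁻¹ - a⁻¹ * ((b - a) * b⁻¹) := by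
      intro a b ha hb
      field_simp
      ring
    exact e _ _ hp hp'
  rw [hdecomp, norm_smul, Real.norm_of_nonneg (inv_nonneg.2 hp.le), inv_mul_eq_div]
  refine div_le_div_of_nonneg_right ?_ hp.le
  refine (norm_add_le _ _).trans ?_
  rw [norm_smul, norm_mul, Real.norm_eq_abs, Real.norm_of_nonneg (inv_nonneg.2 hp'.le)]
  have h1 := hbound S' y' hS'
  have h2 : |(S'.card : ℝ) - S.card| * (S'.card : ℝ)⁻¹ * ‖∑ j ∈ S', (y' j - c)‖ ≤ B.card * ρ := by
    refine (mul_le_mul (mul_le_mul_of_nonneg_right hcarddiff (inv_nonneg.2 hp'.le)) h1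
      (norm_nonneg _) (mul_nonneg (Nat.cast_nonneg _) (inv_nonneg.2 hp'.le))).trans_eq ?_
    rw [mul_assoc, inv_mul_cancel_left₀ hp'.ne']
  linarith

end Scores

end PhasedSGD

end

noncomputable section

namespace PhasedSGD

/-! ### Privacy of a single phase -/

section PhasePrivacy

variable {d C : ℕ}

/-- Law of the uniform variables that decide which points are kept. -/
def selectLaw (C : ℕ) : Measure (Fin C → ℝ) :=
  Measure.pi fun _ => volume.restrict (Set.Icc (0 : ℝ) 1)

instance : IsProbabilityMeasure (selectLaw C) := by
  unfold selectLaw; infer_instance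

theorem ae_selectLaw_mem (C : ℕ) : ∀ᵐ u ∂selectLaw C, ∀ j, u j ∈ Set.Icc (0 : ℝ) 1 := by
  rw [ae_all_iff]
  intro j
  have h := (measurePreserving_eval (fun _ : Fin C => volume.restrict (Set.Icc (0 : ℝ) 1)) j)
  exact h.quasiMeasurePreserving.ae (ae_restrict_mem measurableSet_Icc)

open Classical in
/-- The indices, other than `j₀`, whose selection differs between the two families. -/
def flipped (τ : ℝ) (y y' : Fin C → E d) (j₀ : Fin C) (u : Fin C → ℝ) : Finset (Fin C) :=
  Finset.univ.filter fun j => u j ∈ if j = j₀ then ∅ else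
    Set.Ico (min (keepProb C (score τ y j)) (keepProb C (score τ y' j)))
      (max (keepProb C (score τ y j)) (keepProb C (score τ y' j)))

theorem mem_kept_iff {τ : ℝ} {y : Fin C → E d} {u : Fin C → ℝ} {j : Fin C} :
    j ∈ kept τ y u ↔ u j < keepProb C (score τ y j) := by
  simp [kept]

theorem mem_kept_congr {τ : ℝ} {y y' : Fin C → E d} {j₀ : Fin C} {u : Fin C → ℝ} {j : Fin C}
    (hj : j ≠ j₀) (hf : j ∉ flipped τ y y' j₀ u) : j ∈ kept τ y u ↔ j ∈ kept τ y' u := by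
  simp only [flipped, Finset.mem_filter, Finset.mem_univ, true_and, if_neg hj, Set.mem_Ico,
    not_and, not_lt, min_le_iff, max_le_iff] at hf
  rw [mem_kept_iff, mem_kept_iff]
  constructor
  · intro h
    by_contra h'
    exact absurd (hf (Or.inr (not_lt.1 h'))).1 (not_le.2 h)
  · intro h
    by_contra h'
    exact absurd (hf (Or.inl (not_lt.1 h'))).2 (not_le.2 h)

/-- The scores of unchanged points move by at most 1, so each decision flips with probability at
most `6 / C`. Since `e - 1 < 11 / 6`, the exponential moment of the number of flips is at most `(1 +
11 / C) ^ C ≤ e ^ 11`. -/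
theorem selectLaw_flipped_le {τ : ℝ} {y y' : Fin C → E d} {j₀ : Fin C}
    (h : ∀ j, j ≠ j₀ → y j = y' j) (k : ℝ) :
    selectLaw C {u | k ≤ ((flipped τ y y' j₀ u).card : ℝ)} ≤
      ENNReal.ofReal (Real.exp (11 - k)) := by
  classical
  have hC : 0 < C := j₀.pos
  have hC' : (0 : ℝ) < C := by exact_mod_cast hC
  set A : Fin C → Set ℝ := fun j => if j = j₀ then ∅ else
    Set.Ico (min (keepProb C (score τ y j)) (keepProb C (score τ y' j)))
      (max (keepProb C (score τ y j)) (keepProb C (score τ y' j))) with hA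
  have hAm : ∀ j, MeasurableSet (A j) := by
    intro j
    simp only [hA]
    split_ifs
    · exact MeasurableSet.empty
    · exact measurableSet_Ico
  have hbound : ∀ j, (volume.restrict (Set.Icc (0 : ℝ) 1)).real (A j) ≤ 6 / C := by
    intro j
    simp only [hA]
    split_ifs with hj
    · simp; positivity
    · refine (uniform_Ico_le _ _).trans ?_
      rw [max_sub_min_eq_abs, abs_abs, abs_sub_comm]
      refine (abs_keepProb_sub_le hC _ _).trans ?_
      have := abs_score_sub_le (τ := τ) h hj
      calc 6 / (C : ℝ) * _ ≤ 6 / C * 1 := by gcongr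
        _ = _ := by ring
  have hm := measure_pi_card_ge_le (fun _ : Fin C => volume.restrict (Set.Icc (0 : ℝ) 1)) hAm 1 k
  have hset : {u : Fin C → ℝ | k ≤ ((flipped τ y y' j₀ u).card : ℝ)} =
      {u | k ≤ 1 * ((Finset.univ.filter fun i => u i ∈ A i).card : ℝ)} := by
    ext u
    simp only [Set.mem_ofPred_eq, one_mul, flipped, hA]
  rw [hset]
  refine hm.trans (ENNReal.ofReal_le_ofReal ?_)
  have he := Real.exp_one_lt_d9
  have he1 : 1 ≤ Real.exp 1 := Real.one_le_exp zero_le_one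
  have hprod : ∏ i : Fin C, (1 + (Real.exp 1 - 1) *
      (volume.restrict (Set.Icc (0 : ℝ) 1)).real (A i)) ≤ ∏ _i : Fin C, Real.exp (11 / C) := by
    refine Finset.prod_le_prod (fun i _ => by positivity) fun i _ => ?_
    have h2 : (Real.exp 1 - 1) * (volume.restrict (Set.Icc (0 : ℝ) 1)).real (A i) ≤ 11 / C := by
      calc _ ≤ (11 / 6) * (6 / (C : ℝ)) := by
            refine mul_le_mul (by linarith) (hbound i) measureReal_nonneg (by norm_num)
        _ = _ := by ring
    linarith [Real.add_one_le_exp (11 / (C : ℝ))]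
  rw [Finset.prod_const, Finset.card_univ, Fintype.card_fin, ← Real.exp_nat_mul,
    mul_div_cancel₀ _ hC'.ne'] at hprod
  calc _ ≤ Real.exp (-k) * Real.exp 11 := by gcongr
    _ = _ := by rw [← Real.exp_add, neg_add_eq_sub]

/-- The Chernoff factor of a point kept with probability at least `3 / 5`. Any exponent larger than
`5 / 18` in place of `4 / 9` would give exponential decay when a fraction `3 / 5` of the points must
fall below `C / 6`. -/
theorem exp_neg_four_ninths : 1 - (1 - Real.exp (-1)) * (3 / 5) ≤ Real.exp (-(4 / 9)) := by
  have h1 : Real.exp (-1) < 0.3678794412 := by exact_mod_cast Real.exp_neg_one_lt_d9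
  have h2 : (1 - 4 / 90 : ℝ) ≤ Real.exp (-(4 / 90)) := by
    linarith [Real.add_one_le_exp (-(4 / 90) : ℝ)]
  have h3 : (1 - 4 / 90 : ℝ) ^ 10 ≤ Real.exp (-(4 / 90)) ^ 10 := by gcongr
  rw [← Real.exp_nat_mul] at h3
  norm_num at h3 ⊢
  norm_num at h1
  linarith

/-- At least `3C/5` points are each kept with probability at least `3 / 5`. The lower-tail Chernoff
exponent is `C/6 - (4/9)(3C/5) = -C/10`. -/
theorem selectLaw_card_kept_le {τ : ℝ} {y : Fin C → E d} {M : Finset (Fin C)}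
    (hC : 0 < C) (hcard : 3 / 5 * (C : ℝ) ≤ M.card)
    (hM : ∀ j ∈ M, 3 / 5 * (C : ℝ) ≤ score τ y j) :
    selectLaw C {u | ((kept τ y u).card : ℝ) ≤ C / 6} ≤ ENNReal.ofReal (Real.exp (-(C / 10))) := by
  classical
  have hm := measure_pi_card_ge_le (fun _ : Fin C => volume.restrict (Set.Icc (0 : ℝ) 1))
    (A := fun j => Set.Iio (keepProb C (score τ y j))) (fun j => measurableSet_Iio) (-1)
    (-(C / 6 : ℝ))
  have hset : {u : Fin C → ℝ | ((kept τ y u).card : ℝ) ≤ C / 6} =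
      {u | -(C / 6 : ℝ) ≤ -1 * ((Finset.univ.filter fun i =>
        u i ∈ Set.Iio (keepProb C (score τ y i))).card : ℝ)} := by
    ext u
    simp only [Set.mem_ofPred_eq, kept, Set.mem_Iio]
    rw [neg_one_mul, neg_le_neg_iff]
  rw [hset]
  refine hm.trans (ENNReal.ofReal_le_ofReal ?_)
  have he : Real.exp (-1) ≤ 1 := Real.exp_le_one_iff.2 (by norm_num)
  have he0 := Real.exp_pos (-1)
  have hfac : ∀ i : Fin C, 1 + (Real.exp (-1) - 1) *
      (volume.restrict (Set.Icc (0 : ℝ) 1)).real (Set.Iio (keepProb C (score τ y i))) ≤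
      if i ∈ M then Real.exp (-(4 / 9)) else 1 := by
    intro i
    rw [uniform_Iio (keepProb_nonneg hC _) (keepProb_le_one hC _)]
    split_ifs with hi
    · have := le_keepProb hC (hM i hi)
      have h4 := exp_neg_four_ninths
      nlinarith
    · have := keepProb_nonneg hC (score τ y i)
      nlinarith
  have hprod : ∏ i : Fin C, (1 + (Real.exp (-1) - 1) *
      (volume.restrict (Set.Icc (0 : ℝ) 1)).real (Set.Iio (keepProb C (score τ y i)))) ≤
      ∏ i : Fin C, if i ∈ M then Real.exp (-(4 / 9)) else 1 := by
    refine Finset.prod_le_prod (fun i _ => ?_) fun i _ => hfac i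
    rw [uniform_Iio (keepProb_nonneg hC _) (keepProb_le_one hC _)]
    have h1 := keepProb_nonneg hC (score τ y i)
    have h2 := keepProb_le_one hC (score τ y i)
    nlinarith
  rw [Finset.prod_ite_mem, Finset.univ_inter, Finset.prod_const, ← Real.exp_nat_mul] at hprod
  rw [neg_neg]
  calc _ ≤ Real.exp (C / 6) * Real.exp (M.card * -(4 / 9)) := by gcongr
    _ ≤ _ := by
      rw [← Real.exp_add]
      exact Real.exp_le_exp.2 (by linarith)

/-- The bound for averages is applied with radius `3τ`, an exceptional set of the changed index and
the flipped ones, hence fewer than `k + 1` indices, and more than `C / 6` kept points: `3 · 3τ · (k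
+ 1) · 6 / C`. -/
theorem norm_keptMean_sub_keptMean_le {τ : ℝ} {y y' : Fin C → E d} {j₀ : Fin C}
    (h : ∀ j, j ≠ j₀ → y j = y' j) (hτ : 0 ≤ τ) {c : E d} {M : Finset (Fin C)}
    (hC10 : 10 < C) (hcard : 3 / 5 * (C : ℝ) ≤ M.card) (hM : ∀ j ∈ M, ‖c - y j‖ ≤ τ)
    {u : Fin C → ℝ} (hu : ∀ j, 0 ≤ u j) {k : ℝ} (hk : k + 1 < C / 6)
    (hflip : ((flipped τ y y' j₀ u).card : ℝ) < k) (hkept : (C : ℝ) / 6 < (kept τ y u).card) :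
    ‖keptMean τ y u - keptMean τ y' u‖ ≤ 54 * τ * (k + 1) / C := by
  classical
  have hC10' : (10 : ℝ) < C := by exact_mod_cast hC10
  set B := insert j₀ (flipped τ y y' j₀ u) with hBdef
  have hBcard : (B.card : ℝ) < k + 1 := by
    have : B.card ≤ (flipped τ y y' j₀ u).card + 1 := Finset.card_insert_le _ _
    have : (B.card : ℝ) ≤ (flipped τ y y' j₀ u).card + 1 := by exact_mod_cast this
    linarith
  have hB : ∀ j, j ∉ B → ((j ∈ kept τ y u ↔ j ∈ kept τ y' u) ∧ y j = y' j) := by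
    intro j hj
    simp only [hBdef, Finset.mem_insert, not_or] at hj
    exact ⟨mem_kept_congr hj.1 hj.2, h j hj.1⟩
  have hS : ∀ j ∈ kept τ y u, ‖y j - c‖ ≤ 3 * τ := fun j hj =>
    norm_sub_le_of_majority hM (by linarith)
      (half_le_of_keepProb_pos ((hu j).trans_lt (mem_kept_iff.1 hj)))
  have hM' : ∀ j ∈ M.erase j₀, ‖c - y' j‖ ≤ τ := fun j hj => by
    rw [← h j (Finset.ne_of_mem_erase hj)]
    exact hM j (Finset.mem_of_mem_erase hj)
  -- Without the changed index the cluster is still a strict majority because `C > 10`, so the same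
  -- centre serves for both families.
  have hcard' : (C : ℝ) / 2 < (M.erase j₀).card := by
    have : M.card ≤ (M.erase j₀).card + 1 := by
      have := Finset.pred_card_le_card_erase (s := M) (a := j₀)
      omega
    have : (M.card : ℝ) ≤ (M.erase j₀).card + 1 := by exact_mod_cast this
    linarith
  have hS' : ∀ j ∈ kept τ y' u, ‖y' j - c‖ ≤ 3 * τ := fun j hj =>
    norm_sub_le_of_majority hM' hcard'
      (half_le_of_keepProb_pos ((hu j).trans_lt (mem_kept_iff.1 hj)))
  have hne : (kept τ y u).Nonempty := by
    rw [← Finset.card_pos]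
    have : (0 : ℝ) < (kept τ y u).card := by linarith
    exact_mod_cast this
  -- If nothing were kept in the second family, all kept points of the first would be exceptional,
  -- and there are too many of them.
  have hne' : (kept τ y' u).Nonempty := by
    by_contra hemp
    rw [Finset.not_nonempty_iff_eq_empty] at hemp
    have hsub : kept τ y u ⊆ B := by
      intro j hj
      by_contra hjB
      have := (hB j hjB).1.1 hj
      rw [hemp] at this
      simp at this
    have : ((kept τ y u).card : ℝ) ≤ B.card := by exact_mod_cast Finset.card_le_card hsub
    linarith
  have hmain := norm_average_sub_average_le hS hS' hne hne' hB (by positivity)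
  unfold keptMean
  refine hmain.trans ?_
  have hCpos : (0 : ℝ) < C := by linarith
  rw [div_le_div_iff₀ (by linarith) hCpos]
  have hB0 : (0 : ℝ) ≤ B.card := Nat.cast_nonneg _
  calc 3 * (3 * τ) * (B.card : ℝ) * C = 9 * τ * (B.card * C) := by ring
    _ ≤ 9 * τ * ((k + 1) * (6 * (kept τ y u).card)) := by
      refine mul_le_mul_of_nonneg_left ?_ (by positivity)
      exact mul_le_mul hBcard.le (by linarith) hCpos.le (by linarith)
    _ = _ := by ring

/-- Quantitative requirements under which a phase is private. -/
structure PhaseBudget (C : ℕ) (ε δ lam : ℝ) : Prop where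
  eps_pos : 0 < ε
  eps_le : ε ≤ 10
  delta_pos : 0 < δ
  delta_lt_one : δ < 1
  le_lam : Real.log (1 / δ) + 6 ≤ lam
  le_groups : 10 * lam + 100 ≤ C
  le_groups_mul : 100 * (lam + 2) ≤ C * ε

theorem PhaseBudget.log_nonneg {ε δ lam : ℝ} (hb : PhaseBudget C ε δ lam) :
    0 ≤ Real.log (1 / δ) :=
  Real.log_nonneg (by rw [le_div_iff₀ hb.delta_pos]; linarith [hb.delta_lt_one])

/-- Each of the three failure events of a phase that passes the test is charged a quarter of `δ`;
the summand 2 is there because `e⁻² ≤ 1 / 4`. -/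
theorem PhaseBudget.exp_le {ε δ lam : ℝ} (hb : PhaseBudget C ε δ lam) {t : ℝ}
    (ht : Real.log (1 / δ) + 2 ≤ t) : Real.exp (-t) ≤ δ / 4 := by
  have h1 : Real.exp (-t) ≤ Real.exp (Real.log δ + -2) := by
    apply Real.exp_le_exp.2
    rw [one_div, Real.log_inv] at ht
    linarith
  have h2 : Real.exp (-2) ≤ 1 / 4 := by
    have h3 : Real.exp (-1) ≤ 1 / 2 := by
      have : Real.exp (-1) < 0.3678794412 := by exact_mod_cast Real.exp_neg_one_lt_d9
      norm_num at this
      linarith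
    have : Real.exp (-2) = Real.exp (-1) * Real.exp (-1) := by rw [← Real.exp_add]; norm_num
    rw [this]
    nlinarith [Real.exp_pos (-1)]
  rw [Real.exp_add, Real.exp_log hb.delta_pos] at h1
  nlinarith [hb.delta_pos]

/-- In units of `σ` the shift is of order `ε / lam`, so the Gaussian tail exponent at privacy level
`9ε/10` is of order `lam²`, which dominates `log (1 / δ)`. -/
theorem gaussian_shift_le {ε δ lam τ σ : ℝ} (hb : PhaseBudget C ε δ lam) (hτ : 0 < τ)
    (hσ : σ = 100 * τ * lam ^ 2 / (ε * C)) {v v' : E d}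
    (hv : ‖v - v'‖ ≤ 54 * τ * (lam + 8) / C) {B : Set (E d)} (hB : MeasurableSet B) :
    stdGaussian (E d) {ξ | v + σ • ξ ∈ B} ≤
      ENNReal.ofReal (Real.exp (9 / 10 * ε)) * stdGaussian (E d) {ξ | v' + σ • ξ ∈ B} +
        ENNReal.ofReal (δ / 4) := by
  have hε := hb.eps_pos
  have hl0 := hb.log_nonneg
  have hlam6 : 6 ≤ lam := by linarith [hb.le_lam]
  have hC : (0 : ℝ) < C := by linarith [hb.le_groups]
  have hlam : 0 < lam := by linarith
  have hσ0 : 0 < σ := by rw [hσ]; positivity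
  -- The quotient of the shift by `σ` is at most `(54 / 100) ε (lam + 8) / lam²`, and `lam + 8 ≤ (7
  -- / 3) lam` for `lam ≥ 6`.
  set a := 63 / 50 * ε / lam with ha
  have ha0 : 0 < a := by positivity
  have hnorm : ‖σ⁻¹ • (v - v')‖ ≤ a := by
    rw [norm_smul, Real.norm_of_nonneg (inv_nonneg.2 hσ0.le), inv_mul_le_iff₀ hσ0]
    refine hv.trans ?_
    have e : σ * a = 126 * τ * lam / C := by
      rw [hσ, ha]; field_simp; ring
    rw [e]
    refine div_le_div_of_nonneg_right ?_ hC.le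
    nlinarith
  have ha2 : a ^ 2 ≤ 441 / 1000 * ε := by
    rw [ha, div_pow, div_le_iff₀ (by positivity)]
    have : (36 : ℝ) ≤ lam ^ 2 := by nlinarith
    have h1 : ε ^ 2 ≤ 10 * ε := by nlinarith [hb.eps_le]
    nlinarith
  have hS2 : MeasurableSet {ξ : E d | v' + σ • ξ ∈ B} :=
    hB.preimage (by fun_prop : Measurable fun ξ : E d => v' + σ • ξ)
  have hmain := stdGaussian_preimage_add_le ha0 hnorm (ε := 9 / 10 * ε) (by linarith) hS2
  have hset : {x : E d | σ⁻¹ • (v - v') + x ∈ {ξ : E d | v' + σ • ξ ∈ B}} =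
      {ξ | v + σ • ξ ∈ B} := by
    ext ξ
    simp only [Set.mem_ofPred_eq, smul_add, smul_smul, mul_inv_cancel₀ hσ0.ne', one_smul]
    rw [← add_assoc, add_sub_cancel]
  rw [hset] at hmain
  refine hmain.trans (add_le_add le_rfl (ENNReal.ofReal_le_ofReal (hb.exp_le ?_)))
  rw [le_div_iff₀ (by positivity)]
  have h1 : (679 / 1000 * ε) ^ 2 ≤ (9 / 10 * ε - a ^ 2 / 2) ^ 2 := by
    gcongr; linarith
  have e : lam ^ 2 * a ^ 2 = (63 / 50 * ε) ^ 2 := by rw [ha]; field_simp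
  have h2 : (Real.log (1 / δ) + 2) ≤ 145 / 1000 * lam ^ 2 := by
    have : (Real.log (1 / δ) + 6) ^ 2 ≤ lam ^ 2 := by
      gcongr; exact hb.le_lam
    nlinarith
  calc (Real.log (1 / δ) + 2) * (2 * a ^ 2) ≤ 145 / 1000 * lam ^ 2 * (2 * a ^ 2) := by gcongr
    _ = 145 / 1000 * 2 * (63 / 50 * ε) ^ 2 := by rw [← e]; ring
    _ ≤ (679 / 1000 * ε) ^ 2 := by nlinarith [sq_nonneg ε]
    _ ≤ _ := h1

theorem measurable_keptMean_right (τ : ℝ) (y : Fin C → E d) : Measurable (keptMean τ y) := by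
  have h := measurable_keptMean (d := d) (C := C) τ
  have h2 := h.comp (measurable_prodMk_left (x := y))
  exact h2

/-- Conditionally on the selection variables this is the Gaussian mechanism, valid whenever enough
points are kept and few decisions flip. The two exceptional events are integrated as indicators and
paid for additively. -/
theorem keptMean_noise_le {ε δ lam τ σ : ℝ} (hb : PhaseBudget C ε δ lam) (hτ : 0 < τ)
    (hσ : σ = 100 * τ * lam ^ 2 / (ε * C)) {y y' : Fin C → E d} {j₀ : Fin C}
    (h : ∀ j, j ≠ j₀ → y j = y' j) (hs : 3 / 5 * (C : ℝ) ≤ concentrationScore τ y)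
    {B : Set (E d)} (hB : MeasurableSet B) :
    ((selectLaw C).prod (stdGaussian (E d))) {ω | keptMean τ y ω.1 + σ • ω.2 ∈ B} ≤
      ENNReal.ofReal (Real.exp (9 / 10 * ε)) *
        ((selectLaw C).prod (stdGaussian (E d))) {ω | keptMean τ y' ω.1 + σ • ω.2 ∈ B} +
        ENNReal.ofReal δ := by
  classical
  have hl0 := hb.log_nonneg
  have hlam6 : 6 ≤ lam := by linarith [hb.le_lam]
  have hCr : (100 : ℝ) < C := by linarith [hb.le_groups]
  have hC : 100 < C := by exact_mod_cast hCr
  have hmeas : ∀ z : Fin C → E d, MeasurableSet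
      {ω : (Fin C → ℝ) × E d | keptMean τ z ω.1 + σ • ω.2 ∈ B} := fun z => by
    have h2 : Measurable fun ω : (Fin C → ℝ) × E d => keptMean τ z ω.1 :=
      (measurable_keptMean_right τ z).comp measurable_fst
    have h3 : Measurable fun ω : (Fin C → ℝ) × E d => keptMean τ z ω.1 + σ • ω.2 := by fun_prop
    exact h3 hB
  obtain ⟨j₁, hj₁⟩ := exists_majority (by omega) hs
  set M := Finset.univ.filter fun j' => ‖y j₁ - y j'‖ ≤ τ with hMdef
  have hM : ∀ j ∈ M, ‖y j₁ - y j‖ ≤ τ := fun j hj => (Finset.mem_filter.1 hj).2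
  -- Two members of a ball of radius `τ` are within `2τ` of each other, which is why the selection
  -- score uses twice the radius of the test: all cluster members inherit a large score.
  have hMscore : ∀ j ∈ M, 3 / 5 * (C : ℝ) ≤ score τ y j := by
    intro j hj
    refine hj₁.trans ?_
    unfold score
    rw [Finset.card_filter]
    push_cast
    refine Finset.sum_le_sum fun j' _ => ?_
    split_ifs with h1 h2 h2
    · exact le_rfl
    · exfalso
      apply h2
      calc ‖y j - y j'‖ = ‖(y j₁ - y j') - (y j₁ - y j)‖ := by congr 1; abel
        _ ≤ _ := (norm_sub_le _ _).trans (by linarith [hM j hj])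
    · norm_num
    · exact le_rfl
  -- Large enough for the tail `exp (11 - k)` of the number of flips to be at most `δ / 4`; the
  -- changed point itself adds one more exceptional index and gives the `lam + 8` in the shift.
  set k := lam + 7 with hk
  set bad1 : Set (Fin C → ℝ) := {u | ((kept τ y u).card : ℝ) ≤ C / 6} with hbad1
  set bad2 : Set (Fin C → ℝ) := {u | k ≤ ((flipped τ y y' j₀ u).card : ℝ)} with hbad2
  have hp1 : selectLaw C bad1 ≤ ENNReal.ofReal (δ / 4) :=
    (selectLaw_card_kept_le (by omega) hj₁ hMscore).trans (ENNReal.ofReal_le_ofReal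
      (hb.exp_le (by linarith [hb.le_groups, hb.le_lam])))
  have hp2 : selectLaw C bad2 ≤ ENNReal.ofReal (δ / 4) := by
    refine (selectLaw_flipped_le h k).trans (ENNReal.ofReal_le_ofReal ?_)
    have := hb.exp_le (t := k - 11) (by linarith [hb.le_lam])
    rwa [neg_sub] at this
  rw [Measure.prod_apply (hmeas y), Measure.prod_apply (hmeas y')]
  set g : (Fin C → ℝ) → ENNReal := fun u => stdGaussian (E d) {ξ | keptMean τ y' u + σ • ξ ∈ B}
    with hg
  have hgm : Measurable g := measurable_measure_prodMk_left (hmeas y')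
  have hpt : ∀ᵐ u ∂selectLaw C, stdGaussian (E d) {ξ | keptMean τ y u + σ • ξ ∈ B} ≤
      (ENNReal.ofReal (Real.exp (9 / 10 * ε)) * g u + ENNReal.ofReal (δ / 4)) +
        (bad1.indicator (fun _ => 1) u + bad2.indicator (fun _ => 1) u) := by
    filter_upwards [ae_selectLaw_mem C] with u hu
    by_cases h1 : u ∈ bad1
    · rw [Set.indicator_of_mem h1]
      exact prob_le_one.trans (le_add_left (le_add_right le_rfl))
    by_cases h2 : u ∈ bad2
    · rw [Set.indicator_of_mem h2]
      exact prob_le_one.trans (le_add_left (le_add_left le_rfl))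
    refine le_add_right (gaussian_shift_le hb hτ hσ ?_ hB)
    have := norm_keptMean_sub_keptMean_le h hτ.le (by omega) hj₁ hM (fun j => (hu j).1)
      (k := k) (by linarith [hb.le_groups]) (not_le.1 h2) (not_le.1 h1)
    rwa [hk, show lam + 7 + 1 = lam + 8 by ring] at this
  calc ∫⁻ u, stdGaussian (E d) {ξ | keptMean τ y u + σ • ξ ∈ B} ∂selectLaw C
      ≤ ∫⁻ u, (ENNReal.ofReal (Real.exp (9 / 10 * ε)) * g u + ENNReal.ofReal (δ / 4)) +
        (bad1.indicator (fun _ => 1) u + bad2.indicator (fun _ => 1) u) ∂selectLaw C :=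
        lintegral_mono_ae hpt
    _ ≤ (ENNReal.ofReal (Real.exp (9 / 10 * ε)) * ∫⁻ u, g u ∂selectLaw C +
          ENNReal.ofReal (δ / 4)) + (ENNReal.ofReal (δ / 4) + ENNReal.ofReal (δ / 4)) := by
        rw [lintegral_add_left ((hgm.const_mul _).add_const _),
          lintegral_add_left (hgm.const_mul _), lintegral_const_mul _ hgm, lintegral_const,
          measure_univ, mul_one]
        gcongr
        have hm2 : MeasurableSet bad2 := by
          have : bad2 = {u | k ≤ ∑ j : Fin C, if u j ∈ (if j = j₀ then ∅ else
              Set.Ico (min (keepProb C (score τ y j)) (keepProb C (score τ y' j)))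
                (max (keepProb C (score τ y j)) (keepProb C (score τ y' j)))) then (1 : ℝ)
                else 0} := by
            ext u
            simp only [hbad2, flipped, Set.mem_ofPred_eq, Finset.card_filter]
            push_cast
            congr!
          rw [this]
          refine measurableSet_le measurable_const (Finset.measurable_sum _ fun j _ =>
            Measurable.ite ?_ measurable_const measurable_const)
          have hj : Measurable fun u : Fin C → ℝ => u j := measurable_pi_apply j
          split_ifs
          · exact hj MeasurableSet.empty
          · exact hj measurableSet_Ico
        rw [lintegral_add_right _ (measurable_const.indicator hm2)]
        gcongr
        · refine (lintegral_indicator_const_le _ _).trans ?_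
          rwa [one_mul]
        · refine (lintegral_indicator_const_le _ _).trans ?_
          rwa [one_mul]
    _ ≤ _ := by
        rw [add_assoc]
        refine add_le_add le_rfl ?_
        rw [← ENNReal.ofReal_add (by linarith [hb.delta_pos]) (by linarith [hb.delta_pos]),
          ← ENNReal.ofReal_add (by linarith [hb.delta_pos]) (by linarith [hb.delta_pos])]
        exact ENNReal.ofReal_le_ofReal (by linarith [hb.delta_pos])

/-- A phase is private: changing one of the points it aggregates changes the probability of any
event about its result by at most a factor `exp ε` and an additive `δ`. -/
theorem phase_private {ε δ lam τ σ : ℝ} (hb : PhaseBudget C ε δ lam) (hτ : 0 < τ)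
    (hσ : σ = 100 * τ * lam ^ 2 / (ε * C)) {y y' : Fin C → E d} {j₀ : Fin C}
    (h : ∀ j, j ≠ j₀ → y j = y' j) {B : Set (E d)} (hB : MeasurableSet B) (b : Prop) :
    ((laplace (20 / ε)).prod ((selectLaw C).prod (stdGaussian (E d))))
        {ω | (4 * (C : ℝ) / 5 ≤ concentrationScore τ y + ω.1 ∧
          keptMean τ y ω.2.1 + σ • ω.2.2 ∈ B) ∨
          (¬ 4 * (C : ℝ) / 5 ≤ concentrationScore τ y + ω.1 ∧ b)} ≤
      ENNReal.ofReal (Real.exp ε) *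
        ((laplace (20 / ε)).prod ((selectLaw C).prod (stdGaussian (E d))))
          {ω | (4 * (C : ℝ) / 5 ≤ concentrationScore τ y' + ω.1 ∧
            keptMean τ y' ω.2.1 + σ • ω.2.2 ∈ B) ∨
            (¬ 4 * (C : ℝ) / 5 ≤ concentrationScore τ y' + ω.1 ∧ b)} +
        ENNReal.ofReal δ := by
  have hε := hb.eps_pos
  have hl0 := hb.log_nonneg
  have hlam6 : 6 ≤ lam := by linarith [hb.le_lam]
  have hbpos : 0 < 20 / ε := by positivity
  have := isProbabilityMeasure_laplace hbpos
  set ν := (selectLaw C).prod (stdGaussian (E d)) with hν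
  set pass : (Fin C → E d) → Set ℝ := fun z =>
    {x | 4 * (C : ℝ) / 5 ≤ concentrationScore τ z + x} with hpass
  set ev : (Fin C → E d) → Set ((Fin C → ℝ) × E d) := fun z =>
    {ω | keptMean τ z ω.1 + σ • ω.2 ∈ B} with hev
  have hpm : ∀ z, MeasurableSet (pass z) := fun z => measurableSet_le measurable_const (by fun_prop)
  have hsplit : ∀ z, ((laplace (20 / ε)).prod ν)
      {ω | (4 * (C : ℝ) / 5 ≤ concentrationScore τ z + ω.1 ∧
          keptMean τ z ω.2.1 + σ • ω.2.2 ∈ B) ∨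
          (¬ 4 * (C : ℝ) / 5 ≤ concentrationScore τ z + ω.1 ∧ b)} =
      laplace (20 / ε) (pass z) * ν (ev z) + laplace (20 / ε) (pass z)ᶜ * ν {_ω | b} := by
    intro z
    have e : {ω : ℝ × (Fin C → ℝ) × E d | (4 * (C : ℝ) / 5 ≤ concentrationScore τ z + ω.1 ∧
          keptMean τ z ω.2.1 + σ • ω.2.2 ∈ B) ∨
          (¬ 4 * (C : ℝ) / 5 ≤ concentrationScore τ z + ω.1 ∧ b)} =
        pass z ×ˢ ev z ∪ (pass z)ᶜ ×ˢ {_ω | b} := by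
      ext ω
      simp [hpass, hev]
    rw [e, measure_union, Measure.prod_prod, Measure.prod_prod]
    · rw [Set.disjoint_left]
      rintro ω hω hω'
      exact hω'.1 hω.1
    · exact (hpm z).compl.prod (MeasurableSet.const b)
  have hdiff := abs_concentrationScore_sub_le (τ := τ) h
  -- Sensitivity 2 against scale `20 / ε`: the test costs `ε / 10`.
  have hshift : ∀ A : Set ℝ, MeasurableSet A → laplace (20 / ε)
      {x | x + (concentrationScore τ y - concentrationScore τ y') ∈ A} ≤
      ENNReal.ofReal (Real.exp (ε / 10)) * laplace (20 / ε) A := by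
    intro A hA
    refine (laplace_preimage_add_le hbpos _ hA).trans ?_
    refine mul_le_mul_left (ENNReal.ofReal_le_ofReal (Real.exp_le_exp.2 ?_)) _
    rw [div_div_eq_mul_div, div_le_iff₀ (by norm_num)]
    nlinarith
  have hpassle : laplace (20 / ε) (pass y) ≤
      ENNReal.ofReal (Real.exp (ε / 10)) * laplace (20 / ε) (pass y') := by
    refine le_trans (measure_mono ?_) (hshift _ (hpm y'))
    intro x hx
    simp only [hpass, Set.mem_ofPred_eq] at hx ⊢
    linarith
  have hfaille : laplace (20 / ε) (pass y)ᶜ ≤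
      ENNReal.ofReal (Real.exp (ε / 10)) * laplace (20 / ε) (pass y')ᶜ := by
    refine le_trans (measure_mono ?_) (hshift _ (hpm y').compl)
    intro x hx
    simp only [hpass, Set.mem_compl_iff, Set.mem_ofPred_eq] at hx ⊢
    intro hx'
    apply hx
    linarith
  have hexp : ENNReal.ofReal (Real.exp (ε / 10)) ≤ ENNReal.ofReal (Real.exp ε) :=
    ENNReal.ofReal_le_ofReal (Real.exp_le_exp.2 (by linarith))
  have hfail2 : laplace (20 / ε) (pass y)ᶜ * ν {_ω | b} ≤
      ENNReal.ofReal (Real.exp ε) * (laplace (20 / ε) (pass y')ᶜ * ν {_ω | b}) := by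
    rw [← mul_assoc]
    gcongr
    exact hfaille.trans (by gcongr)
  have hpass2 : laplace (20 / ε) (pass y) * ν (ev y) ≤
      ENNReal.ofReal (Real.exp ε) * (laplace (20 / ε) (pass y') * ν (ev y')) +
        ENNReal.ofReal δ := by
    -- With a large score there is a majority cluster and the Gaussian step is private. With a small
    -- score the test is passed only if the Laplace noise exceeds `C / 5`, so the whole event is
    -- charged to `δ`.
    by_cases hs : 3 / 5 * (C : ℝ) ≤ concentrationScore τ y
    · calc laplace (20 / ε) (pass y) * ν (ev y)
          ≤ laplace (20 / ε) (pass y) * (ENNReal.ofReal (Real.exp (9 / 10 * ε)) * ν (ev y') +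
            ENNReal.ofReal δ) := by
            gcongr
            exact keptMean_noise_le hb hτ hσ h hs hB
        _ ≤ ENNReal.ofReal (Real.exp (ε / 10)) * laplace (20 / ε) (pass y') *
              (ENNReal.ofReal (Real.exp (9 / 10 * ε)) * ν (ev y')) + 1 * ENNReal.ofReal δ := by
            rw [mul_add]
            gcongr
            exact prob_le_one
        _ = _ := by
            rw [one_mul, show Real.exp ε = Real.exp (ε / 10) * Real.exp (9 / 10 * ε) by
              rw [← Real.exp_add]; ring_nf, ENNReal.ofReal_mul (Real.exp_pos _).le]
            ring
    · push Not at hs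
      refine le_add_left ?_
      calc laplace (20 / ε) (pass y) * ν (ev y) ≤ laplace (20 / ε) (pass y) * 1 := by
            gcongr; exact prob_le_one
        _ ≤ laplace (20 / ε) (Set.Ici ((C : ℝ) / 5)) := by
            rw [mul_one]
            refine measure_mono fun x hx => ?_
            simp only [hpass, Set.mem_ofPred_eq, Set.mem_Ici] at hx ⊢
            linarith
        _ ≤ ENNReal.ofReal (Real.exp (-(C / 5 : ℝ) / (20 / ε))) :=
            laplace_Ici_le hbpos (by positivity)
        _ ≤ ENNReal.ofReal δ := by
            apply ENNReal.ofReal_le_ofReal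
            have := hb.exp_le (t := C * ε / 100) (by linarith [hb.le_lam, hb.le_groups_mul])
            rw [show -(C / 5 : ℝ) / (20 / ε) = -(C * ε / 100) by field_simp; ring]
            linarith [hb.delta_pos]
  rw [hsplit y, hsplit y', mul_add]
  refine (add_le_add hpass2 hfail2).trans_eq ?_
  ring

end PhasePrivacy

end PhasedSGD

end

noncomputable section

namespace PhasedSGD

/-! ### Elementary facts about the parameters -/

/-- Admissible parameter ranges. -/
structure Params.Valid {d : ℕ} (P : Params d) : Prop where
  dim_pos : 1 ≤ d
  n_pos : 1 ≤ P.n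
  m_pos : 1 ≤ P.m
  eps_pos : 0 < P.ε
  eps_le : P.ε ≤ 10
  delta_pos : 0 < P.δ
  delta_lt_one : P.δ < 1
  q_pos : 0 < P.q
  eta_pos : 0 < P.η
  L_pos : 0 < P.L

theorem two_le_log_twenty : 2 ≤ Real.log 20 := by
  rw [Real.le_log_iff_exp_le (by norm_num)]
  have h : Real.exp 2 = Real.exp 1 * Real.exp 1 := by rw [← Real.exp_add]; norm_num
  rw [h]
  nlinarith [Real.exp_one_lt_d9, Real.exp_pos 1]

theorem Params.two_rpow_mul_q {d : ℕ} (P : Params d) (i : ℕ) :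
    (2 : ℝ) ^ (i * P.q) = ((2 : ℝ) ^ P.q) ^ i := by
  rw [mul_comm, Real.rpow_mul (by norm_num), Real.rpow_natCast]

theorem Params.users_eq {d : ℕ} (P : Params d) (i : ℕ) :
    P.users i = (1 - ((2 : ℝ) ^ P.q)⁻¹) * P.n / ((2 : ℝ) ^ P.q) ^ i := by
  unfold Params.users
  rw [P.two_rpow_mul_q, one_div, Real.inv_rpow (by norm_num)]

namespace Params.Valid

variable {d : ℕ} {P : Params d} (hP : P.Valid)

include hP

theorem one_le_n : (1 : ℝ) ≤ P.n := by exact_mod_cast hP.n_pos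

theorem one_le_m : (1 : ℝ) ≤ P.m := by exact_mod_cast hP.m_pos

theorem one_le_d : (1 : ℝ) ≤ d := by exact_mod_cast hP.dim_pos

theorem log_groups : Real.log (20 * P.n * P.m * Real.exp P.ε / P.δ) =
    Real.log 20 + Real.log P.m + Real.log (P.n / P.δ) + P.ε := by
  have h1 := hP.one_le_n
  have h2 := hP.one_le_m
  have h3 := hP.delta_pos
  rw [show 20 * (P.n : ℝ) * P.m * Real.exp P.ε / P.δ =
      20 * P.m * (P.n / P.δ) * Real.exp P.ε by ring,
    Real.log_mul (by positivity) (by positivity), Real.log_mul (by positivity) (by positivity),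
    Real.log_mul (by positivity) (by positivity), Real.log_exp]

theorem log_inv_delta_pos : 0 < Real.log (1 / P.δ) :=
  Real.log_pos (by rw [lt_div_iff₀ hP.delta_pos]; linarith [hP.delta_lt_one])

theorem log_div_delta : Real.log (P.n / P.δ) = Real.log P.n + Real.log (1 / P.δ) := by
  have h1 := hP.one_le_n
  have h3 := hP.delta_pos
  rw [← Real.log_mul (by positivity) (by positivity), mul_one_div]

theorem log_div_delta_pos : 0 < Real.log (P.n / P.δ) := by
  rw [hP.log_div_delta]
  linarith [hP.log_inv_delta_pos, Real.log_nonneg hP.one_le_n]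

theorem groups_mul_ge : 100 * (Real.log (P.n / P.δ) + 2 + P.ε) ≤ P.C * P.ε := by
  have h := Nat.le_ceil (100 * Real.log (20 * P.n * P.m * Real.exp P.ε / P.δ) / P.ε)
  rw [div_le_iff₀ hP.eps_pos, hP.log_groups] at h
  have h2 := two_le_log_twenty
  have h3 := Real.log_nonneg hP.one_le_m
  unfold Params.C
  rw [hP.log_groups]
  linarith

theorem groups_ge : 10 * Real.log (P.n / P.δ) + 120 ≤ P.C := by
  have h := hP.groups_mul_ge
  have h0 := hP.log_div_delta_pos
  have hε := hP.eps_pos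
  have hε' := hP.eps_le
  refine le_of_mul_le_mul_right ?_ hε
  nlinarith

theorem C_pos : 0 < P.C := by
  have h := hP.groups_ge
  have h0 := hP.log_div_delta_pos
  have : (0 : ℝ) < P.C := by linarith
  exact_mod_cast this

theorem one_lt_two_rpow_q : 1 < (2 : ℝ) ^ P.q := Real.one_lt_rpow (by norm_num) hP.q_pos

theorem users_nonneg (i : ℕ) : 0 ≤ P.users i := by
  rw [P.users_eq]
  have h := hP.one_lt_two_rpow_q
  have : ((2 : ℝ) ^ P.q)⁻¹ ≤ 1 := inv_le_one_of_one_le₀ h.le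
  have : 0 ≤ 1 - ((2 : ℝ) ^ P.q)⁻¹ := by linarith
  positivity

/-- With `a = 2 ^ q`, the largest possible share `(a - 1) / a²` is at most `1 / 4`, because `(a -
2)² ≥ 0`. -/
theorem four_mul_users_le {i : ℕ} (hi : 1 ≤ i) : 4 * P.users i ≤ P.n := by
  rw [P.users_eq]
  have h := hP.one_lt_two_rpow_q
  set a := (2 : ℝ) ^ P.q
  have ha : 0 < a := by linarith
  have hai : a ≤ a ^ i := le_self_pow₀ h.le (by omega)
  have h1 : 0 ≤ 1 - a⁻¹ := by
    have : a⁻¹ ≤ 1 := inv_le_one_of_one_le₀ h.le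
    linarith
  have hn := hP.one_le_n
  calc 4 * ((1 - a⁻¹) * P.n / a ^ i) ≤ 4 * ((1 - a⁻¹) * P.n / a) := by gcongr
    _ = (4 * (a - 1) / a ^ 2) * P.n := by field_simp
    _ ≤ 1 * P.n := by
      gcongr
      rw [div_le_one (by positivity)]
      nlinarith [sq_nonneg (a - 2)]
    _ = _ := one_mul _

theorem mul_N_le_users (i : ℕ) : (P.C : ℝ) * P.N i ≤ P.users i := by
  have hC : (0 : ℝ) < P.C := by exact_mod_cast hP.C_pos
  have h := Nat.floor_le (div_nonneg (hP.users_nonneg i) hC.le)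
  rw [le_div_iff₀ hC] at h
  unfold Params.N
  linarith

/-- The factor `1 - 2 ^ (-q)` makes the nominal group sizes telescope, so all phases together never
need more than `n` users. -/
theorem sum_users_le (k : ℕ) : ∑ i ∈ Finset.range k, P.users (i + 1) ≤ P.n := by
  have h := hP.one_lt_two_rpow_q
  set a := (2 : ℝ) ^ P.q with ha
  have hn := hP.one_le_n
  have ha0 : 0 < a := by linarith
  have hclaim : ∑ i ∈ Finset.range k, P.users (i + 1) = P.n * (a⁻¹ - a⁻¹ ^ (k + 1)) := by
    induction k with
    | zero => simp
    | succ k ih =>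
      rw [Finset.sum_range_succ, ih, P.users_eq, ← ha, div_eq_mul_inv, ← inv_pow]
      ring
  rw [hclaim]
  have h1 : a⁻¹ ≤ 1 := inv_le_one_of_one_le₀ h.le
  have h2 : 0 ≤ a⁻¹ ^ (k + 1) := by positivity
  nlinarith

theorem sum_groups_le : ∑ i : Fin P.l, P.C * P.N (i + 1) ≤ P.n := by
  have h : ((∑ i : Fin P.l, P.C * P.N (i + 1) : ℕ) : ℝ) ≤ P.n := by
    push_cast
    refine le_trans ?_ (hP.sum_users_le P.l)
    rw [Finset.sum_range]
    exact Finset.sum_le_sum fun i _ => hP.mul_N_le_users _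
  exact_mod_cast h

theorem four_mul_C_le {i : ℕ} (hi : 1 ≤ i) (hN : 0 < P.N i) : 4 * (P.C : ℝ) ≤ P.n := by
  have h1 := hP.mul_N_le_users i
  have h2 := hP.four_mul_users_le hi
  have h3 : (1 : ℝ) ≤ P.N i := by exact_mod_cast hN
  have hC : (0 : ℝ) < P.C := by exact_mod_cast hP.C_pos
  nlinarith

/-- A nonempty group forces `n ≥ 4C ≥ 480 > e ^ 6`. -/
theorem six_le_log_n {i : ℕ} (hi : 1 ≤ i) (hN : 0 < P.N i) : 6 ≤ Real.log P.n := by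
  have h1 := hP.four_mul_C_le hi hN
  have h2 := hP.groups_ge
  have h3 := hP.log_div_delta_pos
  rw [Real.le_log_iff_exp_le (by linarith)]
  have h4 : Real.exp 6 = Real.exp 1 ^ 6 := by rw [← Real.exp_nat_mul]; norm_num
  have h5 : Real.exp 1 ^ 6 ≤ 2.7182818286 ^ 6 := by gcongr; exact Real.exp_one_lt_d9.le
  rw [h4]
  refine h5.trans ?_
  norm_num
  linarith

/-- The privacy requirements hold only for phases that own samples, which is enough because a phase
without samples has nothing to reveal. Nonempty groups supply the summand 6 through `log n ≥ 6`. -/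
theorem phaseBudget {i : ℕ} (hi : 1 ≤ i) (hN : 0 < P.N i) :
    PhaseBudget P.C P.ε P.δ (Real.log (P.n / P.δ)) where
  eps_pos := hP.eps_pos
  eps_le := hP.eps_le
  delta_pos := hP.delta_pos
  delta_lt_one := hP.delta_lt_one
  le_lam := by
    rw [hP.log_div_delta]
    linarith [hP.six_le_log_n hi hN]
  le_groups := by linarith [hP.groups_ge]
  le_groups_mul := by linarith [hP.groups_mul_ge, hP.eps_pos]

theorem step_pos (i : ℕ) : 0 < P.step i := by
  unfold Params.step
  have := hP.eta_pos
  positivity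

theorem T_pos {i : ℕ} (hN : 0 < P.N i) : 0 < P.T i := Nat.mul_pos hN hP.m_pos

theorem tau_pos {i : ℕ} (hi : 1 ≤ i) (hN : 0 < P.N i) : 0 < P.τ i := by
  unfold Params.τ
  have h1 := hP.step_pos i
  have h2 := hP.L_pos
  have h3 : (0 : ℝ) < P.T i := by exact_mod_cast hP.T_pos hN
  have h4 : 0 < Real.log ((P.n : ℝ) * d * P.m) := by
    rw [Real.log_mul (by have := hP.one_le_n; have := hP.one_le_d; positivity)
      (by have := hP.one_le_m; positivity), Real.log_mul (by have := hP.one_le_n; positivity)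
      (by have := hP.one_le_d; positivity)]
    linarith [hP.six_le_log_n hi hN, Real.log_nonneg hP.one_le_d, Real.log_nonneg hP.one_le_m]
  positivity

/-- Disjoint groups of the required sizes exist. -/
theorem nonempty_schedule : Nonempty (Schedule P) := by
  have hcard : Fintype.card (Σ i : Fin P.l, Fin P.C × Fin (P.N (i + 1))) ≤
      Fintype.card (Fin P.n) := by
    simp only [Fintype.card_sigma, Fintype.card_prod, Fintype.card_fin]
    exact hP.sum_groups_le
  obtain ⟨e⟩ := Function.Embedding.nonempty_of_card_le hcard
  exact ⟨{ user := fun i j k => e ⟨i, j, k⟩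
           user_injective := fun a b h => e.injective h
           order := fun i j => finProdFinEquiv.symm }⟩

end Params.Valid

/-! ### The algorithm as an iteration of phases -/

section Iteration

variable {l : ℕ} {S : Type*}

/-- Apply the first `k` of the maps `F 0, …, F (l - 1)`. -/
def iterPhases (F : Fin l → S → S) (a : S) : (k : ℕ) → k ≤ l → S
  | 0, _ => a
  | k + 1, hk => F ⟨k, hk⟩ (iterPhases F a k (Nat.le_of_succ_le hk))

theorem iterPhases_congr {F F' : Fin l → S → S} (a : S) {k : ℕ} (hk : k ≤ l)
    (h : ∀ i : Fin l, i.val < k → F i = F' i) : iterPhases F a k hk = iterPhases F' a k hk := by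
  induction k with
  | zero => rfl
  | succ k ih =>
    simp only [iterPhases]
    rw [h ⟨k, hk⟩ (Nat.lt_succ_self k), ih _ fun i hi => h i (Nat.lt_succ_of_lt hi)]

/-- The result after all phases depends on the phases up to `i` only through the state after
phase `i`. -/
theorem iterPhases_eq_update (F : Fin l → S → S) (a : S) (i : Fin l) {k : ℕ} (hk : k ≤ l) :
    iterPhases F a k hk =
      iterPhases (Function.update F i fun _ => F i (iterPhases F a i i.isLt.le)) a k hk := by
  induction k with
  | zero => rfl
  | succ k ih =>
    simp only [iterPhases]
    rw [← ih]
    by_cases h : (⟨k, hk⟩ : Fin l) = i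
    · subst h
      rw [Function.update_self]
    · rw [Function.update_of_ne h]

theorem measurable_iterPhases {α : Type*} [MeasurableSpace α] [MeasurableSpace S]
    {F : α → Fin l → S → S} (hF : ∀ i, Measurable fun q : α × S => F q.1 i q.2) {a : α → S}
    (ha : Measurable a) {k : ℕ} (hk : k ≤ l) :
    Measurable fun x => iterPhases (F x) (a x) k hk := by
  induction k with
  | zero => exact ha
  | succ k ih => exact (hF ⟨k, hk⟩).comp (measurable_id.prodMk (ih _))

end Iteration

/-! ### The counted program as a recursion on states. -/

section Run

variable {d : ℕ} {Z : Type*} {P : Params d}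

/-- The samples read by the groups of phase `i + 1`. -/
abbrev PhaseData (Z : Type*) (P : Params d) (i : Fin P.l) : Type _ :=
  Fin P.C × Fin (P.T (i + 1)) → Z

/-- The samples of phase `i + 1`, in the order of reading. -/
def Schedule.read (s : Schedule P) (D : Dataset Z P.n P.m) (i : Fin P.l) : PhaseData Z P i :=
  fun p => D (s.user i p.1 (s.order i p.1 p.2).1) (s.order i p.1 p.2).2

/-- The average iterates of the groups of phase `i + 1`, started at `x`. -/
def groupAvgs (X : Set (E d)) (g : E d → Z → E d) (i : Fin P.l) (w : PhaseData Z P i) (x : E d) :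
    Fin P.C → E d :=
  fun j => sgdAvg X g (P.step (i + 1)) (P.T (i + 1)) (fun t => w (j, t)) x

open Classical in
/-- Phase `i + 1` as a map of states; the boolean tells whether the algorithm is still running,
and a halted algorithm sits at `proj X 0`. -/
def phaseStep (X : Set (E d)) (g : E d → Z → E d) (i : Fin P.l) (w : PhaseData Z P i)
    (ω : PhaseNoise P) (a : Bool × E d) : Bool × E d :=
  if a.1 = true then
    if 4 * (P.C : ℝ) / 5 ≤ concentrationScore (P.τ (i + 1)) (groupAvgs X g i w a.2) + ω.1 then
      (true, proj X (keptMean (P.τ (i + 1)) (groupAvgs X g i w a.2) ω.2.1 + P.σ (i + 1) • ω.2.2))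
    else (false, proj X 0)
  else a

/-- The state after the first `k` phases. -/
def stateAfter (X : Set (E d)) (g : E d → Z → E d) (x₀ : E d) (w : (i : Fin P.l) → PhaseData Z P i)
    (ω : Noise P) (k : ℕ) (hk : k ≤ P.l) : Bool × E d :=
  iterPhases (fun i => phaseStep X g i (w i) (ω i)) (true, x₀) k hk

theorem stateAfter_zero (X : Set (E d)) (g : E d → Z → E d) (x₀ : E d)
    (w : (i : Fin P.l) → PhaseData Z P i) (ω : Noise P) (hk : 0 ≤ P.l) :
    stateAfter X g x₀ w ω 0 hk = (true, x₀) := rfl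

theorem stateAfter_succ (X : Set (E d)) (g : E d → Z → E d) (x₀ : E d)
    (w : (i : Fin P.l) → PhaseData Z P i) (ω : Noise P) (k : ℕ) (hk : k + 1 ≤ P.l) :
    stateAfter X g x₀ w ω (k + 1) hk = phaseStep X g ⟨k, hk⟩ (w ⟨k, hk⟩) (ω ⟨k, hk⟩)
      (stateAfter X g x₀ w ω k (Nat.le_of_succ_le hk)) := rfl

/-- Translates a phase of the program into a total map of states. The halted output is stored in the
state, so the option type disappears from the analysis. -/
theorem phase_eq (s : Schedule P) (X : Set (E d)) (G : E d → Z → E d) (D : Dataset Z P.n P.m)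
    (i : Fin P.l) (ω : PhaseNoise P) (x : E d) :
    (phase P s X G D i ω x).val =
      (if (phaseStep X G i (s.read D i) ω (true, x)).1 = true then
        some (phaseStep X G i (s.read D i) ω (true, x)).2 else none) ∧
      ((phaseStep X G i (s.read D i) ω (true, x)).1 = false →
        (phaseStep X G i (s.read D i) ω (true, x)).2 = proj X 0) ∧
    (phase P s X G D i ω x).grads = P.C * P.T (i + 1) := by
  have hy : (Counted.all fun j : Fin P.C => sgd X G (P.step (i + 1)) (s.samples D i j) x).val =
      groupAvgs X G i (s.read D i) x := by
    funext j
    exact (sgd_ofFn X G (P.step (i + 1)) _ x).1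
  have hg : (Counted.all fun j : Fin P.C => sgd X G (P.step (i + 1)) (s.samples D i j) x).grads =
      P.C * P.T (i + 1) := by
    simp only [Counted.all]
    have : ∀ j, (sgd X G (P.step (i + 1)) (s.samples D i j) x).grads = P.T (i + 1) := fun j =>
      (sgd_ofFn X G (P.step (i + 1)) _ x).2
    simp [this]
  unfold phase phaseStep
  simp only [Counted.val_bind, Counted.grads_bind, hy, hg]
  by_cases h : 4 * (P.C : ℝ) / 5 ≤
      concentrationScore (P.τ (i + 1)) (groupAvgs X G i (s.read D i) x) + ω.1
  · simp [h, Counted.val_pure, Counted.grads_pure, keptMean]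
  · simp [h, Counted.val_pure, Counted.grads_pure]

/-- The gradient count is only bounded above, since a run that halts skips the remaining phases. -/
theorem runPhases_eq (s : Schedule P) (X : Set (E d)) (G : E d → Z → E d) (x₀ : E d)
    (D : Dataset Z P.n P.m) (ω : Noise P) (k : ℕ) (hk : k ≤ P.l) :
    (runPhases P s X G x₀ D ω k hk).val =
      (if (stateAfter X G x₀ (s.read D) ω k hk).1 = true then
        some (stateAfter X G x₀ (s.read D) ω k hk).2 else none) ∧
      ((stateAfter X G x₀ (s.read D) ω k hk).1 = false →
        (stateAfter X G x₀ (s.read D) ω k hk).2 = proj X 0) ∧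
    (runPhases P s X G x₀ D ω k hk).grads ≤ ∑ i ∈ Finset.range k, P.C * P.T (i + 1) := by
  induction k with
  | zero => simp [runPhases, stateAfter, iterPhases, Counted.val_pure, Counted.grads_pure]
  | succ k ih =>
    obtain ⟨h1, h2, h3⟩ := ih (Nat.le_of_succ_le hk)
    rw [stateAfter_succ, Finset.sum_range_succ]
    rw [runPhases]
    simp only [Counted.val_bind, Counted.grads_bind]
    generalize stateAfter X G x₀ (s.read D) ω k (Nat.le_of_succ_le hk) = a at *
    rw [h1]
    obtain ⟨b, x⟩ := a
    cases b
    · simp only [phaseStep]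
      simp only [Bool.false_eq_true, if_false, forall_const] at h2 ⊢
      exact ⟨rfl, h2, le_add_right h3⟩
    · obtain ⟨e1, e2, e3⟩ := phase_eq s X G D ⟨k, hk⟩ (ω ⟨k, hk⟩) x
      simp only [if_true]
      exact ⟨e1, e2, by rw [e3]; gcongr⟩

theorem algorithm_val (s : Schedule P) (X : Set (E d)) (G : E d → Z → E d) (x₀ : E d)
    (D : Dataset Z P.n P.m) (ω : Noise P) :
    (algorithm P s X G x₀ D ω).val = (stateAfter X G x₀ (s.read D) ω P.l le_rfl).2 := by
  obtain ⟨h1, h2, -⟩ := runPhases_eq s X G x₀ D ω P.l le_rfl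
  unfold algorithm
  simp only [Counted.val_bind]
  rw [h1]
  generalize stateAfter X G x₀ (s.read D) ω P.l le_rfl = a at *
  obtain ⟨b, x⟩ := a
  cases b
  · simp [Counted.val_pure] at h2 ⊢
    exact h2.symm
  · simp [Counted.val_pure]

theorem algorithm_grads_le (hP : P.Valid) (s : Schedule P) (X : Set (E d)) (G : E d → Z → E d)
    (x₀ : E d) (D : Dataset Z P.n P.m) (ω : Noise P) :
    (algorithm P s X G x₀ D ω).grads ≤ P.n * P.m := by
  obtain ⟨-, -, h3⟩ := runPhases_eq s X G x₀ D ω P.l le_rfl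
  have h4 : (algorithm P s X G x₀ D ω).grads = (runPhases P s X G x₀ D ω P.l le_rfl).grads := by
    unfold algorithm
    simp only [Counted.grads_bind]
    split <;> simp [Counted.grads_pure]
  rw [h4]
  refine h3.trans ?_
  have h5 := hP.sum_groups_le
  calc ∑ i ∈ Finset.range P.l, P.C * P.T (i + 1) = (∑ i : Fin P.l, P.C * P.N (i + 1)) * P.m := by
        rw [Finset.sum_range, Finset.sum_mul]
        refine Finset.sum_congr rfl fun i _ => ?_
        unfold Params.T
        ring
    _ ≤ _ := Nat.mul_le_mul_right _ h5

end Run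

end PhasedSGD

end

noncomputable section

namespace PhasedSGD

/-! ### Membership, measurability and privacy of the algorithm -/

section Algorithm

variable {d : ℕ} {Z : Type*} {P : Params d} {X : Set (E d)}

theorem phaseStep_mem (hne : X.Nonempty) (hc : IsCompact X) (g : E d → Z → E d) (i : Fin P.l)
    (w : PhaseData Z P i) (ω : PhaseNoise P) {a : Bool × E d} (ha : a.2 ∈ X) :
    (phaseStep X g i w ω a).2 ∈ X := by
  unfold phaseStep
  split_ifs
  · exact proj_mem hne hc _
  · exact proj_mem hne hc _
  · exact ha

theorem stateAfter_mem (hne : X.Nonempty) (hc : IsCompact X) (g : E d → Z → E d) {x₀ : E d}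
    (hx₀ : x₀ ∈ X) (w : (i : Fin P.l) → PhaseData Z P i) (ω : Noise P) (k : ℕ) (hk : k ≤ P.l) :
    (stateAfter X g x₀ w ω k hk).2 ∈ X := by
  induction k with
  | zero => exact hx₀
  | succ k ih =>
    rw [stateAfter_succ]
    exact phaseStep_mem hne hc g _ _ _ (ih (Nat.le_of_succ_le hk))

/-- Every phase starts at a point of `X`, where the original and the reduced gradient produce the
same SGD averages. The analysis may therefore use the bounded and jointly measurable oracle. -/
theorem stateAfter_reducedGrad (hne : X.Nonempty) (hc : IsCompact X) (hX : Convex ℝ X)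
    (G : E d → Z → E d) {x₀ : E d} (hx₀ : x₀ ∈ X) (w : (i : Fin P.l) → PhaseData Z P i)
    (ω : Noise P) (k : ℕ) (hk : k ≤ P.l) :
    stateAfter X G x₀ w ω k hk = stateAfter X (reducedGrad X G) x₀ w ω k hk := by
  induction k with
  | zero => rw [stateAfter_zero, stateAfter_zero]
  | succ k ih =>
    rw [stateAfter_succ, stateAfter_succ, ← ih]
    have hmem := stateAfter_mem hne hc G hx₀ w ω k (Nat.le_of_succ_le hk)
    have : groupAvgs X G ⟨k, hk⟩ (w ⟨k, hk⟩) (stateAfter X G x₀ w ω k (Nat.le_of_succ_le hk)).2 =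
        groupAvgs X (reducedGrad X G) ⟨k, hk⟩ (w ⟨k, hk⟩)
          (stateAfter X G x₀ w ω k (Nat.le_of_succ_le hk)).2 := by
      funext j
      exact sgdAvg_reducedGrad hne hc hX G _ _ hmem
    unfold phaseStep
    rw [this]

variable [MeasurableSpace Z]

theorem measurable_groupAvgs (hne : X.Nonempty) (hc : IsCompact X) (hX : Convex ℝ X)
    {g : E d → Z → E d} (hg : Measurable (Function.uncurry g)) (i : Fin P.l) :
    Measurable fun q : PhaseData Z P i × E d => groupAvgs X g i q.1 q.2 := by
  refine measurable_pi_lambda _ fun j => ?_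
  have h := measurable_sgdAvg hne hc hX hg (P.step (i + 1)) (P.T (i + 1))
  have h2 : Measurable fun q : PhaseData Z P i × E d =>
      ((fun t => q.1 (j, t) : Fin (P.T (i + 1)) → Z), q.2) :=
    (measurable_pi_lambda _ fun t => (measurable_pi_apply (j, t)).comp measurable_fst).prodMk
      measurable_snd
  exact h.comp h2

theorem measurable_phaseStep (hne : X.Nonempty) (hc : IsCompact X) (hX : Convex ℝ X)
    {g : E d → Z → E d} (hg : Measurable (Function.uncurry g)) (i : Fin P.l) :
    Measurable fun q : (PhaseData Z P i × PhaseNoise P) × (Bool × E d) =>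
      phaseStep X g i q.1.1 q.1.2 q.2 := by
  have hy : Measurable fun q : (PhaseData Z P i × PhaseNoise P) × (Bool × E d) =>
      groupAvgs X g i q.1.1 q.2.2 := by
    have h1 : Measurable fun q : (PhaseData Z P i × PhaseNoise P) × (Bool × E d) =>
      (q.1.1, q.2.2) := by fun_prop
    have h2 := (measurable_groupAvgs hne hc hX hg i).comp h1
    exact h2
  have hs : Measurable fun q : (PhaseData Z P i × PhaseNoise P) × (Bool × E d) =>
      concentrationScore (P.τ (i + 1)) (groupAvgs X g i q.1.1 q.2.2) + q.1.2.1 :=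
    ((measurable_concentrationScore _).comp hy).add (by fun_prop)
  have hm : Measurable fun q : (PhaseData Z P i × PhaseNoise P) × (Bool × E d) =>
      keptMean (P.τ (i + 1)) (groupAvgs X g i q.1.1 q.2.2) q.1.2.2.1 := by
    have h1 : Measurable fun q : (PhaseData Z P i × PhaseNoise P) × (Bool × E d) =>
      (groupAvgs X g i q.1.1 q.2.2, q.1.2.2.1) := hy.prodMk (by fun_prop)
    have h2 := (measurable_keptMean (d := d) (P.τ (i + 1))).comp h1
    exact h2
  have hp : Measurable fun q : (PhaseData Z P i × PhaseNoise P) × (Bool × E d) =>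
      proj X (keptMean (P.τ (i + 1)) (groupAvgs X g i q.1.1 q.2.2) q.1.2.2.1 +
        P.σ (i + 1) • q.1.2.2.2) :=
    (continuous_proj hne hc hX).measurable.comp (hm.add (by fun_prop))
  unfold phaseStep
  refine Measurable.ite ?_ (Measurable.ite ?_ (measurable_const.prodMk hp) measurable_const)
    measurable_snd
  · have h1 : Measurable fun q : (PhaseData Z P i × PhaseNoise P) × (Bool × E d) => q.2.1 := by
      fun_prop
    exact h1 (measurableSet_singleton true)
  · exact measurableSet_le measurable_const hs

theorem measurable_stateAfter (hne : X.Nonempty) (hc : IsCompact X) (hX : Convex ℝ X)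
    {g : E d → Z → E d} (hg : Measurable (Function.uncurry g)) (x₀ : E d) (k : ℕ) (hk : k ≤ P.l) :
    Measurable fun q : ((i : Fin P.l) → PhaseData Z P i) × Noise P =>
      stateAfter X g x₀ q.1 q.2 k hk := by
  refine measurable_iterPhases (fun i => ?_) measurable_const hk
  have h1 : Measurable fun q : (((i : Fin P.l) → PhaseData Z P i) × Noise P) × (Bool × E d) =>
      ((q.1.1 i, q.1.2 i), q.2) := by fun_prop
  exact (measurable_phaseStep hne hc hX hg i).comp h1

instance isProbabilityMeasure_phaseNoiseLaw [hε : Fact (0 < P.ε)] :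
    IsProbabilityMeasure (phaseNoiseLaw P) := by
  have := isProbabilityMeasure_laplace (b := 20 / P.ε) (div_pos (by norm_num) hε.out)
  unfold phaseNoiseLaw
  infer_instance

/-- Changing the data of one group of one phase is private. -/
theorem stateAfter_private (hP : P.Valid) (hne : X.Nonempty) (hc : IsCompact X) (hX : Convex ℝ X)
    {g : E d → Z → E d} (hg : Measurable (Function.uncurry g)) (x₀ : E d)
    {w w' : (i : Fin P.l) → PhaseData Z P i} {i₀ : Fin P.l} {j₀ : Fin P.C}
    (hN : 0 < P.N (i₀ + 1)) (hw : ∀ i, i ≠ i₀ → w i = w' i)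
    (hw₀ : ∀ j, j ≠ j₀ → ∀ t, w i₀ (j, t) = w' i₀ (j, t)) {S : Set (E d)} (hS : MeasurableSet S) :
    noiseLaw P {ω | (stateAfter X g x₀ w ω P.l le_rfl).2 ∈ S} ≤
      ENNReal.ofReal (Real.exp P.ε) *
        noiseLaw P {ω | (stateAfter X g x₀ w' ω P.l le_rfl).2 ∈ S} + ENNReal.ofReal P.δ := by
  have : Fact (0 < P.ε) := ⟨hP.eps_pos⟩
  have hmeas : ∀ v : (i : Fin P.l) → PhaseData Z P i,
      MeasurableSet {ω : Noise P | (stateAfter X g x₀ v ω P.l le_rfl).2 ∈ S} := fun v => by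
    have h1 := (measurable_stateAfter hne hc hX hg x₀ P.l le_rfl).comp
      (measurable_prodMk_left (x := v))
    exact (measurable_snd.comp h1) hS
  have hup := measurePreserving_update (fun _ : Fin P.l => phaseNoiseLaw P) i₀
  -- The noise of phase `i₀` is redrawn independently, so that it can be integrated with the noise
  -- of all other phases frozen.
  have hI : ∀ v : (i : Fin P.l) → PhaseData Z P i,
      noiseLaw P {ω | (stateAfter X g x₀ v ω P.l le_rfl).2 ∈ S} =
      ∫⁻ ω, phaseNoiseLaw P {θ | (stateAfter X g x₀ v (Function.update ω i₀ θ) P.l le_rfl).2 ∈ S}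
        ∂noiseLaw P := by
    intro v
    unfold noiseLaw
    rw [← hup.measure_preimage (hmeas v).nullMeasurableSet,
      Measure.prod_apply (hup.measurable (hmeas v))]
    rfl
  have hmeasint : Measurable fun ω => phaseNoiseLaw P
      {θ | (stateAfter X g x₀ w' (Function.update ω i₀ θ) P.l le_rfl).2 ∈ S} :=
    measurable_measure_prodMk_left (hup.measurable (hmeas w'))
  have hpt : ∀ ω, phaseNoiseLaw P
      {θ | (stateAfter X g x₀ w (Function.update ω i₀ θ) P.l le_rfl).2 ∈ S} ≤
      ENNReal.ofReal (Real.exp P.ε) * phaseNoiseLaw P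
      {θ | (stateAfter X g x₀ w' (Function.update ω i₀ θ) P.l le_rfl).2 ∈ S} +
        ENNReal.ofReal P.δ := by
    intro ω
    -- The state `a` before the affected phase and the map `post` of the later phases are the same
    -- for both datasets; only the middle map sees the change.
    set a := stateAfter X g x₀ w ω i₀ i₀.isLt.le with ha
    set post : Bool × E d → Bool × E d := fun b =>
      iterPhases (Function.update (fun i => phaseStep X g i (w i) (ω i)) i₀ fun _ => b) (true, x₀)
        P.l le_rfl with hpost
    have hform : ∀ v : (i : Fin P.l) → PhaseData Z P i, (∀ i, i ≠ i₀ → w i = v i) → ∀ θ,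
        stateAfter X g x₀ v (Function.update ω i₀ θ) P.l le_rfl =
          post (phaseStep X g i₀ (v i₀) θ a) := by
      intro v hv θ
      unfold stateAfter
      rw [iterPhases_eq_update _ _ i₀ le_rfl, hpost]
      have e1 : iterPhases (fun i => phaseStep X g i (v i) (Function.update ω i₀ θ i)) (true, x₀)
          i₀ i₀.isLt.le = a := by
        rw [ha]
        unfold stateAfter
        refine iterPhases_congr _ _ fun i hi => ?_
        have hii : i ≠ i₀ := by rintro rfl; exact lt_irrefl _ hi
        rw [Function.update_of_ne hii, hv i hii]
      rw [e1, Function.update_self]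
      refine iterPhases_congr _ _ fun i _ => ?_
      by_cases hii : i = i₀
      · subst hii
        rw [Function.update_self, Function.update_self]
      · rw [Function.update_of_ne hii, Function.update_of_ne hii, Function.update_of_ne hii,
          hv i hii]
    have hpostm : Measurable post := by
      refine measurable_iterPhases (F := fun b => Function.update
        (fun i => phaseStep X g i (w i) (ω i)) i₀ fun _ => b) (fun i => ?_) measurable_const le_rfl
      by_cases hii : i = i₀
      · subst hii
        simp only [Function.update_self]
        exact measurable_fst
      · simp only [Function.update_of_ne hii]
        have h1 : Measurable fun q : (Bool × E d) × (Bool × E d) => ((w i, ω i), q.2) := by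
          fun_prop
        exact (measurable_phaseStep hne hc hX hg i).comp h1
    simp only [hform w fun _ _ => rfl, hform w' hw]
    obtain ⟨b, x⟩ := a
    cases b
    -- If the run has already halted, the affected phase does nothing and both outputs agree.
    · simp only [phaseStep, Bool.false_eq_true, if_false]
      refine le_add_right (le_mul_of_one_le_left zero_le ?_)
      rw [ENNReal.one_le_ofReal]
      exact Real.one_le_exp hP.eps_pos.le
    -- Projection and later phases are absorbed into an event about the perturbed mean:
    -- post-processing.
    · set B : Set (E d) := {u | (post (true, proj X u)).2 ∈ S} with hB
      have hBm : MeasurableSet B := by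
        have h1 : Measurable fun u : E d => (post (true, proj X u)).2 :=
          measurable_snd.comp (hpostm.comp (measurable_const.prodMk
            (continuous_proj hne hc hX).measurable))
        exact h1 hS
      have hset : ∀ v : PhaseData Z P i₀,
          {θ | (post (phaseStep X g i₀ v θ (true, x))).2 ∈ S} =
          {θ : PhaseNoise P | (4 * (P.C : ℝ) / 5 ≤
              concentrationScore (P.τ (i₀ + 1)) (groupAvgs X g i₀ v x) + θ.1 ∧
            keptMean (P.τ (i₀ + 1)) (groupAvgs X g i₀ v x) θ.2.1 + P.σ (i₀ + 1) • θ.2.2 ∈ B) ∨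
            (¬ 4 * (P.C : ℝ) / 5 ≤
              concentrationScore (P.τ (i₀ + 1)) (groupAvgs X g i₀ v x) + θ.1 ∧
              (post (false, proj X 0)).2 ∈ S)} := by
        intro v
        ext θ
        simp only [phaseStep, if_true, Set.mem_ofPred_eq, hB]
        by_cases h : 4 * (P.C : ℝ) / 5 ≤
              concentrationScore (P.τ (i₀ + 1)) (groupAvgs X g i₀ v x) + θ.1
        · simp [h]
        · simp [h]
      rw [hset, hset]
      refine phase_private (hP.phaseBudget (Nat.le_add_left 1 _) hN)
        (hP.tau_pos (Nat.le_add_left 1 _) hN) rfl (j₀ := j₀) (fun j hj => ?_) hBm _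
      unfold groupAvgs
      rw [funext (hw₀ j hj)]
  rw [hI w, hI w']
  calc _ ≤ _ := lintegral_mono hpt
    _ = _ := by
      have : IsProbabilityMeasure (noiseLaw P) := by unfold noiseLaw; infer_instance
      rw [lintegral_add_right _ measurable_const, lintegral_const_mul _ hmeasint, lintegral_const,
        measure_univ, mul_one]

/-- By injectivity of the schedule, the differing user sits in exactly one group of one phase, where
`stateAfter_private` applies, or in none, where the datasets are indistinguishable to the algorithm.
-/
theorem algorithm_private {f : E d → Z → ℝ} {G : E d → Z → E d} {Q : Measure Z} {R β : ℝ}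
    (hP : P.Valid) (h : IsSmoothSCO X f G Q P.L R β) (hβ : 0 ≤ β) (s : Schedule P) {x₀ : E d}
    (hx₀ : x₀ ∈ X) :
    IsUserLevelDP (noiseLaw P) (fun D ω => (algorithm P s X G x₀ D ω).val) P.ε P.δ := by
  have ht := h.isTame hP.L_pos.le hβ
  simp only [algorithm_val, stateAfter_reducedGrad h.nonempty h.compact h.convex G hx₀]
  refine ⟨fun D => ?_, ?_⟩
  · have h1 := (measurable_stateAfter (P := P) h.nonempty h.compact h.convex ht.measurable x₀ P.l
      le_rfl).comp (measurable_prodMk_left (x := s.read D))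
    exact measurable_snd.comp h1
  rintro D D' ⟨u, hu⟩ S hS
  by_cases hex : ∃ a : (Σ i : Fin P.l, Fin P.C × Fin (P.N (i + 1))), s.user a.1 a.2.1 a.2.2 = u
  · obtain ⟨⟨i₀, j₀, k₀⟩, ha⟩ := hex
    have hN : 0 < P.N (i₀ + 1) := k₀.pos
    refine stateAfter_private hP h.nonempty h.compact h.convex ht.measurable x₀ (i₀ := i₀)
      (j₀ := j₀) hN (fun i hi => ?_) (fun j hj t => ?_) hS
    · funext p
      unfold Schedule.read
      rw [hu]
      intro heq
      have := s.user_injective (a₁ := ⟨i, p.1, (s.order i p.1 p.2).1⟩) (a₂ := ⟨i₀, j₀, k₀⟩)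
        (heq.trans ha.symm)
      exact hi (congrArg Sigma.fst this)
    · unfold Schedule.read
      rw [hu]
      intro heq
      have := s.user_injective (a₁ := ⟨i₀, j, (s.order i₀ j t).1⟩) (a₂ := ⟨i₀, j₀, k₀⟩)
        (heq.trans ha.symm)
      simp only [Sigma.mk.injEq, heq_eq_eq, true_and, Prod.mk.injEq] at this
      exact hj this.1
  · push Not at hex
    have : s.read D = s.read D' := by
      funext i p
      unfold Schedule.read
      rw [hu _ (hex ⟨i, p.1, (s.order i p.1 p.2).1⟩)]
    simp only [this]
    refine le_add_right (le_mul_of_one_le_left zero_le ?_)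
    rw [ENNReal.one_le_ofReal]
    exact Real.one_le_exp hP.eps_pos.le

end Algorithm

end PhasedSGD

end

noncomputable section

namespace PhasedSGD

/-! ### The idealized phase and its failure probability -/

section Ideal

variable {d : ℕ} {Z : Type*} {P : Params d} {X : Set (E d)}

/-- The average over all groups of the average iterates of phase `i + 1`. -/
def meanAvg (X : Set (E d)) (g : E d → Z → E d) (i : Fin P.l) (w : PhaseData Z P i) (x : E d) :
    E d :=
  (P.C : ℝ)⁻¹ • ∑ j, groupAvgs X g i w x j

/-- Phase `i + 1` without test and selection: perturb the average over all groups. -/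
def idealStep (X : Set (E d)) (g : E d → Z → E d) (i : Fin P.l) (w : PhaseData Z P i)
    (ω : PhaseNoise P) (x : E d) : E d :=
  proj X (meanAvg X g i w x + P.σ (i + 1) • ω.2.2)

theorem meanAvg_mem (hC : 0 < P.C) (hne : X.Nonempty) (hc : IsCompact X) (hX : Convex ℝ X)
    (g : E d → Z → E d) (i : Fin P.l) (w : PhaseData Z P i) {x : E d} (hx : x ∈ X) :
    meanAvg X g i w x ∈ X := by
  have h := average_mem hX (s := (Finset.univ : Finset (Fin P.C))) ⟨⟨0, hC⟩, Finset.mem_univ _⟩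
    (y := groupAvgs X g i w x) fun j _ => sgdAvg_mem hne hc hX g _ _ hx
  rwa [Finset.card_univ, Fintype.card_fin] at h

theorem concentrationScore_eq_of_close {C : ℕ} {τ : ℝ} {y : Fin C → E d}
    (h : ∀ j j', ‖y j - y j'‖ ≤ τ) : concentrationScore τ y = C := by
  unfold concentrationScore
  simp only [h, if_true, Finset.sum_const, Finset.card_univ, Fintype.card_fin, nsmul_eq_mul,
    mul_one]
  rcases eq_or_ne (C : ℝ) 0 with h0 | h0
  · rw [h0]; simp
  · field_simp

/-- Full scores give keeping probability 1. Because selection is a strict comparison, the uniform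
variables must be strictly below 1, which fails only on a null set. -/
theorem kept_eq_univ_of_close {C : ℕ} {τ : ℝ} (hτ : 0 ≤ τ) {y : Fin C → E d}
    (h : ∀ j j', ‖y j - y j'‖ ≤ τ) {u : Fin C → ℝ} (hu : ∀ j, u j < 1) :
    kept τ y u = Finset.univ := by
  ext j
  have hC : 0 < C := j.pos
  have hC' : (0 : ℝ) < C := by exact_mod_cast hC
  have hs : score τ y j = C := by
    unfold score
    have : ∀ j', ‖y j - y j'‖ ≤ 2 * τ := fun j' => (h j j').trans (by linarith)
    simp [this]
  rw [mem_kept_iff, hs, keepProb_eq hC]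
  have : 6 / (C : ℝ) * C - 3 = 3 := by field_simp; norm_num
  rw [this]
  norm_num
  exact hu j

/-- Points within `τ / 2` of a common centre are pairwise within `τ`, so the score is `C`. The test
then fails only for Laplace noise below `-C / 5`, and no point is discarded. -/
theorem phaseStep_eq_of_close (g : E d → Z → E d) (i : Fin P.l) (w : PhaseData Z P i)
    {ω : PhaseNoise P} {x c : E d} (hτ : 0 ≤ P.τ (i + 1))
    (hy : ∀ j, ‖groupAvgs X g i w x j - c‖ ≤ P.τ (i + 1) / 2) (hω : -((P.C : ℝ) / 5) ≤ ω.1)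
    (hu : ∀ j, ω.2.1 j < 1) :
    phaseStep X g i w ω (true, x) = (true, idealStep X g i w ω x) := by
  have hclose : ∀ j j', ‖groupAvgs X g i w x j - groupAvgs X g i w x j'‖ ≤ P.τ (i + 1) := by
    intro j j'
    calc _ = ‖(groupAvgs X g i w x j - c) - (groupAvgs X g i w x j' - c)‖ := by congr 1; abel
      _ ≤ _ := (norm_sub_le _ _).trans (by linarith [hy j, hy j'])
  unfold phaseStep idealStep meanAvg
  rw [if_pos rfl, concentrationScore_eq_of_close hclose, if_pos (by linarith)]
  unfold keptMean
  rw [kept_eq_univ_of_close hτ hclose hu, Finset.card_univ, Fintype.card_fin]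

variable [MeasurableSpace Z]

/-- Law of the samples of phase `i + 1`. -/
abbrev phaseDataLaw (P : Params d) (Q : Measure Z) (i : Fin P.l) : Measure (PhaseData Z P i) :=
  Measure.pi fun _ => Q

theorem measurable_meanAvg (hne : X.Nonempty) (hc : IsCompact X) (hX : Convex ℝ X)
    {g : E d → Z → E d} (hg : Measurable (Function.uncurry g)) (i : Fin P.l) :
    Measurable fun q : PhaseData Z P i × E d => meanAvg X g i q.1 q.2 := by
  have h := measurable_groupAvgs hne hc hX hg i
  have h2 : Measurable fun q : PhaseData Z P i × E d => ∑ j, groupAvgs X g i q.1 q.2 j :=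
    Finset.measurable_sum _ fun j _ => (measurable_pi_apply j).comp h
  exact h2.const_smul (P.C : ℝ)⁻¹

theorem measurable_idealStep (hne : X.Nonempty) (hc : IsCompact X) (hX : Convex ℝ X)
    {g : E d → Z → E d} (hg : Measurable (Function.uncurry g)) (i : Fin P.l) :
    Measurable fun q : (PhaseData Z P i × PhaseNoise P) × E d =>
      idealStep X g i q.1.1 q.1.2 q.2 := by
  have h1 : Measurable fun q : (PhaseData Z P i × PhaseNoise P) × E d => (q.1.1, q.2) := by
    fun_prop
  have h2 := (measurable_meanAvg hne hc hX hg i).comp h1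
  have h3 : Measurable fun q : (PhaseData Z P i × PhaseNoise P) × E d =>
      meanAvg X g i q.1.1 q.2 := h2
  have h4 : Measurable fun q : (PhaseData Z P i × PhaseNoise P) × E d =>
      meanAvg X g i q.1.1 q.2 + P.σ (i + 1) • q.1.2.2.2 := h3.add (by fun_prop)
  exact (continuous_proj hne hc hX).measurable.comp h4

theorem selectLaw_exists_one_le (C : ℕ) : selectLaw C {u | ∃ j, 1 ≤ u j} = 0 := by
  have hset : {u : Fin C → ℝ | ∃ j, 1 ≤ u j} = ⋃ j, {u | 1 ≤ u j} := by ext; simp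
  rw [hset]
  refine measure_iUnion_null fun j => ?_
  have h := (measurePreserving_eval (fun _ : Fin C => volume.restrict (Set.Icc (0 : ℝ) 1)) j)
  have h2 := h.measure_preimage (s := Set.Ici 1) measurableSet_Ici.nullMeasurableSet
  refine h2.trans ?_
  rw [Measure.restrict_apply measurableSet_Ici]
  refine measure_mono_null (t := {1}) ?_ (by simp)
  rintro x ⟨hx1, hx2⟩
  exact le_antisymm hx2.2 hx1

variable {f : E d → Z → ℝ} {g : E d → Z → E d} {Q : Measure Z} [IsProbabilityMeasure Q] {R β : ℝ}

theorem tau_of_T_eq_zero {i : ℕ} (hT : P.T i = 0) : P.τ i = 0 := by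
  unfold Params.τ
  rw [hT]
  simp

/-- The probability that a phase deviates from the idealized phase. -/
theorem phaseStep_ne_idealStep_le (hP : P.Valid) (h : IsTame X f g Q P.L R β) (i : Fin P.l)
    (hηβ : P.step (i + 1) * β ≤ 1) {x : E d} (hx : x ∈ X) :
    ((phaseDataLaw P Q i).prod (phaseNoiseLaw P))
      {b | phaseStep X g i b.1 b.2 (true, x) ≠ (true, idealStep X g i b.1 b.2 x)} ≤
      ENNReal.ofReal (Real.exp (-(P.C * P.ε / 100))) +
        if P.T (i + 1) = 0 then 0 else P.C * ENNReal.ofReal (Real.exp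
          (1 - 31250 * Real.log ((P.n : ℝ) * d * P.m) ^ 2)) := by
  have hfact : Fact (0 < P.ε) := ⟨hP.eps_pos⟩
  have hlap := isProbabilityMeasure_laplace (b := 20 / P.ε) (div_pos (by norm_num) hP.eps_pos)
  have hC : (0 : ℝ) < P.C := by exact_mod_cast hP.C_pos
  have hε := hP.eps_pos
  have hnoise : phaseNoiseLaw P {θ | θ.1 < -((P.C : ℝ) / 5) ∨ ∃ j, 1 ≤ θ.2.1 j} ≤
      ENNReal.ofReal (Real.exp (-(P.C * P.ε / 100))) := by
    have hsub : {θ : PhaseNoise P | θ.1 < -((P.C : ℝ) / 5) ∨ ∃ j, 1 ≤ θ.2.1 j} ⊆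
        (Set.Iic (-((P.C : ℝ) / 5)) ×ˢ Set.univ) ∪
          (Set.univ ×ˢ ({u : Fin P.C → ℝ | ∃ j, 1 ≤ u j} ×ˢ Set.univ)) := by
      rintro θ (h1 | h1)
      · exact Or.inl ⟨h1.le, trivial⟩
      · exact Or.inr ⟨trivial, h1, trivial⟩
    refine (measure_mono hsub).trans ((measure_union_le _ _).trans ?_)
    have e : phaseNoiseLaw P = (laplace (20 / P.ε)).prod
      ((selectLaw P.C).prod (stdGaussian (E d))) := rfl
    rw [e, Measure.prod_prod, Measure.prod_prod, Measure.prod_prod, selectLaw_exists_one_le,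
      measure_univ, measure_univ, mul_one, zero_mul, mul_zero, add_zero]
    refine (laplace_Iic_le (div_pos (by norm_num) hε) (by positivity)).trans_eq ?_
    congr 2
    field_simp
    ring
  by_cases hT : P.T (i + 1) = 0
  · rw [if_pos hT, add_zero]
    -- Without samples all averages equal `x` exactly, so the radius 0 is enough and only the noise
    -- can cause a deviation.
    have hτ := tau_of_T_eq_zero hT
    have hsub : {b : PhaseData Z P i × PhaseNoise P | phaseStep X g i b.1 b.2 (true, x) ≠
          (true, idealStep X g i b.1 b.2 x)} ⊆
        Set.univ ×ˢ {θ : PhaseNoise P | θ.1 < -((P.C : ℝ) / 5) ∨ ∃ j, 1 ≤ θ.2.1 j} := by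
      intro b hb
      refine ⟨trivial, ?_⟩
      by_contra hcon
      simp only [Set.mem_ofPred_eq, not_or, not_exists, not_lt, not_le] at hcon
      refine hb (phaseStep_eq_of_close g i b.1 (c := x) hτ.ge (fun j => ?_) hcon.1 hcon.2)
      unfold groupAvgs sgdAvg
      rw [if_pos hT, hτ]
      simp
    refine (measure_mono hsub).trans ?_
    rw [Measure.prod_prod, measure_univ, one_mul]
    exact hnoise
  · rw [if_neg hT]
    have hN : 0 < P.N (i + 1) := by
      rcases Nat.eq_zero_or_pos (P.N (i + 1)) with h0 | h0
      · exact absurd (by unfold Params.T; rw [h0, zero_mul]) hT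
      · exact h0
    have hτ : 0 < P.τ (i + 1) := hP.tau_pos (Nat.le_add_left 1 _) hN
    have hη := hP.step_pos (i + 1)
    obtain ⟨c, hc⟩ := h.exists_sgdAvg_concentration hP.L_pos hη hηβ hT hx
    have hc' := hc (P.τ (i + 1) / 2) (by positivity)
    -- The constant is `500² / 8`: half of the factor 1000 in `τ`, squared, over the 8 of the
    -- concentration bound.
    have hexp : (P.τ (i + 1) / 2) ^ 2 / (8 * P.step (i + 1) ^ 2 * P.L ^ 2 * P.T (i + 1)) =
        31250 * Real.log ((P.n : ℝ) * d * P.m) ^ 2 := by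
      have hT0 : (0 : ℝ) < P.T (i + 1) := by exact_mod_cast Nat.pos_of_ne_zero hT
      have hL := hP.L_pos
      rw [div_eq_iff (by positivity)]
      unfold Params.τ
      rw [div_pow, mul_pow, mul_pow (1000 * P.step (i + 1) * P.L), Real.sq_sqrt hT0.le]
      ring
    rw [hexp] at hc'
    have hdata : phaseDataLaw P Q i
        {w | ∃ j, P.τ (i + 1) / 2 < ‖groupAvgs X g i w x j - c‖} ≤
        P.C * ENNReal.ofReal (Real.exp (1 - 31250 * Real.log ((P.n : ℝ) * d * P.m) ^ 2)) := by
      have hset : {w : PhaseData Z P i | ∃ j, P.τ (i + 1) / 2 < ‖groupAvgs X g i w x j - c‖} =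
          ⋃ j, {w | P.τ (i + 1) / 2 < ‖groupAvgs X g i w x j - c‖} := by ext; simp
      rw [hset]
      refine (measure_iUnion_fintype_le _ _).trans ?_
      refine (Finset.sum_le_sum (g := fun _ => ENNReal.ofReal (Real.exp (1 - 31250 *
        Real.log ((P.n : ℝ) * d * P.m) ^ 2))) fun j _ => ?_).trans (by simp)
      have hinj : Function.Injective fun t : Fin (P.T (i + 1)) => (j, t) := fun t t' htt =>
        (Prod.mk.inj htt).2
      have hmp := measurePreserving_select Q hinj
      have hms : MeasurableSet {w : Fin (P.T (i + 1)) → Z | P.τ (i + 1) / 2 <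
          ‖sgdAvg X g (P.step (i + 1)) (P.T (i + 1)) w x - c‖} := by
        have h1 := (measurable_sgdAvg h.nonempty h.compact h.convex h.measurable (P.step (i + 1))
          (P.T (i + 1))).comp (measurable_prodMk_right (y := x))
        exact measurableSet_lt measurable_const (h1.sub_const c).norm
      have h2 := hmp.measure_preimage hms.nullMeasurableSet
      refine le_trans (le_of_eq ?_) hc'
      rw [← h2]
      rfl
    have hsub : {b : PhaseData Z P i × PhaseNoise P | phaseStep X g i b.1 b.2 (true, x) ≠
          (true, idealStep X g i b.1 b.2 x)} ⊆
        (Set.univ ×ˢ {θ : PhaseNoise P | θ.1 < -((P.C : ℝ) / 5) ∨ ∃ j, 1 ≤ θ.2.1 j}) ∪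
        ({w | ∃ j, P.τ (i + 1) / 2 < ‖groupAvgs X g i w x j - c‖} ×ˢ Set.univ) := by
      intro b hb
      by_contra hcon
      simp only [Set.mem_union, Set.mem_prod, Set.mem_univ, true_and, and_true,
        Set.mem_ofPred_eq, not_or, not_exists, not_lt, not_le] at hcon
      exact hb (phaseStep_eq_of_close g i b.1 (c := c) hτ.le hcon.2 hcon.1.1 hcon.1.2)
    refine (measure_mono hsub).trans ((measure_union_le _ _).trans ?_)
    rw [Measure.prod_prod, Measure.prod_prod, measure_univ, measure_univ, one_mul, mul_one]
    exact add_le_add hnoise hdata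

/-- Excess loss over the level `c`, as an extended nonnegative real. -/
def excess (X : Set (E d)) (f : E d → Z → ℝ) (Q : Measure Z) (c : ℝ) (x : E d) : ENNReal :=
  ENNReal.ofReal (popLoss f Q (proj X x) - c)

theorem measurable_excess (h : IsTame X f g Q P.L R β) (c : ℝ) : Measurable (excess X f Q c) := by
  have h1 := h.continuous_popLoss_proj.measurable
  exact (h1.sub_const c).ennreal_ofReal

omit [IsProbabilityMeasure Q] in
theorem excess_of_mem (h : IsTame X f g Q P.L R β) (c : ℝ) {x : E d} (hx : x ∈ X) :
    excess X f Q c x = ENNReal.ofReal (popLoss f Q x - c) := by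
  unfold excess
  rw [proj_of_mem h.nonempty h.compact h.convex hx]

theorem excess_le_add (h : IsTame X f g Q P.L R β) (c : ℝ) {x y : E d} (hx : x ∈ X) (hy : y ∈ X) :
    excess X f Q c x ≤ excess X f Q c y + ENNReal.ofReal (P.L * ‖x - y‖) := by
  rw [excess_of_mem h c hx, excess_of_mem h c hy]
  refine (ENNReal.ofReal_le_ofReal ?_).trans ENNReal.ofReal_add_le
  have := (abs_le.1 (h.abs_popLoss_sub_le hx hy)).2
  linarith

/-- The regret bound for extended nonnegative excess. As `c` bounds the loss on `X` from below,
nothing is lost by `ENNReal.ofReal`, and the bound can be integrated over comparators that depend on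
earlier phases. -/
theorem lintegral_excess_sgdAvg_le (h : IsTame X f g Q P.L R β) {c : ℝ}
    (hc : ∀ z ∈ X, c ≤ popLoss f Q z) {η : ℝ} (hη : 0 < η) {T : ℕ} (hT : T ≠ 0) {x y : E d}
    (hx : x ∈ X) (hy : y ∈ X) :
    ∫⁻ w, excess X f Q c (sgdAvg X g η T w x) ∂(Measure.pi fun _ => Q) ≤
      excess X f Q c y + ENNReal.ofReal (‖x - y‖ ^ 2 / (2 * η * T)) +
        ENNReal.ofReal (η * P.L ^ 2 / 2) := by
  have hmem : ∀ w, sgdAvg X g η T w x ∈ X := fun w =>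
    sgdAvg_mem h.nonempty h.compact h.convex g η w hx
  have hm : Measurable fun w : Fin T → Z => sgdAvg X g η T w x := by
    have h1 := (measurable_sgdAvg h.nonempty h.compact h.convex h.measurable η T).comp
      (measurable_prodMk_right (y := x))
    exact h1
  have hmF : Measurable fun w : Fin T → Z => popLoss f Q (sgdAvg X g η T w x) := by
    have h1 : Measurable fun w : Fin T → Z => popLoss f Q (proj X (sgdAvg X g η T w x)) :=
      h.continuous_popLoss_proj.measurable.comp hm
    simpa only [fun w => proj_of_mem h.nonempty h.compact h.convex (hmem w)] using h1
  have hI : Integrable (fun w : Fin T → Z => popLoss f Q (sgdAvg X g η T w x))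
      (Measure.pi fun _ => Q) := by
    refine Integrable.of_bound hmF.aestronglyMeasurable (|popLoss f Q x| + P.L * R)
      (Filter.Eventually.of_forall fun w => ?_)
    rw [Real.norm_eq_abs]
    have h1 := h.abs_popLoss_sub_le (hmem w) hx
    have h2 := h.diam _ (hmem w) _ hx
    have h3 := abs_add_le (popLoss f Q (sgdAvg X g η T w x) - popLoss f Q x) (popLoss f Q x)
    rw [sub_add_cancel] at h3
    nlinarith [h.nonneg]
  simp only [fun w => excess_of_mem h c (hmem w)]
  have hI' : Integrable (fun w : Fin T → Z => popLoss f Q (sgdAvg X g η T w x) - c)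
      (Measure.pi fun _ => Q) := hI.sub (integrable_const c)
  rw [← ofReal_integral_eq_lintegral_ofReal hI'
    (Filter.Eventually.of_forall fun w => sub_nonneg.2 (hc _ (hmem w)))]
  rw [integral_sub hI (integrable_const c), excess_of_mem h c hy]
  refine (ENNReal.ofReal_le_ofReal ?_).trans (ENNReal.ofReal_add_le.trans
    (add_le_add ENNReal.ofReal_add_le le_rfl))
  have := h.integral_popLoss_sgdAvg_le hη hT hx hy
  simp only [integral_const, probReal_univ, one_smul]
  linarith

/-- By convexity, averaging over the groups preserves the bound that each group satisfies on its own
samples. -/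
theorem lintegral_excess_meanAvg_le (hP : P.Valid) (h : IsTame X f g Q P.L R β) {c : ℝ}
    (hc : ∀ z ∈ X, c ≤ popLoss f Q z) (i : Fin P.l) (hT : P.T (i + 1) ≠ 0) {x y : E d}
    (hx : x ∈ X) (hy : y ∈ X) :
    ∫⁻ w, excess X f Q c (meanAvg X g i w x) ∂(phaseDataLaw P Q i) ≤
      excess X f Q c y + ENNReal.ofReal (‖x - y‖ ^ 2 / (2 * P.step (i + 1) * P.T (i + 1))) +
        ENNReal.ofReal (P.step (i + 1) * P.L ^ 2 / 2) := by
  have hC : (0 : ℝ) < P.C := by exact_mod_cast hP.C_pos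
  have hmem : ∀ w j, groupAvgs X g i w x j ∈ X := fun w j =>
    sgdAvg_mem h.nonempty h.compact h.convex g _ _ hx
  set bound := excess X f Q c y +
    ENNReal.ofReal (‖x - y‖ ^ 2 / (2 * P.step (i + 1) * P.T (i + 1))) +
        ENNReal.ofReal (P.step (i + 1) * P.L ^ 2 / 2) with hbound
  have hpt : ∀ w, excess X f Q c (meanAvg X g i w x) ≤
      ∑ j, ENNReal.ofReal ((P.C : ℝ)⁻¹) * excess X f Q c (groupAvgs X g i w x j) := by
    intro w
    rw [excess_of_mem h c (meanAvg_mem hP.C_pos h.nonempty h.compact h.convex g i w hx)]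
    have hj := h.convexOn_popLoss.map_sum_le (t := Finset.univ)
      (w := fun _ : Fin P.C => (P.C : ℝ)⁻¹)
      (p := groupAvgs X g i w x) (fun _ _ => by positivity) (by simp [hC.ne'])
      (fun j _ => hmem w j)
    have e : meanAvg X g i w x = ∑ j, (P.C : ℝ)⁻¹ • groupAvgs X g i w x j := by
      unfold meanAvg
      rw [Finset.smul_sum]
    rw [← e] at hj
    simp only [excess_of_mem h c (hmem w _)]
    simp only [← ENNReal.ofReal_mul (inv_nonneg.2 hC.le)]
    rw [← ENNReal.ofReal_sum_of_nonneg fun j _ =>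
      mul_nonneg (inv_nonneg.2 hC.le) (sub_nonneg.2 (hc _ (hmem w j)))]
    refine ENNReal.ofReal_le_ofReal ?_
    simp only [mul_sub, Finset.sum_sub_distrib, Finset.sum_const, Finset.card_univ,
      Fintype.card_fin, nsmul_eq_mul, mul_inv_cancel_left₀ hC.ne']
    simp only [smul_eq_mul] at hj
    linarith
  have hmeas : ∀ j, Measurable fun w : PhaseData Z P i =>
      excess X f Q c (groupAvgs X g i w x j) := by
    intro j
    have h1 := (measurable_groupAvgs h.nonempty h.compact h.convex h.measurable i).comp
      (measurable_prodMk_right (y := x))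
    exact (measurable_excess h c).comp ((measurable_pi_apply j).comp h1)
  have hj : ∀ j, ∫⁻ w, excess X f Q c (groupAvgs X g i w x j) ∂(phaseDataLaw P Q i) ≤ bound := by
    intro j
    have hinj : Function.Injective fun t : Fin (P.T (i + 1)) => (j, t) := fun t t' htt =>
      (Prod.mk.inj htt).2
    have hmp := measurePreserving_select Q hinj
    have hm : Measurable fun w : Fin (P.T (i + 1)) → Z =>
        excess X f Q c (sgdAvg X g (P.step (i + 1)) (P.T (i + 1)) w x) := by
      have h1 := (measurable_sgdAvg h.nonempty h.compact h.convex h.measurable (P.step (i + 1))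
          (P.T (i + 1))).comp (measurable_prodMk_right (y := x))
      exact (measurable_excess h c).comp h1
    have h2 := hmp.lintegral_comp hm
    exact (le_of_eq h2).trans (lintegral_excess_sgdAvg_le h hc (hP.step_pos _) hT hx hy)
  calc ∫⁻ w, excess X f Q c (meanAvg X g i w x) ∂(phaseDataLaw P Q i)
      ≤ ∫⁻ w, ∑ j, ENNReal.ofReal ((P.C : ℝ)⁻¹) * excess X f Q c (groupAvgs X g i w x j)
        ∂(phaseDataLaw P Q i) := lintegral_mono hpt
    _ = ∑ j, ENNReal.ofReal ((P.C : ℝ)⁻¹) * ∫⁻ w, excess X f Q c (groupAvgs X g i w x j)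
        ∂(phaseDataLaw P Q i) := by
        rw [lintegral_finsetSum _ fun j _ => (hmeas j).const_mul _]
        exact Finset.sum_congr rfl fun j _ => lintegral_const_mul _ (hmeas j)
    _ ≤ ∑ _j : Fin P.C, ENNReal.ofReal ((P.C : ℝ)⁻¹) * bound := by
        gcongr with j _
        exact hj j
    _ = bound := by
        rw [Finset.sum_const, Finset.card_univ, Fintype.card_fin, nsmul_eq_mul, ← mul_assoc,
          ← ENNReal.ofReal_natCast, ← ENNReal.ofReal_mul hC.le, mul_inv_cancel₀ hC.ne']
        simp

omit [IsProbabilityMeasure Q] in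
-- The unperturbed mean lies in `X`, so projecting the perturbed point back does not move it further
-- away.
theorem norm_idealStep_sub_meanAvg_le (hP : P.Valid) (h : IsTame X f g Q P.L R β) (i : Fin P.l)
    (w : PhaseData Z P i) (ω : PhaseNoise P) {x : E d} (hx : x ∈ X) :
    ‖idealStep X g i w ω x - meanAvg X g i w x‖ ≤ |P.σ (i + 1)| * ‖ω.2.2‖ := by
  refine (norm_proj_sub_le h.nonempty h.compact h.convex _
    (meanAvg_mem hP.C_pos h.nonempty h.compact h.convex g i w hx)).trans ?_
  rw [add_sub_cancel_left, norm_smul, Real.norm_eq_abs]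

end Ideal

end PhasedSGD

end

noncomputable section

namespace PhasedSGD

/-! ### The chain of idealized phases -/

section Chain

variable {d : ℕ} {Z : Type*} {P : Params d} {X : Set (E d)}

/-- The point reached after `k` idealized phases. -/
def idealAfter (X : Set (E d)) (g : E d → Z → E d) (x₀ : E d)
    (a : ((i : Fin P.l) → PhaseData Z P i) × Noise P) (k : ℕ) (hk : k ≤ P.l) : E d :=
  iterPhases (fun i => idealStep X g i (a.1 i) (a.2 i)) x₀ k hk

/-- The unperturbed mean computed by the idealized phase with index `k`. -/
def idealMean (X : Set (E d)) (g : E d → Z → E d) (x₀ : E d)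
    (a : ((i : Fin P.l) → PhaseData Z P i) × Noise P) (k : ℕ) (hk : k < P.l) : E d :=
  meanAvg X g ⟨k, hk⟩ (a.1 ⟨k, hk⟩) (idealAfter X g x₀ a k hk.le)

theorem idealAfter_zero (X : Set (E d)) (g : E d → Z → E d) (x₀ : E d)
    (a : ((i : Fin P.l) → PhaseData Z P i) × Noise P) (hk : 0 ≤ P.l) :
    idealAfter X g x₀ a 0 hk = x₀ := rfl

theorem idealAfter_succ (X : Set (E d)) (g : E d → Z → E d) (x₀ : E d)
    (a : ((i : Fin P.l) → PhaseData Z P i) × Noise P) (k : ℕ) (hk : k + 1 ≤ P.l) :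
    idealAfter X g x₀ a (k + 1) hk = idealStep X g ⟨k, hk⟩ (a.1 ⟨k, hk⟩) (a.2 ⟨k, hk⟩)
      (idealAfter X g x₀ a k (Nat.le_of_succ_le hk)) := rfl

theorem idealAfter_mem (hne : X.Nonempty) (hc : IsCompact X) (g : E d → Z → E d) {x₀ : E d}
    (hx₀ : x₀ ∈ X) (a : ((i : Fin P.l) → PhaseData Z P i) × Noise P) (k : ℕ) (hk : k ≤ P.l) :
    idealAfter X g x₀ a k hk ∈ X := by
  cases k with
  | zero => rwa [idealAfter_zero]
  | succ k =>
    rw [idealAfter_succ]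
    exact proj_mem hne hc _

theorem idealAfter_update (g : E d → Z → E d) (x₀ : E d)
    (a : ((i : Fin P.l) → PhaseData Z P i) × Noise P) {k : ℕ} (hk : k ≤ P.l) {i : Fin P.l}
    (hi : k ≤ i) (v : PhaseData Z P i) (θ : PhaseNoise P) :
    idealAfter X g x₀ (Function.update a.1 i v, Function.update a.2 i θ) k hk =
      idealAfter X g x₀ a k hk := by
  unfold idealAfter
  refine iterPhases_congr _ _ fun j hj => ?_
  have hji : j ≠ i := by rintro rfl; omega
  simp only [Function.update_of_ne hji]

/-- Phases without samples do not move the point. -/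
theorem idealAfter_succ_of_T_eq_zero (hP : P.Valid) (hne : X.Nonempty) (hc : IsCompact X)
    (hX : Convex ℝ X) (g : E d → Z → E d) {x₀ : E d} (hx₀ : x₀ ∈ X)
    (a : ((i : Fin P.l) → PhaseData Z P i) × Noise P) (k : ℕ) (hk : k + 1 ≤ P.l)
    (hT : P.T (k + 1) = 0) :
    idealAfter X g x₀ a (k + 1) hk = idealAfter X g x₀ a k (Nat.le_of_succ_le hk) := by
  have hC : (P.C : ℝ) ≠ 0 := by exact_mod_cast hP.C_pos.ne'
  have hσ : P.σ (k + 1) = 0 := by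
    unfold Params.σ
    rw [tau_of_T_eq_zero hT]
    simp
  have hmem := idealAfter_mem hne hc g hx₀ a k (Nat.le_of_succ_le hk)
  rw [idealAfter_succ]
  generalize idealAfter X g x₀ a k (Nat.le_of_succ_le hk) = x at *
  unfold idealStep meanAvg groupAvgs sgdAvg
  simp only [hT, if_true, hσ, zero_smul, add_zero, Finset.sum_const, Finset.card_univ,
    Fintype.card_fin]
  rw [← Nat.cast_smul_eq_nsmul ℝ, smul_smul, inv_mul_cancel₀ hC, one_smul]
  exact proj_of_mem hne hc hX hmem

theorem idealAfter_eq_of_inactive (hP : P.Valid) (hne : X.Nonempty) (hc : IsCompact X)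
    (hX : Convex ℝ X) (g : E d → Z → E d) {x₀ : E d} (hx₀ : x₀ ∈ X)
    (a : ((i : Fin P.l) → PhaseData Z P i) × Noise P) {k₀ k : ℕ} (hk₀ : k₀ ≤ k) (hk : k ≤ P.l)
    (hT : ∀ j, k₀ ≤ j → j < k → P.T (j + 1) = 0) :
    idealAfter X g x₀ a k hk = idealAfter X g x₀ a k₀ (hk₀.trans hk) := by
  induction k, hk₀ using Nat.le_induction with
  | base => rfl
  | succ k hkk ih =>
    rw [idealAfter_succ_of_T_eq_zero hP hne hc hX g hx₀ a k hk (hT k hkk (Nat.lt_succ_self k))]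
    exact ih _ fun j h1 h2 => hT j h1 (Nat.lt_succ_of_lt h2)

variable [MeasurableSpace Z]

/-- Law of all samples and all noise. -/
def fullLaw (P : Params d) (Q : Measure Z) :
    Measure (((i : Fin P.l) → PhaseData Z P i) × Noise P) :=
  (Measure.pi fun i => phaseDataLaw P Q i).prod (noiseLaw P)

theorem measurable_idealAfter (hne : X.Nonempty) (hc : IsCompact X) (hX : Convex ℝ X)
    {g : E d → Z → E d} (hg : Measurable (Function.uncurry g)) (x₀ : E d) (k : ℕ) (hk : k ≤ P.l) :
    Measurable fun a : ((i : Fin P.l) → PhaseData Z P i) × Noise P =>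
      idealAfter X g x₀ a k hk := by
  refine measurable_iterPhases (fun i => ?_) measurable_const hk
  have h1 : Measurable fun q : (((i : Fin P.l) → PhaseData Z P i) × Noise P) × E d =>
      ((q.1.1 i, q.1.2 i), q.2) := by fun_prop
  have h2 := (measurable_idealStep hne hc hX hg i).comp h1
  exact h2

variable {f : E d → Z → ℝ} {g : E d → Z → E d} {Q : Measure Z} [IsProbabilityMeasure Q] {R β : ℝ}

instance isProbabilityMeasure_noiseLaw [Fact (0 < P.ε)] : IsProbabilityMeasure (noiseLaw P) := by
  unfold noiseLaw; infer_instance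

instance isProbabilityMeasure_fullLaw [Fact (0 < P.ε)] : IsProbabilityMeasure (fullLaw P Q) := by
  unfold fullLaw; infer_instance

/-- The samples and the noise of a phase are independent of everything that does not depend on
them. -/
theorem lintegral_fullLaw_fresh [Fact (0 < P.ε)] (i : Fin P.l) {S : Type*} [MeasurableSpace S]
    {Y : ((i : Fin P.l) → PhaseData Z P i) × Noise P → S} (hY : Measurable Y)
    (hYi : ∀ a v θ, Y (Function.update a.1 i v, Function.update a.2 i θ) = Y a)
    {h : S × (PhaseData Z P i × PhaseNoise P) → ENNReal} (hh : Measurable h) :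
    ∫⁻ a, h (Y a, (a.1 i, a.2 i)) ∂fullLaw P Q =
      ∫⁻ a, ∫⁻ b, h (Y a, b) ∂((phaseDataLaw P Q i).prod (phaseNoiseLaw P)) ∂fullLaw P Q := by
  have hmp := measurePreserving_update_prod (fun i : Fin P.l => phaseDataLaw P Q i)
    (fun _ : Fin P.l => phaseNoiseLaw P) i
  have hm : Measurable fun a : ((i : Fin P.l) → PhaseData Z P i) × Noise P =>
      h (Y a, (a.1 i, a.2 i)) :=
    hh.comp (hY.prodMk (((measurable_pi_apply i).comp measurable_fst).prodMk
      ((measurable_pi_apply i).comp measurable_snd)))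
  have h1 := hmp.lintegral_comp hm
  simp only [Function.update_self, hYi] at h1
  have h2 : Measurable fun q : (((i : Fin P.l) → PhaseData Z P i) × Noise P) ×
      (PhaseData Z P i × PhaseNoise P) => h (Y q.1, q.2) :=
    hh.comp ((hY.comp measurable_fst).prodMk measurable_snd)
  refine h1.symm.trans ?_
  exact lintegral_prod _ h2.aemeasurable

theorem lintegral_fullLaw_gaussian [Fact (0 < P.ε)] (i : Fin P.l) {h : E d → ENNReal}
    (hh : Measurable h) :
    ∫⁻ a, h (a.2 i).2.2 ∂fullLaw P Q = ∫⁻ ξ, h ξ ∂stdGaussian (E d) := by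
  have hε : 0 < P.ε := Fact.out
  have hlap := isProbabilityMeasure_laplace (b := 20 / P.ε) (div_pos (by norm_num) hε)
  have h1 : MeasurePreserving (Prod.snd : ((i : Fin P.l) → PhaseData Z P i) × Noise P → Noise P)
      (fullLaw P Q) (noiseLaw P) := measurePreserving_snd
  have h2 : MeasurePreserving (fun ω : Noise P => ω i) (noiseLaw P) (phaseNoiseLaw P) :=
    measurePreserving_eval _ i
  have h3 : MeasurePreserving (Prod.snd : PhaseNoise P → (Fin P.C → ℝ) × E d) (phaseNoiseLaw P)
      ((Measure.pi fun _ => volume.restrict (Set.Icc (0 : ℝ) 1)).prod (stdGaussian (E d))) :=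
    measurePreserving_snd
  have h4 : MeasurePreserving (Prod.snd : (Fin P.C → ℝ) × E d → E d)
      ((Measure.pi fun _ => volume.restrict (Set.Icc (0 : ℝ) 1)).prod (stdGaussian (E d)))
      (stdGaussian (E d)) := measurePreserving_snd
  exact (((h4.comp h3).comp h2).comp h1).lintegral_comp hh

theorem lintegral_norm_sq_gaussian (d : ℕ) :
    ∫⁻ ξ, ENNReal.ofReal (‖ξ‖ ^ 2) ∂stdGaussian (E d) = ENNReal.ofReal d := by
  rw [← ofReal_integral_eq_lintegral_ofReal integrable_norm_sq_stdGaussian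
    (Filter.Eventually.of_forall fun ξ => by positivity), integral_norm_sq_stdGaussian]

/-- Pointwise `‖ξ‖ ≤ ‖ξ‖² / (2√d) + √d / 2`, by completing a square, reduces the first moment to the
second. -/
theorem lintegral_norm_gaussian_le {d : ℕ} (hd : 1 ≤ d) :
    ∫⁻ ξ, ENNReal.ofReal ‖ξ‖ ∂stdGaussian (E d) ≤ ENNReal.ofReal (Real.sqrt d) := by
  have hd' : (0 : ℝ) < d := by exact_mod_cast hd
  have hs : 0 < Real.sqrt d := Real.sqrt_pos.2 hd'
  have hss : Real.sqrt d * Real.sqrt d = d := Real.mul_self_sqrt hd'.le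
  have hpt : ∀ ξ : E d, ENNReal.ofReal ‖ξ‖ ≤
      ENNReal.ofReal (1 / (2 * Real.sqrt d)) * ENNReal.ofReal (‖ξ‖ ^ 2) +
        ENNReal.ofReal (Real.sqrt d / 2) := by
    intro ξ
    rw [← ENNReal.ofReal_mul (by positivity), ← ENNReal.ofReal_add (by positivity) (by positivity)]
    refine ENNReal.ofReal_le_ofReal ?_
    rw [← sub_nonneg]
    have : 1 / (2 * Real.sqrt d) * ‖ξ‖ ^ 2 + Real.sqrt d / 2 - ‖ξ‖ =
        (‖ξ‖ - Real.sqrt d) ^ 2 / (2 * Real.sqrt d) := by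
      field_simp
      ring
    rw [this]
    positivity
  refine (lintegral_mono hpt).trans ?_
  rw [lintegral_add_right _ measurable_const, lintegral_const_mul _ (by fun_prop),
    lintegral_norm_sq_gaussian, lintegral_const, measure_univ, mul_one,
    ← ENNReal.ofReal_mul (by positivity), ← ENNReal.ofReal_add (by positivity) (by positivity)]
  refine ENNReal.ofReal_le_ofReal (le_of_eq ?_)
  field_simp
  nlinarith

theorem lintegral_excess_idealMean_zero_le (hP : P.Valid) (h : IsTame X f g Q P.L R β)
    {x₀ y : E d} (hx₀ : x₀ ∈ X) (hy : y ∈ X) (hmin : ∀ z ∈ X, popLoss f Q y ≤ popLoss f Q z)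
    (hl : 0 < P.l) (hT : P.T 1 ≠ 0) :
    ∫⁻ a, excess X f Q (popLoss f Q y) (idealMean X g x₀ a 0 hl) ∂fullLaw P Q ≤
      ENNReal.ofReal (R ^ 2 / (2 * P.step 1 * P.T 1)) +
        ENNReal.ofReal (P.step 1 * P.L ^ 2 / 2) := by
  have hfact : Fact (0 < P.ε) := ⟨hP.eps_pos⟩
  set c := popLoss f Q y with hc
  have hm : Measurable fun w : PhaseData Z P ⟨0, hl⟩ =>
      excess X f Q c (meanAvg X g ⟨0, hl⟩ w x₀) := by
    have h1 := (measurable_meanAvg h.nonempty h.compact h.convex h.measurable ⟨0, hl⟩).comp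
      (measurable_prodMk_right (y := x₀))
    exact (measurable_excess h c).comp h1
  have h1 : MeasurePreserving (Prod.fst : ((i : Fin P.l) → PhaseData Z P i) × Noise P → _)
      (fullLaw P Q) (Measure.pi fun i => phaseDataLaw P Q i) := measurePreserving_fst
  have h2 := measurePreserving_eval (fun i : Fin P.l => phaseDataLaw P Q i) ⟨0, hl⟩
  have h3 := (h2.comp h1).lintegral_comp hm
  have h4 := lintegral_excess_meanAvg_le hP h hmin ⟨0, hl⟩ hT hx₀ hy
  have h5 : excess X f Q c y = 0 := by
    rw [excess_of_mem h c hy, hc, sub_self, ENNReal.ofReal_zero]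
  have hη := hP.step_pos 1
  have hd := h.diam x₀ hx₀ y hy
  have h6 : ‖x₀ - y‖ ^ 2 / (2 * P.step 1 * P.T 1) ≤ R ^ 2 / (2 * P.step 1 * P.T 1) := by
    gcongr
  have h7 := (le_of_eq h3).trans h4
  rw [h5] at h7
  refine h7.trans (add_le_add ?_ le_rfl)
  refine (zero_add (ENNReal.ofReal (‖x₀ - y‖ ^ 2 / (2 * P.step 1 * P.T 1)))).le.trans ?_
  exact ENNReal.ofReal_le_ofReal h6

/-- The comparator is the unperturbed mean of the previous phase, and the start is that mean plus
noise. The initial distance in the regret bound is thus pure Gaussian noise, which enters squared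
with mean `σ² d`. The comparator is random but independent of the fresh samples. -/
theorem lintegral_excess_idealMean_succ_le (hP : P.Valid) (h : IsTame X f g Q P.L R β)
    {x₀ : E d} {c : ℝ} (hx₀ : x₀ ∈ X) (hmin : ∀ z ∈ X, c ≤ popLoss f Q z)
    {k : ℕ} (hk : k + 1 < P.l) (hT : P.T (k + 2) ≠ 0) :
    ∫⁻ a, excess X f Q c (idealMean X g x₀ a (k + 1) hk) ∂fullLaw P Q ≤
      ∫⁻ a, excess X f Q c (idealMean X g x₀ a k (Nat.lt_of_succ_lt hk)) ∂fullLaw P Q +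
        ENNReal.ofReal (P.σ (k + 1) ^ 2 * d / (2 * P.step (k + 2) * P.T (k + 2))) +
        ENNReal.ofReal (P.step (k + 2) * P.L ^ 2 / 2) := by
  have hfact : Fact (0 < P.ε) := ⟨hP.eps_pos⟩
  have hη := hP.step_pos (k + 2)
  have hT0 : (0 : ℝ) < P.T (k + 2) := by exact_mod_cast Nat.pos_of_ne_zero hT
  set i : Fin P.l := ⟨k + 1, hk⟩ with hi
  have hk' : k < P.l := Nat.lt_of_succ_lt hk
  set Y : ((i : Fin P.l) → PhaseData Z P i) × Noise P → E d := fun a =>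
    idealAfter X g x₀ a (k + 1) hk.le with hYdef
  have hYm : Measurable Y := measurable_idealAfter h.nonempty h.compact h.convex h.measurable x₀ _ _
  have hYi : ∀ a v θ, Y (Function.update a.1 i v, Function.update a.2 i θ) = Y a := fun a v θ =>
    idealAfter_update g x₀ a hk.le le_rfl v θ
  have hhm : Measurable fun q : E d × (PhaseData Z P i × PhaseNoise P) =>
      excess X f Q c (meanAvg X g i q.2.1 q.1) := by
    have h1 : Measurable fun q : E d × (PhaseData Z P i × PhaseNoise P) => (q.2.1, q.1) := by
      fun_prop
    have h2 := (measurable_meanAvg h.nonempty h.compact h.convex h.measurable i).comp h1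
    have h3 := (measurable_excess h c).comp h2
    exact h3
  have hfresh := lintegral_fullLaw_fresh (Q := Q) i hYm hYi hhm
  have hlhs : ∫⁻ a, excess X f Q c (idealMean X g x₀ a (k + 1) hk) ∂fullLaw P Q =
      ∫⁻ a, ∫⁻ b, excess X f Q c (meanAvg X g i b.1 (Y a))
        ∂((phaseDataLaw P Q i).prod (phaseNoiseLaw P)) ∂fullLaw P Q := hfresh
  rw [hlhs]
  have hpt : ∀ a, ∫⁻ b, excess X f Q c (meanAvg X g i b.1 (Y a))
        ∂((phaseDataLaw P Q i).prod (phaseNoiseLaw P)) ≤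
      excess X f Q c (idealMean X g x₀ a k hk') +
        ENNReal.ofReal (P.σ (k + 1) ^ 2 / (2 * P.step (k + 2) * P.T (k + 2))) *
          ENNReal.ofReal (‖(a.2 ⟨k, hk'⟩).2.2‖ ^ 2) +
        ENNReal.ofReal (P.step (k + 2) * P.L ^ 2 / 2) := by
    intro a
    have hYa : Y a ∈ X := idealAfter_mem h.nonempty h.compact g hx₀ a _ _
    have hMa : idealMean X g x₀ a k hk' ∈ X :=
      meanAvg_mem hP.C_pos h.nonempty h.compact h.convex g _ _
        (idealAfter_mem h.nonempty h.compact g hx₀ a _ _)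
    have hm : Measurable fun w : PhaseData Z P i => excess X f Q c (meanAvg X g i w (Y a)) := by
      have h1 := (measurable_meanAvg h.nonempty h.compact h.convex h.measurable i).comp
        (measurable_prodMk_right (y := Y a))
      exact (measurable_excess h c).comp h1
    have h1 : MeasurePreserving (Prod.fst : PhaseData Z P i × PhaseNoise P → PhaseData Z P i)
      ((phaseDataLaw P Q i).prod (phaseNoiseLaw P)) (phaseDataLaw P Q i) := measurePreserving_fst
    have h2 := h1.lintegral_comp hm
    rw [h2]
    refine (lintegral_excess_meanAvg_le hP h hmin i hT hYa hMa).trans ?_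
    refine add_le_add (add_le_add le_rfl ?_) le_rfl
    rw [← ENNReal.ofReal_mul (by positivity)]
    refine ENNReal.ofReal_le_ofReal ?_
    have hn : ‖Y a - idealMean X g x₀ a k hk'‖ ≤ |P.σ (k + 1)| * ‖(a.2 ⟨k, hk'⟩).2.2‖ :=
      norm_idealStep_sub_meanAvg_le hP h ⟨k, hk'⟩ _ _
        (idealAfter_mem h.nonempty h.compact g hx₀ a _ _)
    have hn2 : ‖Y a - idealMean X g x₀ a k hk'‖ ^ 2 ≤
        P.σ (k + 1) ^ 2 * ‖(a.2 ⟨k, hk'⟩).2.2‖ ^ 2 := by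
      rw [← sq_abs (P.σ (k + 1)), ← mul_pow]
      gcongr
    calc _ ≤ P.σ (k + 1) ^ 2 * ‖(a.2 ⟨k, hk'⟩).2.2‖ ^ 2 / (2 * P.step (k + 2) * P.T (k + 2)) := by
          gcongr ?_ / _
      _ = _ := by ring
  refine (lintegral_mono hpt).trans (le_of_eq ?_)
  have hsq : Measurable fun a : ((i : Fin P.l) → PhaseData Z P i) × Noise P =>
      ENNReal.ofReal (‖(a.2 ⟨k, hk'⟩).2.2‖ ^ 2) := by fun_prop
  rw [lintegral_add_right _ measurable_const, lintegral_add_right _ (hsq.const_mul _),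
    lintegral_const_mul _ hsq, lintegral_const, measure_univ, mul_one,
    lintegral_fullLaw_gaussian ⟨k, hk'⟩ (h := fun ξ => ENNReal.ofReal (‖ξ‖ ^ 2)) (by fun_prop),
    lintegral_norm_sq_gaussian, ← ENNReal.ofReal_mul (by positivity)]
  rw [div_mul_eq_mul_div]

/-- After the last active phase no further regret bound absorbs the noise; the Lipschitz property
pays for its norm linearly. -/
theorem lintegral_excess_idealAfter_le (hP : P.Valid) (h : IsTame X f g Q P.L R β)
    {x₀ : E d} (c : ℝ) (hx₀ : x₀ ∈ X) {k : ℕ} (hk : k < P.l) :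
    ∫⁻ a, excess X f Q c (idealAfter X g x₀ a (k + 1) hk) ∂fullLaw P Q ≤
      ∫⁻ a, excess X f Q c (idealMean X g x₀ a k hk) ∂fullLaw P Q +
        ENNReal.ofReal (P.L * |P.σ (k + 1)| * Real.sqrt d) := by
  have hfact : Fact (0 < P.ε) := ⟨hP.eps_pos⟩
  have hL := hP.L_pos
  have hpt : ∀ a, excess X f Q c (idealAfter X g x₀ a (k + 1) hk) ≤
      excess X f Q c (idealMean X g x₀ a k hk) + ENNReal.ofReal (P.L * |P.σ (k + 1)|) *
        ENNReal.ofReal ‖(a.2 ⟨k, hk⟩).2.2‖ := by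
    intro a
    have hMa : idealMean X g x₀ a k hk ∈ X :=
      meanAvg_mem hP.C_pos h.nonempty h.compact h.convex g _ _
        (idealAfter_mem h.nonempty h.compact g hx₀ a _ _)
    refine (excess_le_add h c (idealAfter_mem h.nonempty h.compact g hx₀ a _ _) hMa).trans ?_
    rw [← ENNReal.ofReal_mul (by positivity)]
    refine add_le_add le_rfl (ENNReal.ofReal_le_ofReal ?_)
    rw [mul_assoc]
    refine mul_le_mul_of_nonneg_left ?_ hL.le
    exact norm_idealStep_sub_meanAvg_le hP h ⟨k, hk⟩ _ _
      (idealAfter_mem h.nonempty h.compact g hx₀ a _ _)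
  refine (lintegral_mono hpt).trans ?_
  have hsq : Measurable fun a : ((i : Fin P.l) → PhaseData Z P i) × Noise P =>
      ENNReal.ofReal ‖(a.2 ⟨k, hk⟩).2.2‖ := by fun_prop
  rw [lintegral_add_right _ (hsq.const_mul _), lintegral_const_mul _ hsq,
    lintegral_fullLaw_gaussian ⟨k, hk⟩ (h := fun ξ => ENNReal.ofReal ‖ξ‖) (by fun_prop),
    ENNReal.ofReal_mul (p := P.L * |P.σ (k + 1)|) (by positivity)]
  gcongr
  exact lintegral_norm_gaussian_le hP.dim_pos

/-- The first phase pays `A` for its distance to the minimizer and `B` for its step size; each later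
phase pays `B` for the incoming noise and `B` for its step size. -/
theorem lintegral_excess_idealMean_le (hP : P.Valid) (h : IsTame X f g Q P.L R β)
    {x₀ y : E d} (hx₀ : x₀ ∈ X) (hy : y ∈ X) (hmin : ∀ z ∈ X, popLoss f Q y ≤ popLoss f Q z)
    {A B : ℝ} (hB : 0 ≤ B) {k : ℕ} (hk : k < P.l) (hT : ∀ j ≤ k, P.T (j + 1) ≠ 0)
    (hA : R ^ 2 / (2 * P.step 1 * P.T 1) ≤ A) (hA0 : 0 ≤ A)
    (hstep : ∀ j, P.step j * P.L ^ 2 / 2 ≤ B)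
    (hσ : ∀ j < k, P.σ (j + 1) ^ 2 * d / (2 * P.step (j + 2) * P.T (j + 2)) ≤ B) :
    ∫⁻ a, excess X f Q (popLoss f Q y) (idealMean X g x₀ a k hk) ∂fullLaw P Q ≤
      ENNReal.ofReal (A + (2 * k + 1) * B) := by
  induction k with
  | zero =>
    refine (lintegral_excess_idealMean_zero_le hP h hx₀ hy hmin hk (hT 0 le_rfl)).trans ?_
    have e : A + (2 * ((0 : ℕ) : ℝ) + 1) * B = A + B := by push_cast; ring
    rw [e, ENNReal.ofReal_add hA0 hB]
    exact add_le_add (ENNReal.ofReal_le_ofReal hA) (ENNReal.ofReal_le_ofReal (hstep 1))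
  | succ k ih =>
    refine (lintegral_excess_idealMean_succ_le hP h hx₀ hmin hk (hT (k + 1) le_rfl)).trans ?_
    have ih' := ih (Nat.lt_of_succ_lt hk) (fun j hj => hT j (hj.trans (Nat.le_succ k)))
      fun j hj => hσ j (Nat.lt_succ_of_lt hj)
    have e : A + (2 * ((k + 1 : ℕ) : ℝ) + 1) * B = A + (2 * k + 1) * B + B + B := by
      push_cast; ring
    rw [e, ENNReal.ofReal_add (by positivity) hB, ENNReal.ofReal_add (by positivity) hB]
    exact add_le_add (add_le_add ih' (ENNReal.ofReal_le_ofReal (hσ k (Nat.lt_succ_self k))))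
      (ENNReal.ofReal_le_ofReal (hstep _))

/-- The probability that the algorithm deviates from the chain of idealized phases. -/
theorem fullLaw_stateAfter_ne_le (hP : P.Valid) (h : IsTame X f g Q P.L R β) {x₀ : E d}
    (hx₀ : x₀ ∈ X) (hηβ : ∀ j, P.step j * β ≤ 1) {φ : ENNReal}
    (hφ : ∀ j : ℕ, ENNReal.ofReal (Real.exp (-(P.C * P.ε / 100))) +
        (if P.T (j + 1) = 0 then 0 else P.C * ENNReal.ofReal (Real.exp
          (1 - 31250 * Real.log ((P.n : ℝ) * d * P.m) ^ 2))) ≤ φ) (k : ℕ) (hk : k ≤ P.l) :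
    fullLaw P Q {a | stateAfter X g x₀ a.1 a.2 k hk ≠ (true, idealAfter X g x₀ a k hk)} ≤
      k * φ := by
  have hfact : Fact (0 < P.ε) := ⟨hP.eps_pos⟩
  induction k with
  | zero => simp [stateAfter_zero, idealAfter_zero]
  | succ k ih =>
    set i : Fin P.l := ⟨k, hk⟩ with hi
    set Y : ((i : Fin P.l) → PhaseData Z P i) × Noise P → E d := fun a =>
      idealAfter X g x₀ a k (Nat.le_of_succ_le hk) with hYdef
    have hYm : Measurable Y :=
      measurable_idealAfter h.nonempty h.compact h.convex h.measurable x₀ _ _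
    have hYi : ∀ a v θ, Y (Function.update a.1 i v, Function.update a.2 i θ) = Y a := fun a v θ =>
      idealAfter_update g x₀ a (Nat.le_of_succ_le hk) le_rfl v θ
    set bad : Set (E d × (PhaseData Z P i × PhaseNoise P)) :=
      {q | phaseStep X g i q.2.1 q.2.2 (true, q.1) ≠ (true, idealStep X g i q.2.1 q.2.2 q.1)}
      with hbad
    have hbadm : MeasurableSet bad := by
      have h1 : Measurable fun q : E d × (PhaseData Z P i × PhaseNoise P) =>
          ((q.2.1, q.2.2), ((true : Bool), q.1)) := by fun_prop
      have h2 : Measurable fun q : E d × (PhaseData Z P i × PhaseNoise P) =>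
          ((q.2.1, q.2.2), q.1) := by fun_prop
      have h3 := (measurable_phaseStep h.nonempty h.compact h.convex h.measurable i).comp h1
      have h4 := (measurable_idealStep h.nonempty h.compact h.convex h.measurable i).comp h2
      have h5 := measurableSet_eq_fun h3 (measurable_const (a := true).prodMk h4)
      exact h5.compl
    have hsub : {a : ((i : Fin P.l) → PhaseData Z P i) × Noise P |
          stateAfter X g x₀ a.1 a.2 (k + 1) hk ≠ (true, idealAfter X g x₀ a (k + 1) hk)} ⊆
        {a | stateAfter X g x₀ a.1 a.2 k (Nat.le_of_succ_le hk) ≠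
          (true, idealAfter X g x₀ a k (Nat.le_of_succ_le hk))} ∪
        {a | (Y a, (a.1 i, a.2 i)) ∈ bad} := by
      intro a ha
      by_contra hcon
      simp only [Set.mem_union, Set.mem_ofPred_eq, not_or, not_not, hbad] at hcon
      apply ha
      rw [stateAfter_succ, idealAfter_succ, hcon.1]
      exact hcon.2
    refine (measure_mono hsub).trans ((measure_union_le _ _).trans ?_)
    -- The entry point `Y` of the phase is independent of its samples and noise, so the uniform
    -- bound for fixed starting points can be integrated.
    have h2 : fullLaw P Q {a | (Y a, (a.1 i, a.2 i)) ∈ bad} ≤ φ := by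
      have hm : Measurable (bad.indicator fun _ => (1 : ENNReal)) :=
        measurable_const.indicator hbadm
      have hfresh := lintegral_fullLaw_fresh (Q := Q) i hYm hYi hm
      have hpm : Measurable fun a : ((i : Fin P.l) → PhaseData Z P i) × Noise P =>
          (Y a, (a.1 i, a.2 i)) :=
        hYm.prodMk (((measurable_pi_apply i).comp measurable_fst).prodMk
          ((measurable_pi_apply i).comp measurable_snd))
      have e1 : fullLaw P Q {a | (Y a, (a.1 i, a.2 i)) ∈ bad} =
          ∫⁻ a, bad.indicator (fun _ => 1) (Y a, (a.1 i, a.2 i)) ∂fullLaw P Q := by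
        have h3 : MeasurableSet {a : ((i : Fin P.l) → PhaseData Z P i) × Noise P |
          (Y a, (a.1 i, a.2 i)) ∈ bad} := hpm hbadm
        rw [← lintegral_indicator_one h3]
        rfl
      rw [e1, hfresh]
      calc _ ≤ ∫⁻ _a, φ ∂fullLaw P Q := by
            refine lintegral_mono fun a => ?_
            have hYa : Y a ∈ X := idealAfter_mem h.nonempty h.compact g hx₀ a _ _
            have e2 : ∫⁻ b, bad.indicator (fun _ => (1 : ENNReal)) (Y a, b)
                ∂((phaseDataLaw P Q i).prod (phaseNoiseLaw P)) =
                ((phaseDataLaw P Q i).prod (phaseNoiseLaw P)) {b | phaseStep X g i b.1 b.2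
                  (true, Y a) ≠ (true, idealStep X g i b.1 b.2 (Y a))} := by
              have hb : MeasurableSet {b : PhaseData Z P i × PhaseNoise P |
                  phaseStep X g i b.1 b.2 (true, Y a) ≠
                  (true, idealStep X g i b.1 b.2 (Y a))} := measurable_prodMk_left hbadm
              rw [← lintegral_indicator_one hb]
              rfl
            rw [e2]
            exact (phaseStep_ne_idealStep_le hP h i (hηβ _) hYa).trans (hφ k)
        _ = φ := by simp
    refine (add_le_add (ih (Nat.le_of_succ_le hk)) h2).trans_eq ?_
    push_cast
    ring

/-- The two runs agree off the deviation event. On it the output still lies in `X`, so its excess is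
at most the Lipschitz constant times the diameter. -/
theorem lintegral_excess_stateAfter_le (hP : P.Valid) (h : IsTame X f g Q P.L R β) {x₀ y : E d}
    (hx₀ : x₀ ∈ X) (hy : y ∈ X) :
    ∫⁻ a, excess X f Q (popLoss f Q y) (stateAfter X g x₀ a.1 a.2 P.l le_rfl).2 ∂fullLaw P Q ≤
      ∫⁻ a, excess X f Q (popLoss f Q y) (idealAfter X g x₀ a P.l le_rfl) ∂fullLaw P Q +
        ENNReal.ofReal (P.L * R) * fullLaw P Q
          {a | stateAfter X g x₀ a.1 a.2 P.l le_rfl ≠ (true, idealAfter X g x₀ a P.l le_rfl)} := by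
  have hL := hP.L_pos
  set c := popLoss f Q y with hc
  set bad : Set (((i : Fin P.l) → PhaseData Z P i) × Noise P) :=
    {a | stateAfter X g x₀ a.1 a.2 P.l le_rfl ≠ (true, idealAfter X g x₀ a P.l le_rfl)} with hbad
  have hpt : ∀ a : ((i : Fin P.l) → PhaseData Z P i) × Noise P,
      excess X f Q c (stateAfter X g x₀ a.1 a.2 P.l le_rfl).2 ≤
      excess X f Q c (idealAfter X g x₀ a P.l le_rfl) +
        bad.indicator (fun _ => ENNReal.ofReal (P.L * R)) a := by
    intro a
    by_cases ha : a ∈ bad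
    · rw [Set.indicator_of_mem ha]
      refine le_add_left ?_
      have hmem := stateAfter_mem h.nonempty h.compact g hx₀ a.1 a.2 P.l le_rfl
      rw [excess_of_mem h c hmem]
      refine ENNReal.ofReal_le_ofReal ?_
      have h1 := (abs_le.1 (h.abs_popLoss_sub_le hmem hy)).2
      have h2 := h.diam _ hmem _ hy
      nlinarith
    · rw [Set.indicator_of_notMem ha, add_zero]
      have : stateAfter X g x₀ a.1 a.2 P.l le_rfl = (true, idealAfter X g x₀ a P.l le_rfl) := by
        by_contra hne
        exact ha hne
      rw [this]
  refine (lintegral_mono hpt).trans ?_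
  have hm : Measurable fun a : ((i : Fin P.l) → PhaseData Z P i) × Noise P =>
      excess X f Q c (idealAfter X g x₀ a P.l le_rfl) :=
    (measurable_excess h c).comp
      (measurable_idealAfter h.nonempty h.compact h.convex h.measurable x₀ _ _)
  rw [lintegral_add_left hm]
  gcongr
  exact lintegral_indicator_const_le _ _

end Chain

end PhasedSGD

end

noncomputable section

namespace PhasedSGD

/-! ### Estimates for the parameters -/

/-- The parameter choices under which the excess loss is bounded. -/
structure Params.Tuned {d : ℕ} (P : Params d) (J R : ℝ) : Prop extends P.Valid where
  J_pos : 0 < J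
  R_pos : 0 < R
  p_eq : P.p = J + 3 / 2
  eta_eq : P.η = R / (P.L * Real.sqrt (d * P.m * P.n * P.ε))
  users_large : 100 / (1 - 1 / (2 : ℝ) ^ P.q) * Real.log (P.n / P.δ) / P.ε ≤
    (P.n : ℝ) ^ (1 - P.q)
  m_le : (P.m : ℝ) ≤ (P.n : ℝ) ^ J

/-- The logarithmic factor of the rate. -/
def Params.logFactor {d : ℕ} (P : Params d) : ℝ := 1 + Real.log (P.n * P.m * d / P.δ)

/-- The polynomial part of the rate. -/
def Params.rate {d : ℕ} (P : Params d) : ℝ := Real.sqrt d / Real.sqrt (P.n * P.m * P.ε)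

namespace Params.Valid

variable {d : ℕ} {P : Params d} (hP : P.Valid)

include hP

theorem logFactor_eq : P.logFactor =
    1 + Real.log P.n + Real.log P.m + Real.log d + Real.log (1 / P.δ) := by
  have h1 := hP.one_le_n
  have h2 := hP.one_le_m
  have h3 := hP.one_le_d
  have h4 := hP.delta_pos
  unfold Params.logFactor
  rw [← mul_one_div, Real.log_mul (by positivity) (by positivity),
    Real.log_mul (by positivity) (by positivity), Real.log_mul (by positivity) (by positivity)]
  ring

theorem one_le_logFactor : 1 ≤ P.logFactor := by
  rw [hP.logFactor_eq]
  linarith [Real.log_nonneg hP.one_le_n, Real.log_nonneg hP.one_le_m, Real.log_nonneg hP.one_le_d,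
    hP.log_inv_delta_pos]

theorem log_div_delta_le : Real.log (P.n / P.δ) ≤ P.logFactor := by
  rw [hP.logFactor_eq, hP.log_div_delta]
  linarith [Real.log_nonneg hP.one_le_m, Real.log_nonneg hP.one_le_d]

theorem log_ndm : Real.log ((P.n : ℝ) * d * P.m) = Real.log P.n + Real.log d + Real.log P.m := by
  have h1 := hP.one_le_n
  have h2 := hP.one_le_m
  have h3 := hP.one_le_d
  rw [Real.log_mul (by positivity) (by positivity), Real.log_mul (by positivity) (by positivity)]

theorem log_ndm_nonneg : 0 ≤ Real.log ((P.n : ℝ) * d * P.m) := by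
  rw [hP.log_ndm]
  linarith [Real.log_nonneg hP.one_le_n, Real.log_nonneg hP.one_le_m, Real.log_nonneg hP.one_le_d]

theorem log_ndm_le : Real.log ((P.n : ℝ) * d * P.m) ≤ P.logFactor := by
  rw [hP.logFactor_eq, hP.log_ndm]
  linarith [hP.log_inv_delta_pos]

theorem l_le : (P.l : ℝ) ≤ 2 * P.logFactor := by
  have h1 : 2 ^ P.l ≤ P.n := Nat.pow_log_le_self 2 (by have := hP.n_pos; omega)
  have h2 : ((2 : ℝ) ^ P.l) ≤ P.n := by exact_mod_cast h1
  have h3 := Real.log_le_log (by positivity) h2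
  rw [Real.log_pow] at h3
  have h4 : Real.log P.n ≤ P.logFactor := by
    rw [hP.logFactor_eq]
    linarith [Real.log_nonneg hP.one_le_m, Real.log_nonneg hP.one_le_d, hP.log_inv_delta_pos]
  have h5 := Real.log_two_gt_d9
  have h6 : (0 : ℝ) ≤ P.l := Nat.cast_nonneg _
  nlinarith

theorem C_le : (P.C : ℝ) ≤ 100 * (Real.log P.m + Real.log (P.n / P.δ) + 14) / P.ε := by
  have hε := hP.eps_pos
  have h20 : Real.log 20 ≤ 3 := by
    rw [Real.log_le_iff_le_exp (by norm_num)]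
    have : Real.exp 3 = Real.exp 1 ^ 3 := by rw [← Real.exp_nat_mul]; norm_num
    rw [this]
    have h1 : (2.7182818283 : ℝ) ^ 3 ≤ Real.exp 1 ^ 3 := by gcongr; exact Real.exp_one_gt_d9.le
    refine le_trans ?_ h1
    norm_num
  have h0 : 0 ≤ 100 * Real.log (20 * P.n * P.m * Real.exp P.ε / P.δ) / P.ε := by
    rw [hP.log_groups]
    have := hP.log_div_delta_pos
    have := Real.log_nonneg hP.one_le_m
    have := two_le_log_twenty
    positivity
  have h := (Nat.ceil_lt_add_one h0).le
  unfold Params.C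
  refine h.trans ?_
  rw [hP.log_groups, ← le_sub_iff_add_le', ← sub_div, le_div_iff₀ hε]
  linarith [hP.eps_le]

theorem C_le_logFactor : (P.C : ℝ) ≤ 1400 * P.logFactor / P.ε := by
  refine hP.C_le.trans ?_
  have hε := hP.eps_pos
  refine div_le_div_of_nonneg_right ?_ hε.le
  have h1 := hP.one_le_logFactor
  have h2 : Real.log P.m + Real.log (P.n / P.δ) ≤ P.logFactor - 1 := by
    rw [hP.logFactor_eq, hP.log_div_delta]
    linarith [Real.log_nonneg hP.one_le_d]
  linarith

theorem sigma_nonneg (i : ℕ) : 0 ≤ P.σ i := by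
  have h1 := hP.step_pos i
  have h2 := hP.L_pos
  have h3 := hP.log_ndm_nonneg
  have h4 := hP.eps_pos
  unfold Params.σ Params.τ
  positivity

/-- Since `ε C ≥ 100`, the denominator of `σ` absorbs its factor 100; three logarithms remain, one
from `τ` and two from `σ`. -/
theorem sigma_le (i : ℕ) :
    P.σ i ≤ 1000 * P.step i * P.L * Real.sqrt (P.T i) * P.logFactor ^ 3 := by
  have h1 := hP.step_pos i
  have h2 := hP.L_pos
  have h3 := hP.log_ndm_nonneg
  have h4 := hP.eps_pos
  have h5 := hP.log_div_delta_pos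
  have h6 := hP.one_le_logFactor
  have hC : 100 ≤ P.ε * P.C := by linarith [hP.groups_mul_ge]
  unfold Params.σ Params.τ
  rw [div_le_iff₀ (by linarith)]
  calc 100 * (1000 * P.step i * P.L * Real.sqrt (P.T i) * Real.log ((P.n : ℝ) * d * P.m)) *
        Real.log (P.n / P.δ) ^ 2
      ≤ 100 * (1000 * P.step i * P.L * Real.sqrt (P.T i) * P.logFactor) * P.logFactor ^ 2 := by
        gcongr
        · exact hP.log_ndm_le
        · exact hP.log_div_delta_le
    _ = 1000 * P.step i * P.L * Real.sqrt (P.T i) * P.logFactor ^ 3 * 100 := by ring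
    _ ≤ _ := by gcongr

omit hP in
theorem step_succ (i : ℕ) : P.step i = (2 : ℝ) ^ P.p * P.step (i + 1) := by
  unfold Params.step
  rw [Nat.cast_add, Nat.cast_one, mul_add, mul_one, Real.rpow_add (by norm_num)]
  field_simp

theorem step_le (hp : 0 ≤ P.p) (i : ℕ) : P.step i ≤ P.η := by
  unfold Params.step
  refine div_le_self hP.eta_pos.le (Real.one_le_rpow (by norm_num) (by positivity))

theorem users_succ (i : ℕ) : P.users i = (2 : ℝ) ^ P.q * P.users (i + 1) := by
  have h := hP.one_lt_two_rpow_q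
  rw [P.users_eq, P.users_eq, pow_succ]
  field_simp

theorem N_antitone : Antitone P.N := by
  refine antitone_nat_of_succ_le fun i => ?_
  unfold Params.N
  refine Nat.floor_mono (div_le_div_of_nonneg_right ?_ (Nat.cast_nonneg _))
  rw [hP.users_succ i]
  exact le_mul_of_one_le_left (hP.users_nonneg _) hP.one_lt_two_rpow_q.le

/-- Rounding down loses at most a factor 2 as long as the result is not zero. -/
theorem users_le_N {i : ℕ} (hN : 0 < P.N i) : P.users i ≤ 2 * P.C * P.N i := by
  have hC : (0 : ℝ) < P.C := by exact_mod_cast hP.C_pos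
  have h1 := (Nat.lt_floor_add_one (P.users i / P.C)).le
  rw [div_le_iff₀ hC] at h1
  have h2 : (1 : ℝ) ≤ P.N i := by exact_mod_cast hN
  have h3 : P.users i ≤ ((P.N i : ℝ) + 1) * P.C := h1
  nlinarith

theorem T_le {i : ℕ} (hN : 0 < P.N (i + 1)) :
    (P.T i : ℝ) ≤ 2 * (2 : ℝ) ^ P.q * P.T (i + 1) := by
  have hC : (0 : ℝ) < P.C := by exact_mod_cast hP.C_pos
  have h1 := hP.mul_N_le_users i
  have h2 := hP.users_le_N hN
  have ha := hP.one_lt_two_rpow_q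
  have h3 : (P.N i : ℝ) ≤ 2 * (2 : ℝ) ^ P.q * P.N (i + 1) := by
    refine le_of_mul_le_mul_left ?_ hC
    rw [hP.users_succ i] at h1
    refine h1.trans ((mul_le_mul_of_nonneg_left h2 (by linarith)).trans_eq (by ring))
  unfold Params.T
  push_cast
  calc (P.N i : ℝ) * P.m ≤ 2 * (2 : ℝ) ^ P.q * P.N (i + 1) * P.m := by gcongr
    _ = _ := by ring

theorem T_le_nm {i : ℕ} (hi : 1 ≤ i) : (P.T i : ℝ) ≤ P.n * P.m := by
  have h1 := hP.mul_N_le_users i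
  have h2 := hP.four_mul_users_le hi
  have hC : (1 : ℝ) ≤ P.C := by exact_mod_cast hP.C_pos
  have hN : (0 : ℝ) ≤ P.N i := Nat.cast_nonneg _
  have h3 : (P.N i : ℝ) ≤ P.n := by nlinarith [hP.users_nonneg i]
  unfold Params.T
  push_cast
  gcongr

theorem rate_pos : 0 < P.rate := by
  have h1 := hP.one_le_n
  have h2 := hP.one_le_m
  have h3 := hP.one_le_d
  have h4 := hP.eps_pos
  unfold Params.rate
  positivity

omit hP in
theorem sqrt_eq : Real.sqrt (d * P.m * P.n * P.ε) =
    Real.sqrt d * Real.sqrt (P.n * P.m * P.ε) := by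
  rw [← Real.sqrt_mul (Nat.cast_nonneg _)]
  congr 1
  ring

theorem one_le_sqrt_d : 1 ≤ Real.sqrt d := Real.one_le_sqrt.2 hP.one_le_d

theorem inv_le_rate : 1 / Real.sqrt (P.n * P.m * P.ε) ≤ P.rate := by
  unfold Params.rate
  gcongr
  exact hP.one_le_sqrt_d

/-- The failure probability of one phase is negligible. -/
theorem failure_le (j : ℕ) : ENNReal.ofReal (Real.exp (-(P.C * P.ε / 100))) +
    (if P.T (j + 1) = 0 then 0 else P.C * ENNReal.ofReal (Real.exp
      (1 - 31250 * Real.log ((P.n : ℝ) * d * P.m) ^ 2))) ≤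
    ENNReal.ofReal (2 / (P.n * P.m)) := by
  have hn := hP.one_le_n
  have hm := hP.one_le_m
  have hd := hP.one_le_d
  have h1 : Real.exp (-(P.C * P.ε / 100)) ≤ 1 / (P.n * P.m) := by
    have h := Nat.le_ceil (100 * Real.log (20 * P.n * P.m * Real.exp P.ε / P.δ) / P.ε)
    rw [div_le_iff₀ hP.eps_pos, hP.log_groups, hP.log_div_delta] at h
    have h' : 100 * (Real.log P.m + Real.log P.n) ≤ P.C * P.ε := by
      unfold Params.C
      rw [hP.log_groups, hP.log_div_delta]
      linarith [two_le_log_twenty, hP.log_inv_delta_pos, hP.eps_pos]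
    rw [Real.exp_neg, one_div]
    refine inv_anti₀ (by positivity) ?_
    rw [← Real.log_le_iff_le_exp (by positivity), Real.log_mul (by positivity) (by positivity)]
    linarith
  have e : (2 : ℝ) / (P.n * P.m) = 1 / (P.n * P.m) + 1 / (P.n * P.m) := by ring
  rw [e, ENNReal.ofReal_add (by positivity) (by positivity)]
  refine add_le_add (ENNReal.ofReal_le_ofReal h1) ?_
  split_ifs with hT
  · exact zero_le
  · have hN : 0 < P.N (j + 1) := by
      rcases Nat.eq_zero_or_pos (P.N (j + 1)) with h0 | h0
      · exact absurd (by unfold Params.T; rw [h0, zero_mul]) hT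
      · exact h0
    have hCn := hP.four_mul_C_le (Nat.le_add_left 1 j) hN
    have h6 := hP.six_le_log_n (Nat.le_add_left 1 j) hN
    set ℓ := Real.log ((P.n : ℝ) * d * P.m) with hℓ
    have hℓ6 : 6 ≤ ℓ := by
      rw [hℓ, hP.log_ndm]
      linarith [Real.log_nonneg hP.one_le_m, Real.log_nonneg hP.one_le_d]
    rw [← ENNReal.ofReal_natCast, ← ENNReal.ofReal_mul (Nat.cast_nonneg _)]
    refine ENNReal.ofReal_le_ofReal ?_
    -- The square of the logarithm beats twice the logarithm, leaving `(n d m)⁻²`; one factor `n`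
    -- pays for the union over the groups.
    have h7 : Real.exp (1 - 31250 * ℓ ^ 2) ≤ Real.exp (-(ℓ + ℓ)) :=
      Real.exp_le_exp.2 (by nlinarith)
    rw [Real.exp_neg, Real.exp_add, hℓ, Real.exp_log (by positivity)] at h7
    calc (P.C : ℝ) * Real.exp (1 - 31250 * ℓ ^ 2)
        ≤ P.n * ((P.n : ℝ) * d * P.m * (P.n * d * P.m))⁻¹ := by
          refine mul_le_mul (by linarith) h7 (Real.exp_pos _).le (by positivity)
      _ = 1 / (P.n * P.m) * ((d : ℝ) * (d * P.m))⁻¹ := by field_simp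
      _ ≤ 1 / (P.n * P.m) * 1 := by
          gcongr
          refine inv_le_one_of_one_le₀ ?_
          nlinarith [mul_le_mul hd hm zero_le_one (by linarith : (0 : ℝ) ≤ d)]
      _ = _ := mul_one _

end Params.Valid

namespace Params.Tuned

variable {d : ℕ} {P : Params d} {J R : ℝ} (hP : P.Tuned J R)

include hP

theorem p_pos : 0 < P.p := by rw [hP.p_eq]; linarith [hP.J_pos]

/-- The identity that fixes `η`: step-size terms carrying the dimension factor of the noise are
exactly `L R` times the rate. -/
theorem eta_mul : P.η * P.L ^ 2 * d = P.L * R * P.rate := by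
  have h1 := hP.one_le_n
  have h2 := hP.one_le_m
  have h3 := hP.one_le_d
  have h4 := hP.eps_pos
  have h5 := hP.L_pos
  have hs : Real.sqrt d * Real.sqrt d = d := Real.mul_self_sqrt (by linarith)
  have hs0 : 0 < Real.sqrt d := Real.sqrt_pos.2 (by linarith)
  have ht0 : 0 < Real.sqrt (P.n * P.m * P.ε) := by positivity
  rw [hP.eta_eq, Params.Valid.sqrt_eq]
  unfold Params.rate
  rw [div_mul_eq_mul_div, div_mul_eq_mul_div, mul_div_assoc', div_eq_div_iff (by positivity)
    ht0.ne']
  calc R * P.L ^ 2 * d * Real.sqrt (P.n * P.m * P.ε)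
      = R * P.L ^ 2 * (Real.sqrt d * Real.sqrt d) * Real.sqrt (P.n * P.m * P.ε) := by rw [hs]
    _ = _ := by ring

theorem eta_mul_le : P.η * P.L ^ 2 ≤ P.L * R * P.rate := by
  rw [← hP.eta_mul]
  have := hP.eta_pos
  exact le_mul_of_one_le_right (by positivity) hP.one_le_d

theorem step_mul_beta_le {β : ℝ} (hβ0 : 0 ≤ β)
    (hβ : β ≤ P.L / R * Real.sqrt (d * P.m * P.n * P.ε)) (j : ℕ) : P.step j * β ≤ 1 := by
  have h1 := hP.one_le_n
  have h2 := hP.one_le_m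
  have h3 := hP.one_le_d
  have h4 := hP.eps_pos
  have h5 := hP.L_pos
  have h6 := hP.R_pos
  have h7 : 0 < Real.sqrt (d * P.m * P.n * P.ε) := by positivity
  calc P.step j * β ≤ P.η * (P.L / R * Real.sqrt (d * P.m * P.n * P.ε)) := by
        have := hP.step_le hP.p_pos.le j
        have := hP.eta_pos
        gcongr
    _ = 1 := by
        rw [hP.eta_eq]
        field_simp

theorem step_mul_le (j : ℕ) :
    P.step j * P.L ^ 2 / 2 ≤
      P.L * R * (1000000 * (2 : ℝ) ^ P.p * (2 : ℝ) ^ P.q * P.logFactor ^ 6 * P.rate) := by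
  have h1 := hP.step_le hP.p_pos.le j
  have h2 := hP.eta_mul_le
  have hL := hP.L_pos
  have hR := hP.R_pos
  have hr := hP.rate_pos
  have h3 : P.step j * P.L ^ 2 / 2 ≤ P.η * P.L ^ 2 := by
    have : P.step j * P.L ^ 2 ≤ P.η * P.L ^ 2 := by gcongr
    have h0 : 0 < P.step j * P.L ^ 2 := mul_pos (hP.step_pos j) (by positivity)
    linarith
  refine h3.trans (h2.trans ?_)
  have hp := Real.one_le_rpow (x := 2) (by norm_num) hP.p_pos.le
  have hq := hP.one_lt_two_rpow_q.le
  have hl : 1 ≤ P.logFactor ^ 6 := one_le_pow₀ hP.one_le_logFactor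
  have hone : 1 ≤ 1000000 * (2 : ℝ) ^ P.p * (2 : ℝ) ^ P.q * P.logFactor ^ 6 := by
    have := one_le_mul_of_one_le_of_one_le
      (one_le_mul_of_one_le_of_one_le (one_le_mul_of_one_le_of_one_le
        (by norm_num : (1 : ℝ) ≤ 1000000) hp) hq) hl
    exact this
  refine mul_le_mul_of_nonneg_left ?_ (by positivity)
  exact le_mul_of_one_le_left hr.le hone

/-- `σ²` contains the square of the previous step size. One factor cancels against the present step
size at the cost of `2 ^ p`, the other is at most `η`; the ratio of the sample counts costs `2 · 2 ^
q`. What remains is `η L² d` times logarithms. -/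
theorem sigma_sq_le {j : ℕ} (hN : 0 < P.N (j + 2)) :
    P.σ (j + 1) ^ 2 * d / (2 * P.step (j + 2) * P.T (j + 2)) ≤
      P.L * R * (1000000 * (2 : ℝ) ^ P.p * (2 : ℝ) ^ P.q * P.logFactor ^ 6 * P.rate) := by
  have hs := hP.step_pos (j + 2)
  have hs1 := hP.step_pos (j + 1)
  have hT : (0 : ℝ) < P.T (j + 2) := by exact_mod_cast hP.T_pos hN
  have hL := hP.L_pos
  have hΛ := hP.one_le_logFactor
  have hd := hP.one_le_d
  have hσ := hP.sigma_le (j + 1)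
  have hσ2 : P.σ (j + 1) ^ 2 ≤
      (1000 * P.step (j + 1) * P.L * Real.sqrt (P.T (j + 1)) * P.logFactor ^ 3) ^ 2 :=
    pow_le_pow_left₀ (hP.sigma_nonneg _) hσ 2
  have hσ3 : (1000 * P.step (j + 1) * P.L * Real.sqrt (P.T (j + 1)) * P.logFactor ^ 3) ^ 2 =
      1000000 * P.step (j + 1) ^ 2 * P.L ^ 2 * P.T (j + 1) * P.logFactor ^ 6 := by
    rw [mul_pow, mul_pow (1000 * P.step (j + 1) * P.L), Real.sq_sqrt (Nat.cast_nonneg _)]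
    ring
  rw [div_le_iff₀ (by positivity)]
  have hsucc : P.step (j + 1) = (2 : ℝ) ^ P.p * P.step (j + 2) := Params.Valid.step_succ (j + 1)
  have hstep := hP.step_le hP.p_pos.le (j + 1)
  calc P.σ (j + 1) ^ 2 * d
      ≤ 1000000 * P.step (j + 1) ^ 2 * P.L ^ 2 * P.T (j + 1) * P.logFactor ^ 6 * d := by
        rw [← hσ3]; gcongr
    _ = 1000000 * (P.step (j + 1) * ((2 : ℝ) ^ P.p * P.step (j + 2))) * P.L ^ 2 * P.T (j + 1) *
          P.logFactor ^ 6 * d := by rw [← hsucc]; ring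
    _ ≤ 1000000 * (P.η * ((2 : ℝ) ^ P.p * P.step (j + 2))) * P.L ^ 2 *
          (2 * (2 : ℝ) ^ P.q * P.T (j + 2)) * P.logFactor ^ 6 * d := by
        have := hP.T_le hN
        have hη := hP.eta_pos
        gcongr
    _ = (P.η * P.L ^ 2 * d) * (1000000 * (2 : ℝ) ^ P.p * (2 : ℝ) ^ P.q * P.logFactor ^ 6) *
          (2 * P.step (j + 2) * P.T (j + 2)) := by ring
    _ = _ := by rw [hP.eta_mul]; ring

/-- The number of groups is of order `log / ε`, so each group of the first phase still reads a
number of samples of order `n m ε / log`; together with `η` this gives `√d / √(n m ε)`. -/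
theorem first_le (hN : 0 < P.N 1) :
    R ^ 2 / (2 * P.step 1 * P.T 1) ≤
      P.L * R * (1400 * (2 : ℝ) ^ P.p * ((2 : ℝ) ^ P.q / (1 - ((2 : ℝ) ^ P.q)⁻¹)) *
        P.logFactor * P.rate) := by
  have hs := hP.step_pos 1
  have hT : (0 : ℝ) < P.T 1 := by exact_mod_cast hP.T_pos hN
  have hL := hP.L_pos
  have hR := hP.R_pos
  have hε := hP.eps_pos
  have hΛ := hP.one_le_logFactor
  have hn := hP.one_le_n
  have hm := hP.one_le_m
  have ha := hP.one_lt_two_rpow_q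
  set a := (2 : ℝ) ^ P.q with hadef
  have ha1 : 0 < 1 - a⁻¹ := by
    have : a⁻¹ < 1 := inv_lt_one_of_one_lt₀ ha
    linarith
  have h1 := hP.users_le_N hN
  have h2 := hP.C_le_logFactor
  have hNpos : (0 : ℝ) < P.N 1 := by exact_mod_cast hN
  rw [P.users_eq, ← hadef, pow_one, div_le_iff₀ (by linarith)] at h1
  have h3 : (1 - a⁻¹) * (P.n * P.m) ≤ 2800 * P.logFactor / P.ε * a * P.T 1 := by
    have hTeq : (P.T 1 : ℝ) = P.N 1 * P.m := by unfold Params.T; push_cast; ring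
    rw [hTeq]
    calc (1 - a⁻¹) * (P.n * P.m) = (1 - a⁻¹) * P.n * P.m := by ring
      _ ≤ 2 * P.C * P.N 1 * a * P.m := by gcongr
      _ ≤ 2 * (1400 * P.logFactor / P.ε) * P.N 1 * a * P.m := by gcongr
      _ = _ := by ring
  have hstep : P.step 1 = P.η / (2 : ℝ) ^ P.p := by
    unfold Params.step
    rw [Nat.cast_one, mul_one]
  set S := Real.sqrt (P.n * P.m * P.ε) with hS
  have hS0 : 0 < S := by positivity
  have hSS : S * S = P.n * P.m * P.ε := Real.mul_self_sqrt (by positivity)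
  have hd0 : 0 < Real.sqrt d := by linarith [hP.one_le_sqrt_d]
  have hstep' : P.step 1 * (P.L * (Real.sqrt d * S) * (2 : ℝ) ^ P.p) = R := by
    rw [hstep, hP.eta_eq, Params.Valid.sqrt_eq, ← hS]
    field_simp
  rw [div_le_iff₀ (by positivity)]
  unfold Params.rate
  rw [← hS]
  have h4 : (1 - a⁻¹) * S ^ 2 ≤ 2800 * P.logFactor * a * P.T 1 := by
    have e : (1 - a⁻¹) * S ^ 2 = (1 - a⁻¹) * (P.n * P.m) * P.ε := by rw [sq, hSS]; ring
    rw [e]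
    calc (1 - a⁻¹) * (P.n * P.m) * P.ε ≤ 2800 * P.logFactor / P.ε * a * P.T 1 * P.ε := by gcongr
      _ = _ := by field_simp
  have h5 : S ≤ 2800 * P.logFactor * a * P.T 1 / (1 - a⁻¹) / S := by
    rw [le_div_iff₀ hS0, le_div_iff₀ ha1]
    linarith
  calc R ^ 2 = R * (P.step 1 * (P.L * (Real.sqrt d * S) * (2 : ℝ) ^ P.p)) := by rw [hstep']; ring
    _ ≤ R * (P.step 1 * (P.L * (Real.sqrt d *
          (2800 * P.logFactor * a * P.T 1 / (1 - a⁻¹) / S)) * (2 : ℝ) ^ P.p)) := by gcongr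
    _ = _ := by field_simp; ring

/-- All phases `i` with `2 ^ i` at most a constant fraction of `n` have samples. -/
theorem N_pos_of_two_pow_le {i : ℕ} (h : (J + 32) ^ (1 / P.q) * (2 : ℝ) ^ i ≤ P.n)
    (hn2 : 2 ≤ P.n) : 0 < P.N i := by
  have hq := hP.q_pos
  have hε := hP.eps_pos
  have hn := hP.one_le_n
  have hJ := hP.J_pos
  have ha := hP.one_lt_two_rpow_q
  have hC : (0 : ℝ) < P.C := by exact_mod_cast hP.C_pos
  set a := (2 : ℝ) ^ P.q with hadef
  have ha1 : 0 < 1 - a⁻¹ := by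
    have : a⁻¹ < 1 := inv_lt_one_of_one_lt₀ ha
    linarith
  set lam := Real.log (P.n / P.δ) with hlam
  have hlogn : Real.log 2 ≤ Real.log P.n := Real.log_le_log (by norm_num) (by exact_mod_cast hn2)
  have hlam1 : Real.log P.n ≤ lam := by
    rw [hlam, hP.log_div_delta]; linarith [hP.log_inv_delta_pos]
  have hlogm : Real.log P.m ≤ J * Real.log P.n := by
    rw [← Real.log_rpow (by linarith)]
    exact Real.log_le_log (by linarith [hP.one_le_m]) hP.m_le
  have hl2 := Real.log_two_gt_d9
  -- Here `log m ≤ J log n ≤ J lam` uses the polynomial bound on `m`, and `14 ≤ 31 lam` follows from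
  -- `lam ≥ log 2`.
  have hC1 : (P.C : ℝ) ≤ (J + 32) * (100 * lam / P.ε) := by
    refine hP.C_le.trans ?_
    rw [mul_div_assoc', ← hlam]
    refine div_le_div_of_nonneg_right ?_ hε.le
    nlinarith
  have hcond := hP.users_large
  rw [one_div ((2 : ℝ) ^ P.q), ← hadef, ← hlam] at hcond
  have hcond' : 100 * lam / P.ε ≤ (1 - a⁻¹) * (P.n : ℝ) ^ (1 - P.q) := by
    have := mul_le_mul_of_nonneg_left hcond ha1.le
    refine le_trans (le_of_eq ?_) this
    generalize 1 - a⁻¹ = r at ha1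
    field_simp
  have hpow : (J + 32) * a ^ i ≤ (P.n : ℝ) ^ P.q := by
    have h1 := Real.rpow_le_rpow (by positivity) h hq.le
    rw [Real.mul_rpow (by positivity) (by positivity), ← Real.rpow_mul (by linarith),
      one_div_mul_cancel hq.ne', Real.rpow_one, ← Real.rpow_natCast, ← Real.rpow_mul (by norm_num),
      mul_comm (i : ℝ), Real.rpow_mul (by norm_num), Real.rpow_natCast] at h1
    exact h1
  have hn1 : (P.n : ℝ) ^ (1 - P.q) * (P.n : ℝ) ^ P.q = P.n := by
    rw [← Real.rpow_add (by linarith)]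
    simp
  unfold Params.N
  rw [Nat.floor_pos, le_div_iff₀ hC, one_mul, P.users_eq, ← hadef, le_div_iff₀ (by positivity)]
  have hnn : 0 ≤ (P.n : ℝ) ^ (1 - P.q) := by positivity
  calc (P.C : ℝ) * a ^ i ≤ (J + 32) * (100 * lam / P.ε) * a ^ i := by gcongr
    _ ≤ (J + 32) * ((1 - a⁻¹) * (P.n : ℝ) ^ (1 - P.q)) * a ^ i := by gcongr
    _ = (1 - a⁻¹) * (P.n : ℝ) ^ (1 - P.q) * ((J + 32) * a ^ i) := by ring
    _ ≤ (1 - a⁻¹) * (P.n : ℝ) ^ (1 - P.q) * (P.n : ℝ) ^ P.q := by gcongr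
    _ = _ := by rw [mul_assoc, hn1]

/-- The phases with samples form an initial segment, which reaches up to a constant fraction
of `n`. -/
theorem exists_active : ∃ k₀ ≤ P.l, (∀ k < k₀, 0 < P.N (k + 1)) ∧
    (∀ k, k₀ ≤ k → k < P.l → P.T (k + 1) = 0) ∧
    (P.n : ℝ) ≤ 2 * (J + 32) ^ (1 / P.q) * 2 ^ k₀ := by
  classical
  have hq := hP.q_pos
  have hJ := hP.J_pos
  have hb : 1 ≤ (J + 32) ^ (1 / P.q) := Real.one_le_rpow (by linarith) (by positivity)
  -- Admitting `k = 0` makes the predicate satisfiable even when no phase has samples.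
  set k₀ := Nat.findGreatest (fun k => k = 0 ∨ 0 < P.N k) P.l with hk₀
  have hspec : k₀ = 0 ∨ 0 < P.N k₀ :=
    Nat.findGreatest_spec (P := fun k => k = 0 ∨ 0 < P.N k) (Nat.zero_le P.l) (Or.inl rfl)
  have hgt : ∀ k, k₀ < k → k ≤ P.l → P.N k = 0 := by
    intro k h1 h2
    have := Nat.findGreatest_is_greatest h1 h2
    simp only [not_or] at this
    omega
  refine ⟨k₀, Nat.findGreatest_le _, fun k hk => ?_, fun k hk1 hk2 => ?_, ?_⟩
  · have h0 : 0 < P.N k₀ := hspec.resolve_left (by omega)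
    exact h0.trans_le (hP.N_antitone (by omega))
  · unfold Params.T
    rw [hgt (k + 1) (by omega) (by omega), zero_mul]
  -- Otherwise `k₀ + 1` is still the index of a phase and is small enough for that phase to have
  -- samples, contradicting maximality.
  · by_contra hcon
    push Not at hcon
    have hlt : (2 : ℝ) ^ (k₀ + 1) < P.n := by
      calc (2 : ℝ) ^ (k₀ + 1) = 1 * (2 * 2 ^ k₀) := by ring
        _ ≤ (J + 32) ^ (1 / P.q) * (2 * 2 ^ k₀) := by gcongr
        _ = 2 * (J + 32) ^ (1 / P.q) * 2 ^ k₀ := by ring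
        _ < _ := hcon
    have hlt' : 2 ^ (k₀ + 1) < P.n := by exact_mod_cast hlt
    have hle : k₀ + 1 ≤ P.l := Nat.le_log_of_pow_le (by norm_num) hlt'.le
    have hn2 : 2 ≤ P.n := by
      have : 2 ^ 1 ≤ 2 ^ (k₀ + 1) := Nat.pow_le_pow_right (by norm_num) (by omega)
      omega
    have hpos := hP.N_pos_of_two_pow_le (i := k₀ + 1)
      (by rw [pow_succ]; refine le_trans (le_of_eq ?_) hcon.le; ring) hn2
    rw [hgt (k₀ + 1) (Nat.lt_succ_self _) hle] at hpos
    exact lt_irrefl _ hpos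

/-- The decay `2 ^ (-p k₀)` of the step size must beat `√T ≤ √(n m) ≤ n ^ ((1 + J) / 2)`. The
exponent `p = J + 3 / 2` exceeds this one, and `2 ^ k₀` is at least `n` divided by a constant. -/
theorem last_sigma_le {k₀ : ℕ} (hk : 1 ≤ k₀)
    (hn : (P.n : ℝ) ≤ 2 * (J + 32) ^ (1 / P.q) * 2 ^ k₀) :
    P.L * |P.σ k₀| * Real.sqrt d ≤
      P.L * R * (1000 * (2 * (J + 32) ^ (1 / P.q)) ^ P.p * P.logFactor ^ 3 * P.rate) := by
  have hL := hP.L_pos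
  have hR := hP.R_pos
  have hJ := hP.J_pos
  have hη := hP.eta_pos
  have hΛ := hP.one_le_logFactor
  have hn1 := hP.one_le_n
  have hm1 := hP.one_le_m
  have hd1 := hP.one_le_d
  set b := 2 * (J + 32) ^ (1 / P.q) with hb
  have hb0 : 0 < b := by positivity
  have hpow : Real.sqrt (P.n * P.m) / (2 : ℝ) ^ (P.p * k₀) ≤ b ^ P.p := by
    rw [div_le_iff₀ (by positivity), mul_comm P.p, Real.rpow_mul (by norm_num), Real.rpow_natCast,
      ← Real.mul_rpow hb0.le (by positivity)]
    have h1 : Real.sqrt (P.n * P.m) ≤ (P.n : ℝ) ^ P.p := by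
      rw [Real.sqrt_le_left (by positivity), ← Real.rpow_natCast, ← Real.rpow_mul (by linarith)]
      calc (P.n : ℝ) * P.m ≤ P.n * (P.n : ℝ) ^ J := by gcongr; exact hP.m_le
        _ = (P.n : ℝ) ^ (1 + J) := by rw [Real.rpow_add (by linarith), Real.rpow_one]
        _ ≤ _ := by
          apply Real.rpow_le_rpow_of_exponent_le hn1
          rw [hP.p_eq]
          push_cast
          linarith
    exact h1.trans (Real.rpow_le_rpow (by linarith) hn hP.p_pos.le)
  rw [abs_of_nonneg (hP.sigma_nonneg _)]
  have hTs : Real.sqrt (P.T k₀) ≤ Real.sqrt (P.n * P.m) := Real.sqrt_le_sqrt (hP.T_le_nm hk)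
  -- A deliberate loss, to bring in the dimension factor needed for the identity defining the rate.
  have hsd : Real.sqrt d ≤ d := by
    have := hP.one_le_sqrt_d
    have h2 : Real.sqrt d * Real.sqrt d = d := Real.mul_self_sqrt (by linarith)
    nlinarith
  calc P.L * P.σ k₀ * Real.sqrt d
      ≤ P.L * (1000 * P.step k₀ * P.L * Real.sqrt (P.n * P.m) * P.logFactor ^ 3) * d := by
        have := hP.sigma_le k₀
        have hs := hP.step_pos k₀
        have h2 : P.σ k₀ ≤ 1000 * P.step k₀ * P.L * Real.sqrt (P.n * P.m) * P.logFactor ^ 3 :=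
          this.trans (by gcongr)
        gcongr
    _ = P.η * P.L ^ 2 * d * (1000 * (Real.sqrt (P.n * P.m) / (2 : ℝ) ^ (P.p * k₀)) *
          P.logFactor ^ 3) := by
        unfold Params.step
        ring
    _ ≤ P.η * P.L ^ 2 * d * (1000 * b ^ P.p * P.logFactor ^ 3) := by gcongr
    _ = _ := by rw [hP.eta_mul]; ring

/-- If no phase is active then `n`, and with it `n m ε`, is bounded by a constant, and the trivial
bound `L R` is already of the order of the rate. -/
theorem one_le_of_few_users (hn : (P.n : ℝ) ≤ 2 * (J + 32) ^ (1 / P.q)) :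
    1 ≤ Real.sqrt (10 * (2 * (J + 32) ^ (1 / P.q)) ^ (1 + J)) * P.rate := by
  have hJ := hP.J_pos
  have hn1 := hP.one_le_n
  have hm1 := hP.one_le_m
  have hε := hP.eps_pos
  have h0 : 0 < Real.sqrt (P.n * P.m * P.ε) := by positivity
  have h1 : (P.n : ℝ) * P.m * P.ε ≤ 10 * (2 * (J + 32) ^ (1 / P.q)) ^ (1 + J) := by
    calc (P.n : ℝ) * P.m * P.ε ≤ P.n * (P.n : ℝ) ^ J * 10 := by
          gcongr
          · exact hP.m_le
          · exact hP.eps_le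
      _ = 10 * (P.n : ℝ) ^ (1 + J) := by
          rw [Real.rpow_add (by linarith), Real.rpow_one]; ring
      _ ≤ _ := by
          gcongr
  calc (1 : ℝ) = Real.sqrt (P.n * P.m * P.ε) * (1 / Real.sqrt (P.n * P.m * P.ε)) := by
        field_simp
    _ ≤ _ := by
        gcongr
        exact hP.inv_le_rate

theorem inv_nm_le : 1 / ((P.n : ℝ) * P.m) ≤ 4 * P.rate := by
  have hn1 := hP.one_le_n
  have hm1 := hP.one_le_m
  have hε := hP.eps_pos
  have hnm : 1 ≤ (P.n : ℝ) * P.m := one_le_mul_of_one_le_of_one_le hn1 hm1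
  have h0 : 0 < Real.sqrt (P.n * P.m * P.ε) := by positivity
  have h1 : Real.sqrt (P.n * P.m * P.ε) ≤ 4 * (P.n * P.m) := by
    rw [Real.sqrt_le_left (by positivity)]
    nlinarith [hP.eps_le]
  calc 1 / ((P.n : ℝ) * P.m) = 4 * (1 / (4 * (P.n * P.m))) := by field_simp
    _ ≤ 4 * (1 / Real.sqrt (P.n * P.m * P.ε)) := by gcongr
    _ ≤ _ := by gcongr; exact hP.inv_le_rate

end Params.Tuned

end PhasedSGD

end

noncomputable section

namespace PhasedSGD

/-! ### Excess loss of the algorithm -/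

/-- The constant in the bound for the excess loss. -/
def rateConst (J q : ℝ) : ℝ :=
  1400 * (2 : ℝ) ^ (J + 3 / 2) * ((2 : ℝ) ^ q / (1 - ((2 : ℝ) ^ q)⁻¹)) +
    4 * (1000000 * (2 : ℝ) ^ (J + 3 / 2) * (2 : ℝ) ^ q) +
    1000 * (2 * (J + 32) ^ (1 / q)) ^ (J + 3 / 2) + 16 +
    Real.sqrt (10 * (2 * (J + 32) ^ (1 / q)) ^ (1 + J))

theorem rateConst_pos {J q : ℝ} (hJ : 0 < J) (hq : 0 < q) : 0 < rateConst J q := by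
  have h1 : 1 < (2 : ℝ) ^ q := Real.one_lt_rpow (by norm_num) hq
  have h2 : 0 < 1 - ((2 : ℝ) ^ q)⁻¹ := by
    have : ((2 : ℝ) ^ q)⁻¹ < 1 := inv_lt_one_of_one_lt₀ h1
    linarith
  unfold rateConst
  positivity

section Utility

variable {d : ℕ} {Z : Type*} {P : Params d} {X : Set (E d)} [MeasurableSpace Z]
  {f : E d → Z → ℝ} {Q : Measure Z} [IsProbabilityMeasure Q] {J R β : ℝ}

/-- Deviation from the ideal chain contributes the 16 in `rateConst`; the ideal chain contributes
the rest. Its phases after the last active one are deleted, since they do not move the point. -/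
theorem lintegral_excess_output_le {g : E d → Z → E d} (hP : P.Tuned J R)
    (h : IsTame X f g Q P.L R β) (hβ0 : 0 ≤ β)
    (hβ : β ≤ P.L / R * Real.sqrt (d * P.m * P.n * P.ε)) {x₀ y : E d} (hx₀ : x₀ ∈ X)
    (hy : y ∈ X) (hmin : ∀ z ∈ X, popLoss f Q y ≤ popLoss f Q z) :
    ∫⁻ a, excess X f Q (popLoss f Q y) (stateAfter X g x₀ a.1 a.2 P.l le_rfl).2 ∂fullLaw P Q ≤
      ENNReal.ofReal (P.L * R * (rateConst J P.q * P.logFactor ^ 8 * P.rate)) := by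
  have hV := hP.toValid
  have hfact : Fact (0 < P.ε) := ⟨hP.eps_pos⟩
  have hL := hP.L_pos
  have hR := hP.R_pos
  have hΛ := hP.one_le_logFactor
  have hr := hP.rate_pos
  have hn1 := hP.one_le_n
  have hm1 := hP.one_le_m
  have hlΛ := hP.l_le
  have hJ := hP.J_pos
  have hq1 := hP.one_lt_two_rpow_q
  have hq2 : 0 < 1 - ((2 : ℝ) ^ P.q)⁻¹ := by
    have : ((2 : ℝ) ^ P.q)⁻¹ < 1 := inv_lt_one_of_one_lt₀ hq1
    linarith
  set c := popLoss f Q y with hc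
  have hLR : 0 < P.L * R := by positivity
  have hfail : ENNReal.ofReal (P.L * R) * fullLaw P Q
      {a | stateAfter X g x₀ a.1 a.2 P.l le_rfl ≠ (true, idealAfter X g x₀ a P.l le_rfl)} ≤
      ENNReal.ofReal (P.L * R * (16 * P.logFactor ^ 8 * P.rate)) := by
    have h1 := fullLaw_stateAfter_ne_le hV h hx₀ (hP.step_mul_beta_le hβ0 hβ) hP.failure_le P.l
      le_rfl
    rw [← ENNReal.ofReal_natCast, ← ENNReal.ofReal_mul (Nat.cast_nonneg _)] at h1
    refine (mul_le_mul_right h1 _).trans ?_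
    rw [← ENNReal.ofReal_mul hLR.le]
    refine ENNReal.ofReal_le_ofReal (mul_le_mul_of_nonneg_left ?_ hLR.le)
    have h2 := hP.inv_nm_le
    calc (P.l : ℝ) * (2 / (P.n * P.m)) = P.l * 2 * (1 / (P.n * P.m)) := by ring
      _ ≤ 2 * P.logFactor * 2 * (4 * P.rate) := by gcongr
      _ = 16 * P.logFactor * P.rate := by ring
      _ ≤ _ := by
        gcongr
        exact le_self_pow₀ hΛ (by norm_num)
  have hideal : ∫⁻ a, excess X f Q c (idealAfter X g x₀ a P.l le_rfl) ∂fullLaw P Q ≤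
      ENNReal.ofReal (P.L * R * ((rateConst J P.q - 16) * P.logFactor ^ 8 * P.rate)) := by
    obtain ⟨k₀, hk₀, hact, hinact, hnk⟩ := hP.exists_active
    simp only [fun a => idealAfter_eq_of_inactive hV h.nonempty h.compact h.convex g hx₀ a hk₀
      le_rfl hinact]
    have hsqrt0 : 0 ≤ Real.sqrt (10 * (2 * (J + 32) ^ (1 / P.q)) ^ (1 + J)) := Real.sqrt_nonneg _
    have hΛ8 : 1 ≤ P.logFactor ^ 8 := one_le_pow₀ hΛ
    -- With no active phase the output of the chain is `x₀`, and only the trivial bound is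
    -- available.
    rcases Nat.eq_zero_or_pos k₀ with rfl | hpos
    · simp only [idealAfter_zero, lintegral_const, measure_univ, mul_one]
      rw [pow_zero, mul_one] at hnk
      rw [excess_of_mem h c hx₀]
      refine ENNReal.ofReal_le_ofReal ?_
      have h1 := (abs_le.1 (h.abs_popLoss_sub_le hx₀ hy)).2
      have h2 := h.diam _ hx₀ _ hy
      have h3 := hP.one_le_of_few_users hnk
      have h4 : popLoss f Q x₀ - c ≤ P.L * R := h1.trans (by gcongr)
      refine h4.trans (le_mul_of_one_le_right hLR.le (h3.trans ?_))
      calc Real.sqrt (10 * (2 * (J + 32) ^ (1 / P.q)) ^ (1 + J)) * P.rate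
          = Real.sqrt (10 * (2 * (J + 32) ^ (1 / P.q)) ^ (1 + J)) * 1 * P.rate := by ring
        _ ≤ (rateConst J P.q - 16) * P.logFactor ^ 8 * P.rate := by
          have hle : Real.sqrt (10 * (2 * (J + 32) ^ (1 / P.q)) ^ (1 + J)) ≤
              rateConst J P.q - 16 := by
            unfold rateConst
            have : 0 ≤ 1400 * (2 : ℝ) ^ (J + 3 / 2) *
              ((2 : ℝ) ^ P.q / (1 - ((2 : ℝ) ^ P.q)⁻¹)) := by positivity
            have : 0 ≤ 4 * (1000000 * (2 : ℝ) ^ (J + 3 / 2) * (2 : ℝ) ^ P.q) := by positivity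
            have : 0 ≤ 1000 * (2 * (J + 32) ^ (1 / P.q)) ^ (J + 3 / 2) := by positivity
            linarith
          exact mul_le_mul_of_nonneg_right (mul_le_mul hle hΛ8 zero_le_one (hsqrt0.trans hle)) hr.le
    · obtain ⟨k, rfl⟩ : ∃ k, k₀ = k + 1 := ⟨k₀ - 1, by omega⟩
      have hk : k < P.l := hk₀
      have h1 := lintegral_excess_idealAfter_le hV h c hx₀ hk
      have hmean := lintegral_excess_idealMean_le hV h hx₀ hy hmin (k := k)
        (A := P.L * R * (1400 * (2 : ℝ) ^ P.p * ((2 : ℝ) ^ P.q / (1 - ((2 : ℝ) ^ P.q)⁻¹)) *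
          P.logFactor * P.rate))
        (B := P.L * R * (1000000 * (2 : ℝ) ^ P.p * (2 : ℝ) ^ P.q * P.logFactor ^ 6 * P.rate))
        (by positivity) hk
        (fun j hj => (hP.T_pos (hact j (by omega))).ne') (hP.first_le (hact 0 (by omega)))
        (by positivity) hP.step_mul_le (fun j hj => hP.sigma_sq_le (hact (j + 1) (by omega)))
      refine (h1.trans (add_le_add hmean (ENNReal.ofReal_le_ofReal
        (hP.last_sigma_le (Nat.le_add_left 1 k) hnk)))).trans ?_
      rw [← ENNReal.ofReal_add (by positivity) (by positivity)]
      refine ENNReal.ofReal_le_ofReal ?_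
      -- The number of phases costs one more logarithm on top of the sixth power from `σ²`;
      -- everything is finally rounded up to the eighth power.
      have hkΛ : 2 * (k : ℝ) + 1 ≤ 4 * P.logFactor := by
        have : (k : ℝ) + 1 ≤ P.l := by exact_mod_cast hk₀
        linarith
      have hb0 : 0 < 2 * (J + 32) ^ (1 / P.q) := by positivity
      have e8 : ∀ {t : ℝ} {m : ℕ}, m ≤ 8 → 0 ≤ t → t * P.logFactor ^ m ≤ t * P.logFactor ^ 8 :=
        fun hm ht => mul_le_mul_of_nonneg_left (pow_le_pow_right₀ hΛ hm) ht
      have t1 := e8 (m := 1) (t := 1400 * (2 : ℝ) ^ P.p *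
        ((2 : ℝ) ^ P.q / (1 - ((2 : ℝ) ^ P.q)⁻¹))) (by norm_num) (by positivity)
      have t2 := e8 (m := 7) (t := 4 * (1000000 * (2 : ℝ) ^ P.p * (2 : ℝ) ^ P.q)) (by norm_num)
        (by positivity)
      have t3 := e8 (m := 3) (t := 1000 * (2 * (J + 32) ^ (1 / P.q)) ^ P.p) (by norm_num)
        (by positivity)
      have t4 : (2 * (k : ℝ) + 1) * (1000000 * (2 : ℝ) ^ P.p * (2 : ℝ) ^ P.q * P.logFactor ^ 6) ≤
          4 * (1000000 * (2 : ℝ) ^ P.p * (2 : ℝ) ^ P.q) * P.logFactor ^ 7 := by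
        calc _ ≤ 4 * P.logFactor *
              (1000000 * (2 : ℝ) ^ P.p * (2 : ℝ) ^ P.q * P.logFactor ^ 6) := by gcongr
          _ = _ := by ring
      have t5 : 0 ≤ Real.sqrt (10 * (2 * (J + 32) ^ (1 / P.q)) ^ (1 + J)) * P.logFactor ^ 8 := by
        positivity
      rw [pow_one] at t1
      calc _ = P.L * R * ((1400 * (2 : ℝ) ^ P.p * ((2 : ℝ) ^ P.q / (1 - ((2 : ℝ) ^ P.q)⁻¹)) *
              P.logFactor + (2 * (k : ℝ) + 1) * (1000000 * (2 : ℝ) ^ P.p * (2 : ℝ) ^ P.q *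
              P.logFactor ^ 6) + 1000 * (2 * (J + 32) ^ (1 / P.q)) ^ P.p * P.logFactor ^ 3) *
              P.rate) := by ring
        _ ≤ P.L * R * (((rateConst J P.q - 16) * P.logFactor ^ 8) * P.rate) := by
          gcongr
          unfold rateConst
          rw [← hP.p_eq]
          nlinarith
  refine (lintegral_excess_stateAfter_le hV h hx₀ hy).trans
    ((add_le_add hideal hfail).trans ?_)
  have h16 : 0 ≤ rateConst J P.q - 16 := by
    unfold rateConst
    have : 0 ≤ 1400 * (2 : ℝ) ^ (J + 3 / 2) *
      ((2 : ℝ) ^ P.q / (1 - ((2 : ℝ) ^ P.q)⁻¹)) := by positivity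
    have : 0 ≤ 4 * (1000000 * (2 : ℝ) ^ (J + 3 / 2) * (2 : ℝ) ^ P.q) := by positivity
    have : 0 ≤ 1000 * (2 * (J + 32) ^ (1 / P.q)) ^ (J + 3 / 2) := by positivity
    have := Real.sqrt_nonneg (10 * (2 * (J + 32) ^ (1 / P.q)) ^ (1 + J))
    linarith
  rw [← ENNReal.ofReal_add (by positivity) (by positivity)]
  refine ENNReal.ofReal_le_ofReal (le_of_eq ?_)
  ring

instance isProbabilityMeasure_dataLaw (n m : ℕ) : IsProbabilityMeasure (dataLaw Q n m) := by
  unfold dataLaw; infer_instance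

/-- The users of different groups are distinct and each reading order is a bijection, so the
schedule reads no sample twice and the phases see independent data. -/
theorem measurePreserving_read (hε : 0 < P.ε) (s : Schedule P) :
    MeasurePreserving (fun a : Dataset Z P.n P.m × Noise P =>
        ((s.read a.1, a.2) : ((i : Fin P.l) → PhaseData Z P i) × Noise P))
      ((dataLaw Q P.n P.m).prod (noiseLaw P)) (fullLaw P Q) := by
  have hfact : Fact (0 < P.ε) := ⟨hε⟩
  have he : Function.Injective fun a : (Σ i : Fin P.l, Fin P.C × Fin (P.T (i + 1))) =>
      (s.user a.1 a.2.1 (s.order a.1 a.2.1 a.2.2).1, (s.order a.1 a.2.1 a.2.2).2) := by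
    rintro ⟨i, j, t⟩ ⟨i', j', t'⟩ heq
    simp only [Prod.mk.injEq] at heq
    have h1 := s.user_injective (a₁ := ⟨i, j, (s.order i j t).1⟩)
      (a₂ := ⟨i', j', (s.order i' j' t').1⟩) heq.1
    obtain rfl : i = i' := congrArg Sigma.fst h1
    simp only [Sigma.mk.injEq, heq_eq_eq, true_and, Prod.mk.injEq] at h1
    obtain ⟨rfl, h2⟩ := h1
    have h3 : s.order i j t = s.order i j t' := Prod.ext h2 heq.2
    rw [(s.order i j).injective h3]
  have h1 := measurePreserving_dataLaw Q P.n P.m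
    (e := fun (i : Fin P.l) (p : Fin P.C × Fin (P.T (i + 1))) =>
      (s.user i p.1 (s.order i p.1 p.2).1, (s.order i p.1 p.2).2)) he
  exact h1.prod (MeasurePreserving.id (noiseLaw P))

/-- Excess loss of the algorithm. -/
theorem algorithm_excess_le {G : E d → Z → E d} (hP : P.Tuned J R)
    (h : IsSmoothSCO X f G Q P.L R β) (hβ0 : 0 ≤ β)
    (hβ : β ≤ P.L / R * Real.sqrt (d * P.m * P.n * P.ε)) (s : Schedule P) {x₀ : E d}
    (hx₀ : x₀ ∈ X) :
    Integrable (fun a : Dataset Z P.n P.m × Noise P =>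
        popLoss f Q (algorithm P s X G x₀ a.1 a.2).val)
      ((dataLaw Q P.n P.m).prod (noiseLaw P)) ∧
    (∫ a : Dataset Z P.n P.m × Noise P, popLoss f Q (algorithm P s X G x₀ a.1 a.2).val
        ∂((dataLaw Q P.n P.m).prod (noiseLaw P))) - sInf (popLoss f Q '' X) ≤
      P.L * R * (rateConst J P.q * P.logFactor ^ 8 * P.rate) := by
  have hfact : Fact (0 < P.ε) := ⟨hP.eps_pos⟩
  have ht := h.isTame hP.L_pos.le hβ0
  have hL := hP.L_pos
  have hR := hP.R_pos
  have hcont : ContinuousOn (popLoss f Q) X := by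
    refine ht.continuous_popLoss_proj.continuousOn.congr fun x hx => ?_
    exact (congrArg _ (proj_of_mem h.nonempty h.compact h.convex hx)).symm
  obtain ⟨y, hy, hmin⟩ := h.compact.exists_isMinOn h.nonempty hcont
  have hmin' : ∀ z ∈ X, popLoss f Q y ≤ popLoss f Q z := fun z hz => hmin hz
  have hinf : sInf (popLoss f Q '' X) = popLoss f Q y :=
    IsLeast.csInf_eq ⟨Set.mem_image_of_mem _ hy, by rintro _ ⟨z, hz, rfl⟩; exact hmin' z hz⟩
  rw [hinf]
  simp only [algorithm_val, stateAfter_reducedGrad h.nonempty h.compact h.convex G hx₀]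
  set g := reducedGrad X G with hg
  have hmem : ∀ a : Dataset Z P.n P.m × Noise P,
      (stateAfter X g x₀ (s.read a.1) a.2 P.l le_rfl).2 ∈ X := fun a =>
    stateAfter_mem h.nonempty h.compact g hx₀ _ _ _ _
  have hmp := measurePreserving_read (Q := Q) hP.eps_pos s
  have hm : Measurable fun a : Dataset Z P.n P.m × Noise P =>
      (stateAfter X g x₀ (s.read a.1) a.2 P.l le_rfl).2 := by
    have h1 := (measurable_stateAfter (P := P) h.nonempty h.compact h.convex ht.measurable x₀ P.l
      le_rfl).comp hmp.measurable
    exact measurable_snd.comp h1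
  have hmF : Measurable fun a : Dataset Z P.n P.m × Noise P =>
      popLoss f Q (stateAfter X g x₀ (s.read a.1) a.2 P.l le_rfl).2 := by
    have h1 : Measurable fun a : Dataset Z P.n P.m × Noise P =>
        popLoss f Q (proj X (stateAfter X g x₀ (s.read a.1) a.2 P.l le_rfl).2) :=
      ht.continuous_popLoss_proj.measurable.comp hm
    simpa only [fun a => proj_of_mem h.nonempty h.compact h.convex (hmem a)] using h1
  have hI : Integrable (fun a : Dataset Z P.n P.m × Noise P =>
      popLoss f Q (stateAfter X g x₀ (s.read a.1) a.2 P.l le_rfl).2)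
      ((dataLaw Q P.n P.m).prod (noiseLaw P)) := by
    refine Integrable.of_bound hmF.aestronglyMeasurable (|popLoss f Q y| + P.L * R)
      (Filter.Eventually.of_forall fun a => ?_)
    rw [Real.norm_eq_abs]
    have h1 := ht.abs_popLoss_sub_le (hmem a) hy
    have h2 := h.diam _ (hmem a) _ hy
    have h3 := abs_add_le (popLoss f Q (stateAfter X g x₀ (s.read a.1) a.2 P.l le_rfl).2 -
      popLoss f Q y) (popLoss f Q y)
    rw [sub_add_cancel] at h3
    nlinarith
  refine ⟨hI, ?_⟩
  have hI' : Integrable (fun a : Dataset Z P.n P.m × Noise P =>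
      popLoss f Q (stateAfter X g x₀ (s.read a.1) a.2 P.l le_rfl).2 - popLoss f Q y)
      ((dataLaw Q P.n P.m).prod (noiseLaw P)) := hI.sub (integrable_const _)
  have hmain := lintegral_excess_output_le hP ht hβ0 hβ hx₀ hy hmin'
  have hme : Measurable fun a : ((i : Fin P.l) → PhaseData Z P i) × Noise P =>
      excess X f Q (popLoss f Q y) (stateAfter X g x₀ a.1 a.2 P.l le_rfl).2 :=
    (measurable_excess ht _).comp (measurable_snd.comp (measurable_stateAfter (P := P) h.nonempty
      h.compact h.convex ht.measurable x₀ P.l le_rfl))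
  rw [← hmp.lintegral_comp hme] at hmain
  simp only [fun a => excess_of_mem ht (popLoss f Q y) (hmem a)] at hmain
  rw [← ofReal_integral_eq_lintegral_ofReal hI'
    (Filter.Eventually.of_forall fun a => sub_nonneg.2 (hmin' _ (hmem a)))] at hmain
  have hnn : 0 ≤ P.L * R * (rateConst J P.q * P.logFactor ^ 8 * P.rate) := by
    have h1 := rateConst_pos hP.J_pos hP.q_pos
    have h2 := hP.one_le_logFactor
    have h3 := hP.rate_pos
    positivity
  rw [ENNReal.ofReal_le_ofReal_iff hnn, integral_sub hI (integrable_const _)] at hmain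
  simpa using hmain

end Utility

/-- The inequality amounts to `√ε ≤ K √(log (1 / δ))`. It holds because `ε ≤ 10` and `log (1 / δ)`
stays away from zero; this is where an upper bound on `δ` below 1 is needed. -/
theorem rate_le {d n m : ℕ} {ε δ δ₁ : ℝ} (hn : 1 ≤ n) (hm : 1 ≤ m) (hε : 0 < ε) (hε' : ε ≤ 10)
    (hδ : 0 < δ) (hδ₁ : δ ≤ δ₁) (hδ₁' : δ₁ < 1) :
    Real.sqrt d / Real.sqrt (n * m * ε) ≤ Real.sqrt (10 / Real.log (1 / δ₁)) *
      (Real.sqrt (d * Real.log (1 / δ)) / (Real.sqrt n * ε * Real.sqrt m)) := by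
  have hn' : (0 : ℝ) < n := by exact_mod_cast hn
  have hm' : (0 : ℝ) < m := by exact_mod_cast hm
  have hδ₁0 : 0 < δ₁ := hδ.trans_le hδ₁
  have hl1 : 0 < Real.log (1 / δ₁) := Real.log_pos (by rw [lt_div_iff₀ hδ₁0]; linarith)
  have hl : Real.log (1 / δ₁) ≤ Real.log (1 / δ) :=
    Real.log_le_log (by positivity) (one_div_le_one_div_of_le hδ hδ₁)
  have hsε : Real.sqrt ε ≤ Real.sqrt (10 / Real.log (1 / δ₁)) * Real.sqrt (Real.log (1 / δ)) := by
    rw [← Real.sqrt_mul (by positivity)]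
    refine Real.sqrt_le_sqrt (hε'.trans ?_)
    rw [div_mul_eq_mul_div, le_div_iff₀ hl1]
    linarith
  have hεε : Real.sqrt ε * Real.sqrt ε = ε := Real.mul_self_sqrt hε.le
  rw [Real.sqrt_mul (by positivity), Real.sqrt_mul hn'.le, Real.sqrt_mul (Nat.cast_nonneg d)]
  have h1 : 0 < Real.sqrt n := Real.sqrt_pos.2 hn'
  have h2 : 0 < Real.sqrt m := Real.sqrt_pos.2 hm'
  have h3 : 0 < Real.sqrt ε := Real.sqrt_pos.2 hε
  calc Real.sqrt d / (Real.sqrt n * Real.sqrt m * Real.sqrt ε)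
      = Real.sqrt d * Real.sqrt ε / (Real.sqrt n * ε * Real.sqrt m) := by
        rw [div_eq_div_iff (by positivity) (by positivity)]
        nth_rewrite 1 [← hεε]
        ring
    _ ≤ Real.sqrt d * (Real.sqrt (10 / Real.log (1 / δ₁)) * Real.sqrt (Real.log (1 / δ))) /
          (Real.sqrt n * ε * Real.sqrt m) := by gcongr
    _ = _ := by ring

end PhasedSGD

end

/-- The parameters are `p = J + 3/2` and `η = R / (L √(d m n ε))`. `Õ` is made explicit: the power
`k` of the logarithm is absolute, and the constant `K` depends only on `J`, `q` and an upper bound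
`δ₀ < 1` for `δ`. -/
theorem mainTheorem3 :
    ∃ k : ℕ, ∀ J q δ₀ : ℝ, 0 < J → 0 < q → δ₀ < 1 → ∃ K : ℝ, 0 < K ∧
      ∀ (d n m : ℕ) (ε δ L R β : ℝ),
        1 ≤ d → 1 ≤ n → 1 ≤ m → 0 < ε → ε ≤ 10 → 0 < δ → δ < 1 → 0 < L → 0 < R → 0 ≤ β →
        100 / (1 - 1 / (2 : ℝ) ^ q) * Real.log (n / δ) / ε ≤ (n : ℝ) ^ (1 - q) →
        (m : ℝ) ≤ (n : ℝ) ^ J →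
        β ≤ L / R * Real.sqrt (d * m * n * ε) →
        ∀ P : PhasedSGD.Params d,
          P = { n := n, m := m, ε := ε, δ := δ, p := J + 3 / 2, q := q,
                η := R / (L * Real.sqrt (d * m * n * ε)), L := L } →
        Nonempty (PhasedSGD.Schedule P) ∧
        ∀ (s : PhasedSGD.Schedule P) (Z : Type*) [MeasurableSpace Z]
          (Q : MeasureTheory.Measure Z) [MeasureTheory.IsProbabilityMeasure Q]
          (X : Set (PhasedSGD.E d)) (f : PhasedSGD.E d → Z → ℝ)
          (G : PhasedSGD.E d → Z → PhasedSGD.E d) (x₀ : PhasedSGD.E d),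
          PhasedSGD.IsSmoothSCO X f G Q L R β → x₀ ∈ X →
          PhasedSGD.IsUserLevelDP (PhasedSGD.noiseLaw P)
            (fun D ω => (PhasedSGD.algorithm P s X G x₀ D ω).val) ε δ ∧
          (∀ D ω, (PhasedSGD.algorithm P s X G x₀ D ω).val ∈ X ∧
            (PhasedSGD.algorithm P s X G x₀ D ω).grads ≤ n * m) ∧
          (δ ≤ δ₀ →
            MeasureTheory.Integrable
              (fun a : PhasedSGD.Dataset Z P.n P.m × PhasedSGD.Noise P =>
                PhasedSGD.popLoss f Q (PhasedSGD.algorithm P s X G x₀ a.1 a.2).val)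
              ((PhasedSGD.dataLaw Q P.n P.m).prod (PhasedSGD.noiseLaw P)) ∧
            (∫ a : PhasedSGD.Dataset Z P.n P.m × PhasedSGD.Noise P,
                PhasedSGD.popLoss f Q (PhasedSGD.algorithm P s X G x₀ a.1 a.2).val
                ∂((PhasedSGD.dataLaw Q P.n P.m).prod (PhasedSGD.noiseLaw P)))
              - sInf (PhasedSGD.popLoss f Q '' X) ≤
              L * R * (K * (1 + Real.log (n * m * d / δ)) ^ k *
                (1 / Real.sqrt (n * m * ε) +
                  Real.sqrt (d * Real.log (1 / δ)) /
                    (Real.sqrt n * ε * Real.sqrt m)))) := by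
  refine ⟨8, fun J q δ₀ hJ hq hδ₀ => ?_⟩
  -- Replacing `δ₀` by a positive upper bound keeps the logarithm in the constant positive even when
  -- `δ₀ ≤ 0`.
  have hδ₁ : max δ₀ (1 / 2) < 1 := max_lt hδ₀ (by norm_num)
  have hδ₁0 : 0 < max δ₀ (1 / 2) := lt_max_of_lt_right (by norm_num)
  have hlog : 0 < Real.log (1 / max δ₀ (1 / 2)) :=
    Real.log_pos (by rw [lt_div_iff₀ hδ₁0]; linarith)
  have hK := PhasedSGD.rateConst_pos hJ hq
  refine ⟨PhasedSGD.rateConst J q * Real.sqrt (10 / Real.log (1 / max δ₀ (1 / 2))),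
    by positivity, ?_⟩
  intro d n m ε δ L R β hd hn hm hε hε' hδ hδ' hL hR hβ hcond hmJ hβ' P hPeq
  have hnr : (1 : ℝ) ≤ n := by exact_mod_cast hn
  have hmr : (1 : ℝ) ≤ m := by exact_mod_cast hm
  have hdr : (1 : ℝ) ≤ d := by exact_mod_cast hd
  have hP : P.Tuned J R := by
    subst hPeq
    exact { dim_pos := hd, n_pos := hn, m_pos := hm, eps_pos := hε, eps_le := hε'
            delta_pos := hδ, delta_lt_one := hδ', q_pos := hq
            eta_pos := by
              have : 0 < Real.sqrt (d * m * n * ε) := by positivity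
              positivity
            L_pos := hL, J_pos := hJ, R_pos := hR, p_eq := rfl, eta_eq := rfl
            users_large := hcond, m_le := hmJ }
  refine ⟨hP.nonempty_schedule, ?_⟩
  intro s Z _ Q _ X f G x₀ hsco hx₀
  have hPn : P.n = n := by rw [hPeq]
  have hPm : P.m = m := by rw [hPeq]
  have hPε : P.ε = ε := by rw [hPeq]
  have hPδ : P.δ = δ := by rw [hPeq]
  have hPL : P.L = L := by rw [hPeq]
  have hPq : P.q = q := by rw [hPeq]
  have hsco' : PhasedSGD.IsSmoothSCO X f G Q P.L R β := by rwa [hPL]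
  refine ⟨?_, fun D ω => ⟨?_, ?_⟩, fun hδle => ?_⟩
  · rw [← hPε, ← hPδ]
    exact PhasedSGD.algorithm_private hP.toValid hsco' hβ s hx₀
  · rw [PhasedSGD.algorithm_val]
    exact PhasedSGD.stateAfter_mem hsco.nonempty hsco.compact G hx₀ _ _ _ _
  · have h := PhasedSGD.algorithm_grads_le hP.toValid s X G x₀ D ω
    rwa [hPn, hPm] at h
  · have hβ'' : β ≤ P.L / R * Real.sqrt (d * P.m * P.n * P.ε) := by
      rw [hPL, hPm, hPn, hPε]
      exact hβ'
    obtain ⟨hI, hbound⟩ := PhasedSGD.algorithm_excess_le hP hsco' hβ hβ'' s hx₀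
    refine ⟨hI, hbound.trans ?_⟩
    have hrate := PhasedSGD.rate_le (d := d) hn hm hε hε' hδ (hδle.trans (le_max_left δ₀ (1 / 2)))
      hδ₁
    have hΛ := hP.one_le_logFactor
    unfold PhasedSGD.Params.logFactor at hΛ ⊢
    unfold PhasedSGD.Params.rate
    rw [hPL, hPq, hPn, hPm, hPδ, hPε]
    rw [hPn, hPm, hPδ] at hΛ
    refine mul_le_mul_of_nonneg_left ?_ (by positivity)
    -- The privacy term alone already dominates the proved bound; the statistical term only has to
    -- be nonnegative.
    have h0 : 0 ≤ 1 / Real.sqrt (n * m * ε) := by positivity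
    calc _ ≤ PhasedSGD.rateConst J q * (1 + Real.log (n * m * d / δ)) ^ 8 *
          (Real.sqrt (10 / Real.log (1 / max δ₀ (1 / 2))) *
            (Real.sqrt (d * Real.log (1 / δ)) / (Real.sqrt n * ε * Real.sqrt m))) := by
          gcongr
      _ = PhasedSGD.rateConst J q * Real.sqrt (10 / Real.log (1 / max δ₀ (1 / 2))) *
          (1 + Real.log (n * m * d / δ)) ^ 8 *
            (0 + Real.sqrt (d * Real.log (1 / δ)) / (Real.sqrt n * ε * Real.sqrt m)) := by ring
      _ ≤ _ := by gcongr
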